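/- Let $m_1,m_2,m_3\ge 1$ be integers, $m=m_1+m_2+m_3$, and let $\gamma\in S_m$ be the permutation with the three cycles $(1,\dots,m_1)$, $(m_1+1,\dots,m_1+m_2)$, $(m_1+m_2+1,\dots,m)$, whose supports are denoted $[\![m_1]\!],[\![m_2]\!],[\![m_3]\!]$. **Graphs.** Let $T$ be the oriented graph with vertices $1,\dots,m$ and edges $e_x=(\gamma(x),x)$, $1\le x\le m$. For a partition $\pi$ of $[m]$ let $T^\pi$ be the quotient graph (vertices in the same block of $\pi$ are identified; the edges are those of $T$), and for $J\subset\{1,2,3\}$ let $T_J^\pi$ be its subgraph formed by the vertices and edges coming from $[\![m_j]\!]$, $j\in J$. The elementarization $\overline G$ of an oriented graph $G$ is the unoriented graph (loops allowed) in which all edges of $G$ connecting the same pair of vertices are replaced by one edge, whose multiplicity is the number of these edges. A circuit is a connected subgraph in which all vertices have degree $2$, a loop contributing $2$ to the degree. An oriented graph $G$ is a *double tree* if $\overline G$ is a tree and every edge of $\overline G$ has multiplicity $2$ and consists of two edges of opposite orientations. For $j\neq k$, $T_{\{j,k\}}^\pi$ is a *double unicircuit graph* if $\overline{T_{\{j,k\}}^\pi}$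 is connected with a single circuit (equivalently, connected with as many vertices as edges), each of its edges has multiplicity $2$ and consists of two edges of opposite orientations (two loops at the same vertex count as such), and each edge in the circuit contains an edge from $[\![m_j]\!]$ and one from $[\![m_k]\!]$. Two subgraphs are joined along an edge if the edge belongs to both elementarizations and the subgraphs share no vertices other than its end points. The graph $T^\pi$ is - of *2-6-tree type* if $T_{\{1\}}^\pi,T_{\{2\}}^\pi,T_{\{3\}}^\pi$ are double trees joined along one common edge; - of *2-4-4-tree type* if $T_{\{1\}}^\pi,T_{\{2\}}^\pi,T_{\{3\}}^\pi$ are double trees joined along two distinct edges (two of them along an edge, and the third one to their union along another edge); - of *2-4 uniloop type* if for some $\{i,j,k\}=\{1,2,3\}$ and some vertex $U$: $T_{\{i\}}^\pi$ has two loops at $U$ and removing them leaves a double tree; $T_{\{j,k\}}^\pi$ is a double unicircuit graph the circuit of whose elementarization is a loop at $U$; and $U$ is the only common vertex of $T_{\{i\}}^\pi$ and $T_{\{j,k\}}^\pi$; - of *2-4 unicircuit type* if for some $\{i,j,k\}=\{1,2,3\}$, $T_{\{i\}}^\pi$ is a double tree, $T_{\{j,k\}}^\pi$ is a double unicircuit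 graph, and the two are joined along some edge. Let $\mathcal T_{2,6},\mathcal T_{2,4,4},\mathcal{UL}_{2,4},\mathcal{UC}_{2,4}$ be the sets of quotient graphs $T^\pi$ of these four types, $\pi$ ranging over the partitions of $[m]$ (distinct partitions give distinct quotient graphs). **Partitioned permutations.** For a partition or permutation, $\#$ is the number of blocks or cycles (fixed points included) and $|\cdot|=m-\#(\cdot)$. A permutation is also regarded as the partition into its cycles. Consider pairs $(\mathcal V,\pi)$ of a partition $\mathcal V$ of $[m]$ and $\pi\in S_m$ with $\pi\le\mathcal V$. - $\mathcal{PS}_{NC}^{(1,1,1)}$, respectively $\mathcal{PS}_{NC}^{(2,1,1)}$, is the set of such pairs with $|\pi|+|\pi^{-1}\gamma|=|\gamma|$, $\pi\le\gamma$, $|\mathcal V|=|\pi|+2$, $\mathcal V\vee\gamma=1_m$, and one block of $\mathcal V$ containing three cycles of $\pi$, respectively two blocks of $\mathcal V$ each containing two cycles of $\pi$. The subsets where all cycles of $\pi$ have size $2$ are $\mathcal{PS}_{NC_2}^{(1,1,1)}$ and $\mathcal{PS}_{NC_2}^{(2,1,1)}$. - $\mathcal{PS}_{NC_{2,1,1}}^{(1,1,1)}\subset\mathcal{PS}_{NC}^{(1,1,1)}$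 is the subset where for some $\{i_1,i_2,i_3\}=\{1,2,3\}$ all cycles of $\pi$ have size $2$ except for exactly one cycle of size $1$ in each of $[\![m_{i_1}]\!]$ and $[\![m_{i_2}]\!]$, and the block of $\mathcal V$ with three cycles is the union of these two and a cycle in $[\![m_{i_3}]\!]$. - $\mathcal{PS}_{NC}^{(1,1)}$ is the set of such pairs for which there is $\{i_1,i_2,i_3\}=\{1,2,3\}$ with $\#(\pi)+\#(\pi^{-1}\gamma)=m+1$, $\pi\vee\gamma=\rho:=\{[\![m_{i_1}]\!]\cup[\![m_{i_2}]\!],[\![m_{i_3}]\!]\}$, $|\mathcal V|=|\pi|+1$ and $\mathcal V\vee\rho=1_m$. The subset where all cycles of $\pi$ have size $2$ is $\mathcal{PS}_{NC_2}^{(1,1)}$. A cycle of $\pi$ meeting two cycles of $\gamma$ is a through string. $\mathcal{PS}_{NC_2^{(2)}}^{(1,1)}\subset\mathcal{PS}_{NC_2}^{(1,1)}$ is the subset with exactly two through strings, and $\mathcal{PS}_{NC_2}^{(1,1)(t)}\subset\mathcal{PS}_{NC_2}^{(1,1)}$ the subset with exactly one through string where the block of $\mathcal V$ containing two cycles of $\pi$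 is the union of the through string and a cycle in $[\![m_{i_3}]\!]$. **Claim.** For all $m_1,m_2,m_3\ge1$: $$|\mathcal T_{2,6}|=4\,|\mathcal{PS}_{NC_2}^{(1,1,1)}|,\qquad |\mathcal T_{2,4,4}|=4\,|\mathcal{PS}_{NC_2}^{(2,1,1)}|,\qquad |\mathcal{UL}_{2,4}|=|\mathcal{PS}_{NC_{2,1,1}}^{(1,1,1)}|=|\mathcal{PS}_{NC_2}^{(1,1)(t)}|,$$ $$|\mathcal{UC}_{2,4}|=2\,|\mathcal{PS}_{NC_2}^{(1,1)}|-2\,|\mathcal{PS}_{NC_2^{(2)}}^{(1,1)}|-2\,|\mathcal{PS}_{NC_2}^{(1,1)(t)}|.$$ -/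

import Mathlib

namespace LimitGraphs

/-! ### Oriented graphs, quotients and elementarizations -/

/-- An oriented graph with vertices in `V` and labelled edges in `E`; loops and multiple edges are
allowed. -/
structure OrientedGraph (V E : Type*) where
  vertexSet : Set V
  edgeSet : Set E
  source : E → V
  target : E → V
  source_mem : ∀ e ∈ edgeSet, source e ∈ vertexSet
  target_mem : ∀ e ∈ edgeSet, target e ∈ vertexSet

namespace OrientedGraph

variable {V E : Type*}

/-- The quotient graph `T^π`: vertices in the same block of `π` are identified, so the vertices are
blocks of `π`, and the edges are those of `T`. -/
def quotient (T : OrientedGraph V E) (π : Setoid V) : OrientedGraph (Quotient π) E where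
  vertexSet := Quotient.mk π '' T.vertexSet
  edgeSet := T.edgeSet
  source e := Quotient.mk π (T.source e)
  target e := Quotient.mk π (T.target e)
  source_mem e he := ⟨_, T.source_mem e he, rfl⟩
  target_mem e he := ⟨_, T.target_mem e he, rfl⟩

/-- Remove the edges in `F`, keeping all vertices. -/
def deleteEdges (T : OrientedGraph V E) (F : Set E) : OrientedGraph V E where
  vertexSet := T.vertexSet
  edgeSet := T.edgeSet \ F
  source := T.source
  target := T.target
  source_mem e he := T.source_mem e he.1
  target_mem e he := T.target_mem e he.1

/-- The unordered pair of end points of an edge. Two edges are equivalent when these agree. -/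
def ends (T : OrientedGraph V E) (e : E) : Sym2 V := s(T.source e, T.target e)

/-- The equivalence class of edges whose pair of end points is `ε`. Its cardinality is the
multiplicity of `ε`. -/
def edgeClass (T : OrientedGraph V E) (ε : Sym2 V) : Set E := {e ∈ T.edgeSet | T.ends e = ε}

/-- Two edges connecting the same pair of vertices in opposite orientations. -/
def Opposite (T : OrientedGraph V E) (e f : E) : Prop :=
  T.source e = T.target f ∧ T.target e = T.source f

/-- The elementarization: the unoriented graph on the same vertices with one edge for every class
of equivalent edges (the class being represented by its pair of end points). -/
def elementarization (T : OrientedGraph V E) : Graph V (Sym2 V) where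
  vertexSet := T.vertexSet
  IsLink ε u v := ε = s(u, v) ∧ ∃ e ∈ T.edgeSet, T.ends e = ε
  edgeSet := {ε | ∃ e ∈ T.edgeSet, T.ends e = ε}
  isLink_symm ε _ := ⟨fun u v h => ⟨h.1.trans Sym2.eq_swap, h.2⟩⟩
  eq_or_eq_of_isLink_of_isLink ε x y v w h h' := by
    have h2 := h.1.symm.trans h'.1
    rw [Sym2.eq_iff] at h2
    rcases h2 with h2 | h2
    · exact Or.inl h2.1
    · exact Or.inr h2.1
  edge_mem_iff_exists_isLink ε := by
    induction ε with
    | h u v => exact ⟨fun h => ⟨u, v, rfl, h⟩, fun ⟨_, _, h⟩ => h.2⟩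
  left_mem_of_isLink ε x y h := by
    obtain ⟨h1, e, he, h2⟩ := h
    have h3 : s(T.source e, T.target e) = s(x, y) := h2.trans h1
    rw [Sym2.eq_iff] at h3
    rcases h3 with h3 | h3
    · exact h3.1 ▸ T.source_mem e he
    · exact h3.2 ▸ T.target_mem e he

end OrientedGraph

/-! ### Unoriented graphs: connectedness, trees, circuits -/

section Unoriented

variable {α β : Type*}

/-- Nonempty, and any two vertices are joined by a path. -/
def IsConnected (G : Graph α β) : Prop := G.toSimpleGraph.Connected

/-- The degree of a vertex; a loop contributes two. -/
noncomputable def degree (G : Graph α β) (v : α) : ℕ :=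
  (G.incidenceSet v).ncard + (G.loopSet v).ncard

/-- `C` is a circuit of `G`: a connected subgraph in which every vertex has degree `2`. -/
def IsCircuit (G C : Graph α β) : Prop :=
  C ≤ G ∧ IsConnected C ∧ ∀ v ∈ C.vertexSet, degree C v = 2

/-- `G`, a graph without parallel edges, is a tree. -/
def IsTree (G : Graph α (Sym2 α)) : Prop := G.Loopless ∧ G.toSimpleGraph.IsTree

/-- `G` is connected with a single circuit, i.e. it is connected and has as many vertices as
edges. -/
def IsUnicircuit (G : Graph α β) : Prop :=
  IsConnected G ∧ G.vertexSet.ncard = G.edgeSet.ncard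

end Unoriented

namespace OrientedGraph

variable {V E : Type*}

/-- Every edge of the elementarization has multiplicity two and consists of two edges with opposite
orientations. -/
def IsDoubled (T : OrientedGraph V E) : Prop :=
  ∀ ε ∈ T.elementarization.edgeSet, ∃ e f, e ≠ f ∧ T.edgeClass ε = {e, f} ∧ T.Opposite e f

/-- `T` is a double tree. -/
def IsDoubleTree (T : OrientedGraph V E) : Prop :=
  IsTree T.elementarization ∧ T.IsDoubled

/-- `T` has two loops over the vertex `U`, and removing them results in a double tree. -/
def IsDoubleUniloopAt (T : OrientedGraph V E) (U : V) : Prop :=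
  ∃ e ∈ T.edgeSet, ∃ f ∈ T.edgeSet, e ≠ f ∧ T.ends e = s(U, U) ∧ T.ends f = s(U, U) ∧
    (T.deleteEdges {e, f}).IsDoubleTree

/-- The union of `S` and `T` is obtained by joining `S` and `T` along the edge `ε`: they share the
edge `ε` and no vertices besides its end points. -/
def JoinedAlongEdge (S T : OrientedGraph V E) (ε : Sym2 V) : Prop :=
  ε ∈ S.elementarization.edgeSet ∧ ε ∈ T.elementarization.edgeSet ∧
    S.vertexSet ∩ T.vertexSet = {v | v ∈ ε}

/-- The union of `S` and `T` is obtained by joining `S` and `T` at the vertex `U`. -/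
def JoinedAtVertex (S T : OrientedGraph V E) (U : V) : Prop :=
  S.vertexSet ∩ T.vertexSet = {U}

end OrientedGraph

/-! ### The basic cycles and the types of quotient graphs -/

/-- The ground set `[m₁ + m₂ + m₃]`, with the elements of the `j`-th basic cycle written as
`⟨j, i⟩`. -/
abbrev Point (m : Fin 3 → ℕ) : Type := Σ j : Fin 3, Fin (m j)

/-- The permutation `γ_{m₁,m₂,m₃}`, with one cycle of length `mⱼ` for every `j`. -/
def gamma (m : Fin 3 → ℕ) : Equiv.Perm (Point m) :=
  Equiv.sigmaCongrRight fun j => finRotate (m j)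

/-- The union of the basic cycles with index in `J`; the edge labelled `x` goes from `γ x` to
`x`. -/
def cycleGraph (m : Fin 3 → ℕ) (J : Set (Fin 3)) : OrientedGraph (Point m) (Point m) where
  vertexSet := {x | x.1 ∈ J}
  edgeSet := {x | x.1 ∈ J}
  source := gamma m
  target := id
  source_mem _ hx := hx
  target_mem _ hx := hx

/-- The graph `T_J^π`, i.e. the part of `T^π` formed by the basic cycles with index in `J`. Its
vertices are the blocks of `π` that meet these cycles. -/
def quotientGraph {m : Fin 3 → ℕ} (π : Setoid (Point m)) (J : Set (Fin 3)) :
    OrientedGraph (Quotient π) (Point m) :=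
  (cycleGraph m J).quotient π

/-- `T_{j,k}^π` is a double unicircuit graph: its elementarization is a unicircuit graph, all edges
of the elementarization consist of two edges with opposite orientations, and those in the circuit
are `(j,k)`-edges. -/
def IsDoubleUnicircuit {m : Fin 3 → ℕ} (π : Setoid (Point m)) (j k : Fin 3) : Prop :=
  IsUnicircuit (quotientGraph π {j, k}).elementarization ∧
  (quotientGraph π {j, k}).IsDoubled ∧
  ∀ C, IsCircuit (quotientGraph π {j, k}).elementarization C → ∀ ε ∈ C.edgeSet,
    (∃ x ∈ (quotientGraph π {j, k}).edgeClass ε, x.1 = j) ∧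
    (∃ x ∈ (quotientGraph π {j, k}).edgeClass ε, x.1 = k)

/-- All three graphs `T_{mⱼ}^π` are double trees. -/
def AllDoubleTrees {m : Fin 3 → ℕ} (π : Setoid (Point m)) : Prop :=
  ∀ j, (quotientGraph π {j}).IsDoubleTree

/-- The quotient graphs of 2-6-tree type: three double trees joined along the same edge.
A quotient graph is recorded by the partition `π` (its set of vertices). -/
def T26 (m : Fin 3 → ℕ) : Set (Setoid (Point m)) :=
  {π | AllDoubleTrees π ∧ ∃ ε, ∀ i j, i ≠ j →
    (quotientGraph π {i}).JoinedAlongEdge (quotientGraph π {j}) ε}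

/-- The quotient graphs of 2-4-4-tree type: three double trees joined along two distinct edges,
i.e. two of them are joined along an edge and the third one is joined to the result along another
edge. -/
def T244 (m : Fin 3 → ℕ) : Set (Setoid (Point m)) :=
  {π | AllDoubleTrees π ∧ ∃ i j k : Fin 3, i ≠ j ∧ i ≠ k ∧ j ≠ k ∧ ∃ ε ε', ε ≠ ε' ∧
    (quotientGraph π {i}).JoinedAlongEdge (quotientGraph π {j}) ε ∧
    (quotientGraph π {i, j}).JoinedAlongEdge (quotientGraph π {k}) ε'}

/-- The quotient graphs of 2-4 uniloop type. -/
def UL24 (m : Fin 3 → ℕ) : Set (Setoid (Point m)) :=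
  {π | ∃ i j k : Fin 3, i ≠ j ∧ i ≠ k ∧ j ≠ k ∧ ∃ U : Quotient π,
    (quotientGraph π {i}).IsDoubleUniloopAt U ∧
    IsDoubleUnicircuit π j k ∧
    (∃ C, IsCircuit (quotientGraph π {j, k}).elementarization C ∧ C.edgeSet = {s(U, U)}) ∧
    (quotientGraph π {i}).JoinedAtVertex (quotientGraph π {j, k}) U}

/-- The quotient graphs of 2-4 unicircuit type. -/
def UC24 (m : Fin 3 → ℕ) : Set (Setoid (Point m)) :=
  {π | ∃ i j k : Fin 3, i ≠ j ∧ i ≠ k ∧ j ≠ k ∧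
    (quotientGraph π {i}).IsDoubleTree ∧ IsDoubleUnicircuit π j k ∧
    ∃ ε, (quotientGraph π {i}).JoinedAlongEdge (quotientGraph π {j, k}) ε}

/-! ### Partitioned permutations -/

section Permutations

variable {X : Type*}

/-- The number of blocks of a partition. -/
noncomputable def numBlocks (U : Setoid X) : ℕ := Nat.card (Quotient U)

/-- The length `|U| = n - #(U)` of a partition. -/
noncomputable def partitionLength (U : Setoid X) : ℕ := Nat.card X - numBlocks U

/-- The partition into the cycles of a permutation (fixed points are cycles of size one). -/
abbrev cycles (π : Equiv.Perm X) : Setoid X := Equiv.Perm.SameCycle.setoid π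

/-- The length `|π| = n - #(π)` of a permutation. -/
noncomputable def permLength (π : Equiv.Perm X) : ℕ := partitionLength (cycles π)

/-- The number of elements of a cycle. -/
noncomputable def cycleSize (π : Equiv.Perm X) (c : Quotient (cycles π)) : ℕ :=
  {x | Quotient.mk (cycles π) x = c}.ncard

/-- All cycles of `π` have two elements. -/
def IsPairing (π : Equiv.Perm X) : Prop := ∀ c, cycleSize π c = 2

/-- The set of cycles of `π` contained in the block `b` of `V`. -/
def cyclesIn (V : Setoid X) (π : Equiv.Perm X) (b : Quotient V) : Set (Quotient (cycles π)) :=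
  {c | ∀ x, Quotient.mk (cycles π) x = c → Quotient.mk V x = b}

end Permutations

section PartitionedPermutations

variable {m : Fin 3 → ℕ}

/-- `NC(m₁) × NC(m₂) × NC(m₃)`. -/
def NCDiscs (m : Fin 3 → ℕ) : Set (Equiv.Perm (Point m)) :=
  {π | permLength π + permLength (π⁻¹ * gamma m) = permLength (gamma m) ∧
    cycles π ≤ cycles (gamma m)}

/-- The partition into the `k`-th cycle of `γ` and the union of the two other cycles. -/
def isolate (m : Fin 3 → ℕ) (k : Fin 3) : Setoid (Point m) :=
  Setoid.ker fun x => x.1 = k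

/-- `S_NC(mᵢ, mⱼ) × NC(mₖ)`, where `{i, j, k} = {1, 2, 3}`. -/
def NCAnnulusDisc (m : Fin 3 → ℕ) (k : Fin 3) : Set (Equiv.Perm (Point m)) :=
  {π | numBlocks (cycles π) + numBlocks (cycles (π⁻¹ * gamma m)) = (∑ j, m j) + 1 ∧
    cycles π ⊔ cycles (gamma m) = isolate m k}

/-- The cycle `c` of `π` is contained in the `j`-th cycle of `γ`. -/
def CycleLiesIn (π : Equiv.Perm (Point m)) (c : Quotient (cycles π)) (j : Fin 3) : Prop :=
  ∀ x, Quotient.mk (cycles π) x = c → x.1 = j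

/-- The set of through strings of a pairing `π`: its cycles that consist of elements from distinct
cycles of `γ`. -/
def throughStrings (π : Equiv.Perm (Point m)) : Set (Quotient (cycles π)) :=
  {c | ∃ x y, Quotient.mk (cycles π) x = c ∧ Quotient.mk (cycles π) y = c ∧ x.1 ≠ y.1}

/-- `PS_NC^{(1,1,1)}`: one block of `V` contains three cycles of `π`. -/
def PS111 (m : Fin 3 → ℕ) : Set (Setoid (Point m) × Equiv.Perm (Point m)) :=
  {p | cycles p.2 ≤ p.1 ∧ p.2 ∈ NCDiscs m ∧
    partitionLength p.1 = permLength p.2 + 2 ∧ p.1 ⊔ cycles (gamma m) = ⊤ ∧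
    {b | (cyclesIn p.1 p.2 b).ncard = 3}.ncard = 1}

/-- `PS_NC^{(2,1,1)}`: two blocks of `V` each contain two cycles of `π`. -/
def PS211 (m : Fin 3 → ℕ) : Set (Setoid (Point m) × Equiv.Perm (Point m)) :=
  {p | cycles p.2 ≤ p.1 ∧ p.2 ∈ NCDiscs m ∧
    partitionLength p.1 = permLength p.2 + 2 ∧ p.1 ⊔ cycles (gamma m) = ⊤ ∧
    {b | (cyclesIn p.1 p.2 b).ncard = 2}.ncard = 2}

/-- `PS_NC^{(1,1)}`: `π` connects two cycles of `γ`, and `V` joins a cycle of `π` on these with a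
cycle of `π` on the third one. -/
def PS11 (m : Fin 3 → ℕ) : Set (Setoid (Point m) × Equiv.Perm (Point m)) :=
  {p | cycles p.2 ≤ p.1 ∧ ∃ k, p.2 ∈ NCAnnulusDisc m k ∧
    partitionLength p.1 = permLength p.2 + 1 ∧ p.1 ⊔ isolate m k = ⊤}

/-- `PS_{NC₂}^{(1,1,1)}`. -/
def PS111NC2 (m : Fin 3 → ℕ) : Set (Setoid (Point m) × Equiv.Perm (Point m)) :=
  {p ∈ PS111 m | IsPairing p.2}

/-- `PS_{NC₂}^{(2,1,1)}`. -/
def PS211NC2 (m : Fin 3 → ℕ) : Set (Setoid (Point m) × Equiv.Perm (Point m)) :=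
  {p ∈ PS211 m | IsPairing p.2}

/-- `PS_{NC_{2,1,1}}^{(1,1,1)}`: on two of the cycles of `γ`, `π` consists of cycles of size two and
exactly one of size one (`c₁` and `c₂`), on the third it consists of cycles of size two, and the
block of `V` that contains three cycles of `π` consists of `c₁`, `c₂` and one cycle on the third. -/
def PS111NC211 (m : Fin 3 → ℕ) : Set (Setoid (Point m) × Equiv.Perm (Point m)) :=
  {p ∈ PS111 m | ∃ i₁ i₂ i₃ : Fin 3, i₁ ≠ i₂ ∧ i₁ ≠ i₃ ∧ i₂ ≠ i₃ ∧ ∃ c₁ c₂ c₃,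
    CycleLiesIn p.2 c₁ i₁ ∧ CycleLiesIn p.2 c₂ i₂ ∧ CycleLiesIn p.2 c₃ i₃ ∧
    cycleSize p.2 c₁ = 1 ∧ cycleSize p.2 c₂ = 1 ∧
    (∀ c, c ≠ c₁ → c ≠ c₂ → cycleSize p.2 c = 2) ∧
    ∃ b, cyclesIn p.1 p.2 b = {c₁, c₂, c₃}}

/-- `PS_{NC₂}^{(1,1)}`. -/
def PS11NC2 (m : Fin 3 → ℕ) : Set (Setoid (Point m) × Equiv.Perm (Point m)) :=
  {p ∈ PS11 m | IsPairing p.2}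

/-- `PS_{NC₂^{(2)}}^{(1,1)}`: exactly two through strings. -/
def PS11NC2Two (m : Fin 3 → ℕ) : Set (Setoid (Point m) × Equiv.Perm (Point m)) :=
  {p ∈ PS11NC2 m | (throughStrings p.2).ncard = 2}

/-- `PS_{NC₂}^{(1,1)(t)}`: there is exactly one through string `c₁`, and the block of `V` that
contains two cycles of `π` is the union of `c₁` and a cycle `c₂` lying on the isolated cycle
of `γ`. -/
def PS11NC2Through (m : Fin 3 → ℕ) : Set (Setoid (Point m) × Equiv.Perm (Point m)) :=
  {p ∈ PS11NC2 m | ∃ c₁ c₂ k, throughStrings p.2 = {c₁} ∧ p.2 ∈ NCAnnulusDisc m k ∧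
    CycleLiesIn p.2 c₂ k ∧ ∃ b, cyclesIn p.1 p.2 b = {c₁, c₂}}

end PartitionedPermutations

end LimitGraphs

/-! Everything is encoded by partitions of the set of labels. The vertices of `T^π` are the blocks
of `π`; its elementarized edges are the blocks of `edgeSetoid (gamma m) π`, abbreviated `E`. Pairing
opposite edges gives a fixed point free involution `σ`, and the paired edges are opposite exactly
when `cycles (γ * σ) ≤ π`. A quotient graph is therefore sent to the partitioned permutation `(E,
σ)`, where `σ` pairs edges inside each basic cycle for the tree types, and inside the annulus and
the remaining disc separately for the other types.

In the other direction, given `(V, σ)`, choose an orientation `f` that takes opposite values on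
paired edges and identify edges of the same `V`-block according to `f`. The result is `merged γ V σ
f`. The non-crossing condition is an Euler relation: `#(γσ) = #σ + 3` for three discs and `#(γσ) =
#σ + 1` for an annulus and a disc. Each identification of two edges loses at most two vertices,
which bounds the number of vertices below. Connectedness bounds vertices by edges plus one. These
bounds meet, and the equalities force `E = V` and the required shape of the graph
(`TreeForm.tree_structure`, `IsAnnular.union_structure`). Conversely, a graph of one of the types
has exactly as many vertices as the merged partition refining it (`exists_merged_le`), so it is that
merged partition.

The multiplicities come from counting orientations (`ncard_merged`). There are `2 ^ #σ` of them, and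
two give the same quotient exactly when they differ by reversals on whole blocks of `V`, which
leaves `2 ^ (#σ - #V)` quotients. This is 4 for trees, where `V` has two blocks fewer than `σ`, and
2 for the unicircuit type, where it has one fewer. If the joined edge is a loop, orientations do not
matter and the quotient is unique; this is the uniloop type.

For the annulus, the through strings are the edges of the circuit. A circuit in an elementarization
is a loop or has at least three edges. Two through strings instead fold onto one edge and give a
tree, so these pairs are discarded (`IsAnnular.ncard_eq_two`, `IsDoubleUnicircuit.ncard_ne_two`). A
single through string is a loop (`IsAnnular.loop_of_through`), and a graph joined there is a
uniloop. Finally, cutting this string into two fixed points leaves `V` unchanged and turns the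
annulus relation into the disc relation (`image_fst_PS111NC211`). -/

namespace LimitGraphs
open Set

/-! ### Counting the blocks of a partition, and merging two blocks -/

section Blocks

variable {X : Type*}

/-- The number of blocks of `W` that meet `S`. -/
noncomputable def blocks (W : Setoid X) (S : Set X) : ℕ := (Quotient.mk W '' S).ncard

theorem mk_eq_mk {W : Setoid X} {p q : X} : Quotient.mk W p = Quotient.mk W q ↔ W p q :=
  Quotient.eq

theorem blocks_univ (W : Setoid X) : blocks W univ = numBlocks W := by
  have : Quotient.mk W '' univ = univ := by
    rw [image_univ]; exact Quotient.mk_surjective.range_eq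
  rw [blocks, this, numBlocks, ncard_univ]

theorem blocks_eq_ncard_image {Y : Type*} {W : Setoid X} {S : Set X} (g : X → Y)
    (h : ∀ p ∈ S, ∀ q ∈ S, W p q ↔ g p = g q) : blocks W S = (g '' S).ncard := by
  classical
  -- The value on classes that miss `S` is arbitrary; only classes meeting `S` are evaluated below.
  let F : Quotient W → Y := fun c => if hc : ∃ p ∈ S, Quotient.mk W p = c then g hc.choose else g c.out
  have hF : ∀ p ∈ S, F (Quotient.mk W p) = g p := by
    intro p hp
    have hc : ∃ q ∈ S, Quotient.mk W q = Quotient.mk W p := ⟨p, hp, rfl⟩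
    simp only [F, dif_pos hc]
    exact (h _ hc.choose_spec.1 _ hp).1 (mk_eq_mk.1 hc.choose_spec.2)
  have h1 : g '' S = F '' (Quotient.mk W '' S) := by
    rw [image_image]
    exact image_congr fun p hp => (hF p hp).symm
  rw [h1, InjOn.ncard_image, blocks]
  rintro _ ⟨p, hp, rfl⟩ _ ⟨q, hq, rfl⟩ hpq
  rw [hF p hp, hF q hq] at hpq
  exact mk_eq_mk.2 ((h p hp q hq).2 hpq)

theorem blocks_congr {W W' : Setoid X} {S : Set X} (h : ∀ p ∈ S, ∀ q ∈ S, W p q ↔ W' p q) :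
    blocks W S = blocks W' S :=
  blocks_eq_ncard_image (Quotient.mk W') fun p hp q hq => (h p hp q hq).trans mk_eq_mk.symm

/-- The setoid obtained from `W` by merging the blocks of `a` and `b`. -/
def glue (W : Setoid X) (a b : X) : Setoid X where
  r p q := W p q ∨ (W p a ∧ W q b) ∨ (W p b ∧ W q a)
  iseqv := by
    refine ⟨fun p => Or.inl (W.refl' p), ?_, ?_⟩
    · rintro p q (h | ⟨h, h'⟩ | ⟨h, h'⟩)
      · exact Or.inl (W.symm' h)
      · exact Or.inr (Or.inr ⟨h', h⟩)
      · exact Or.inr (Or.inl ⟨h', h⟩)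
    · rintro p q r (h | ⟨h, h'⟩ | ⟨h, h'⟩) (k | ⟨k, k'⟩ | ⟨k, k'⟩)
      · exact Or.inl (W.trans' h k)
      · exact Or.inr (Or.inl ⟨W.trans' h k, k'⟩)
      · exact Or.inr (Or.inr ⟨W.trans' h k, k'⟩)
      · exact Or.inr (Or.inl ⟨h, W.trans' (W.symm' k) h'⟩)
      · exact Or.inr (Or.inl ⟨h, k'⟩)
      · exact Or.inl (W.trans' h (W.symm' k'))
      · exact Or.inr (Or.inr ⟨h, W.trans' (W.symm' k) h'⟩)
      · exact Or.inl (W.trans' h (W.symm' k'))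
      · exact Or.inr (Or.inr ⟨h, k'⟩)

theorem le_glue (W : Setoid X) (a b : X) : W ≤ glue W a b := fun _ _ h => Or.inl h

theorem glue_self (W : Setoid X) (a b : X) : glue W a b a b :=
  Or.inr (Or.inl ⟨W.refl' a, W.refl' b⟩)

theorem glue_le {W W' : Setoid X} {a b : X} (h : W ≤ W') (hab : W' a b) : glue W a b ≤ W' := by
  rintro p q (h1 | ⟨h1, h2⟩ | ⟨h1, h2⟩)
  · exact h h1
  · exact W'.trans' (h h1) (W'.trans' hab (W'.symm' (h h2)))
  · exact W'.trans' (h h1) (W'.trans' (W'.symm' hab) (W'.symm' (h h2)))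

theorem glue_congr {W : Setoid X} {a b a' b' : X} (ha : W a a') (hb : W b b') :
    glue W a b = glue W a' b' := by
  apply le_antisymm
  · exact glue_le (le_glue _ _ _) (Or.inr (Or.inl ⟨ha, hb⟩))
  · exact glue_le (le_glue _ _ _) (Or.inr (Or.inl ⟨W.symm' ha, W.symm' hb⟩))

theorem glue_comm (W : Setoid X) (a b : X) : glue W a b = glue W b a := by
  apply le_antisymm
  · exact glue_le (le_glue _ _ _) ((glue W b a).symm' (glue_self _ _ _))
  · exact glue_le (le_glue _ _ _) ((glue W a b).symm' (glue_self _ _ _))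

variable [Finite X]

omit [Finite X] in
theorem image_mk_of_le {W W' : Setoid X} (h : W ≤ W') (S : Set X) :
    Quotient.mk W' '' S = Quotient.map' id (fun _ _ h' => h h') '' (Quotient.mk W '' S) := by
  rw [image_image]; rfl

theorem blocks_anti {W W' : Setoid X} (h : W ≤ W') (S : Set X) : blocks W' S ≤ blocks W S := by
  rw [blocks, image_mk_of_le h]
  exact ncard_image_le (toFinite _)

/-- Blocks of `W` meeting `S` map onto blocks of `W'` meeting `S`, so a surjection between sets of
equal size is injective. This turns every equality of counts below into an equality of partitions.
-/
theorem rel_of_blocks_le {W W' : Setoid X} (h : W ≤ W') {S : Set X}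
    (hb : blocks W S ≤ blocks W' S) {p q : X} (hp : p ∈ S) (hq : q ∈ S) (hpq : W' p q) :
    W p q := by
  have h1 : (Quotient.map' id (fun _ _ h' => h h') '' (Quotient.mk W '' S)).ncard =
      (Quotient.mk W '' S).ncard := by
    rw [← image_mk_of_le h]
    exact le_antisymm (blocks_anti h S) hb
  have h2 := injOn_of_ncard_image_eq h1 (toFinite _)
  exact mk_eq_mk.1 (h2 ⟨p, hp, rfl⟩ ⟨q, hq, rfl⟩ (Quotient.sound hpq))

theorem eq_of_blocks_le {W W' : Setoid X} (h : W ≤ W') (hb : blocks W univ ≤ blocks W' univ) :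
    W = W' :=
  le_antisymm h fun _ _ h' => rel_of_blocks_le h hb (mem_univ _) (mem_univ _) h'

/-- Outside the block of `b`, distinct blocks stay distinct after gluing, so at most one block is
lost. -/
theorem blocks_le_blocks_glue (W : Setoid X) (a b : X) (S : Set X) :
    blocks W S ≤ blocks (glue W a b) S + 1 := by
  classical
  have h1 : ((Quotient.mk W '' S) \ {Quotient.mk W b}).ncard ≤ blocks (glue W a b) S := by
    rw [blocks, image_mk_of_le (le_glue W a b)]
    rw [← InjOn.ncard_image (s := (Quotient.mk W '' S) \ {Quotient.mk W b})
      (f := Quotient.map' id (fun _ _ h' => le_glue W a b h'))]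
    · exact ncard_le_ncard (image_mono sdiff_subset) (toFinite _)
    · rintro _ ⟨⟨p, hp, rfl⟩, hpb⟩ _ ⟨⟨q, hq, rfl⟩, hqb⟩ hpq
      have h2 : glue W a b p q := Quotient.exact hpq
      rcases h2 with h2 | h2 | h2
      · exact mk_eq_mk.2 h2
      · exact absurd (mk_eq_mk.2 h2.2) hqb
      · exact absurd (mk_eq_mk.2 h2.1) hpb
  have h2 := ncard_le_ncard_sdiff_add_ncard (Quotient.mk W '' S) {Quotient.mk W b} (toFinite _)
  rw [ncard_singleton] at h2
  unfold blocks at *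
  omega

theorem blocks_glue_univ {W : Setoid X} {a b : X} (h : ¬ W a b) :
    blocks (glue W a b) univ + 1 = blocks W univ := by
  have h1 := blocks_le_blocks_glue W a b univ
  have h2 : ¬ blocks W univ ≤ blocks (glue W a b) univ := fun h2 =>
    h (rel_of_blocks_le (le_glue W a b) h2 (mem_univ _) (mem_univ _) (glue_self _ _ _))
  omega

/-- Inclusion–exclusion. With `W = π` the last term counts shared vertices, with `W` the edge
partition it counts shared edges. -/
theorem blocks_union (W : Setoid X) (S T : Set X) :
    blocks W S + blocks W T =
      blocks W (S ∪ T) + (Quotient.mk W '' S ∩ Quotient.mk W '' T).ncard := by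
  rw [blocks, blocks, blocks, image_union, ncard_union_add_ncard_inter]

theorem blocks_union_of_not_rel {W : Setoid X} {S T : Set X}
    (h : ∀ p ∈ S, ∀ q ∈ T, ¬ W p q) : blocks W (S ∪ T) = blocks W S + blocks W T := by
  have h1 := blocks_union W S T
  have h2 : Quotient.mk W '' S ∩ Quotient.mk W '' T = ∅ := by
    rw [eq_empty_iff_forall_notMem]
    rintro _ ⟨⟨p, hp, rfl⟩, q, hq, hpq⟩
    exact h p hp q hq (W.symm' (mk_eq_mk.1 hpq))
  rw [h2, ncard_empty] at h1
  omega

theorem blocks_diff_class (W : Setoid X) {S : Set X} {y : X} (hy : y ∈ S) :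
    blocks W (S \ {z | W z y}) + 1 = blocks W S := by
  have h1 : Quotient.mk W '' (S \ {z | W z y}) = (Quotient.mk W '' S) \ {Quotient.mk W y} := by
    ext c
    constructor
    · rintro ⟨p, ⟨hp, hpy⟩, rfl⟩
      exact ⟨⟨p, hp, rfl⟩, fun h => hpy (mk_eq_mk.1 h)⟩
    · rintro ⟨⟨p, hp, rfl⟩, hpy⟩
      exact ⟨p, ⟨hp, fun h => hpy (mk_eq_mk.2 h)⟩, rfl⟩
  rw [blocks, h1, blocks]
  exact ncard_sdiff_singleton_add_one ⟨y, hy, rfl⟩ (toFinite _)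

theorem blocks_le_one {W : Setoid X} {S : Set X} (h : ∀ p ∈ S, ∀ q ∈ S, W p q) :
    blocks W S ≤ 1 := by
  rw [blocks, ncard_le_one_iff (toFinite _)]
  rintro _ _ ⟨p, hp, rfl⟩ ⟨q, hq, rfl⟩
  exact mk_eq_mk.2 (h p hp q hq)

end Blocks

/-! ### Edges of a quotient as a partition; connectedness, trees and closed walks -/

section EdgeClasses

variable {X : Type*} (γ : Equiv.Perm X)

/-- Two labels are related when the edges `(γ x, x)` with these labels connect the same pair of
vertices of the quotient by `π`. -/
def edgeSetoid (π : Setoid X) : Setoid X :=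
  Setoid.ker fun x => s(Quotient.mk π (γ x), Quotient.mk π x)

variable {γ}

theorem edgeSetoid_apply {π : Setoid X} {x y : X} :
    edgeSetoid γ π x y ↔ (π x y ∧ π (γ x) (γ y)) ∨ (π x (γ y) ∧ π y (γ x)) := by
  rw [edgeSetoid, Setoid.ker_def, Sym2.eq_iff]
  simp only [mk_eq_mk]
  constructor
  · rintro (⟨h, h'⟩ | ⟨h, h'⟩)
    · exact Or.inl ⟨h', h⟩
    · exact Or.inr ⟨h', π.symm' h⟩
  · rintro (⟨h, h'⟩ | ⟨h, h'⟩)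
    · exact Or.inl ⟨h', h⟩
    · exact Or.inr ⟨π.symm' h', h⟩

variable (γ)

/-- Any two elements of `S` are connected by edges with labels in `S`. -/
def Connects (π : Setoid X) (S : Set X) : Prop :=
  ∀ W : Setoid X, π ≤ W → (∀ z ∈ S, W z (γ z)) → ∀ p ∈ S, ∀ q ∈ S, W p q

variable {γ}

theorem rel_gamma_of_edgeSetoid {π W : Setoid X} (h : π ≤ W) {x y : X} (hxy : edgeSetoid γ π x y)
    (hx : W x (γ x)) : W y (γ y) := by
  rw [edgeSetoid_apply] at hxy
  rcases hxy with ⟨h1, h2⟩ | ⟨h1, h2⟩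
  · exact W.trans' (W.symm' (h h1)) (W.trans' hx (h h2))
  · exact W.trans' (h h2) (W.trans' (W.symm' hx) (h h1))

variable [Finite X]

/-- Glue the end points of one representative of each edge class in `F`. Each gluing loses at most
one block, and equivalent edges are joined automatically. This is the statement that `n` edges
reduce the number of components by at most `n`. -/
theorem exists_join_edges (π : Setoid X) (S F : Set X) :
    ∃ W, π ≤ W ∧ (∀ z ∈ F, W z (γ z)) ∧ blocks π S ≤ blocks W S + blocks (edgeSetoid γ π) F := by
  have aux : ∀ R : Set X, R.Finite →
      ∃ W, π ≤ W ∧ (∀ z ∈ R, W z (γ z)) ∧ blocks π S ≤ blocks W S + R.ncard := by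
    intro R hR
    induction R, hR using Set.Finite.induction_on with
    | empty => exact ⟨π, le_rfl, by simp, by simp⟩
    | @insert a R ha hR ih =>
      obtain ⟨W, h1, h2, h3⟩ := ih
      refine ⟨glue W a (γ a), h1.trans (le_glue _ _ _), ?_, ?_⟩
      · rintro z (rfl | hz)
        · exact glue_self _ _ _
        · exact le_glue _ _ _ (h2 z hz)
      · rw [ncard_insert_of_notMem ha hR]
        have := blocks_le_blocks_glue W a (γ a) S
        omega
  rcases isEmpty_or_nonempty X with hX | hX
  · exact ⟨π, le_rfl, fun z => hX.elim z, by omega⟩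
  choose! r hr using fun (c : Quotient (edgeSetoid γ π)) (hc : c ∈ Quotient.mk _ '' F) => hc
  obtain ⟨W, h1, h2, h3⟩ := aux (r '' (Quotient.mk _ '' F)) (toFinite _)
  refine ⟨W, h1, fun z hz => ?_, h3.trans ?_⟩
  · have hz' : Quotient.mk (edgeSetoid γ π) z ∈ Quotient.mk _ '' F := ⟨z, hz, rfl⟩
    exact rel_gamma_of_edgeSetoid h1 (mk_eq_mk.1 (hr _ hz').2) (h2 _ ⟨_, hz', rfl⟩)
  · have := ncard_image_le (f := r) (toFinite (Quotient.mk (edgeSetoid γ π) '' F))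
    unfold blocks at *
    omega

theorem Connects.blocks_le {π : Setoid X} {S : Set X} (h : Connects γ π S) :
    blocks π S ≤ blocks (edgeSetoid γ π) S + 1 := by
  obtain ⟨W, h1, h2, h3⟩ := exists_join_edges (γ := γ) π S S
  have := blocks_le_one (h W h1 h2)
  omega

/-- A connected graph with a loop is not a tree. -/
theorem Connects.not_loop {π : Setoid X} {S : Set X} (h : Connects γ π S)
    (hb : blocks (edgeSetoid γ π) S + 1 ≤ blocks π S) {y : X} (hy : y ∈ S) : ¬ π y (γ y) := by
  intro hl
  obtain ⟨W, h1, h2, h3⟩ := exists_join_edges (γ := γ) π S (S \ {z | edgeSetoid γ π z y})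
  have h4 := blocks_le_one (h W h1 fun z hz => by
    by_cases hzy : edgeSetoid γ π z y
    · exact rel_gamma_of_edgeSetoid h1 ((edgeSetoid γ π).symm' hzy) (h1 hl)
    · exact h2 z ⟨hz, hzy⟩)
  have h5 := blocks_diff_class (edgeSetoid γ π) hy
  omega

/-- A closed walk that leaves a block also returns to it. -/
theorem rel_gamma_of_closed {W : Setoid X} {K : Set X} (hK : ∀ z ∈ K, γ z ∈ K) {y : X}
    (hy : y ∈ K) (h : ∀ z ∈ K, W z (γ z) ∨ W z y) : W y (γ y) := by
  have hK' : ∀ z, γ z ∈ K → z ∈ K := by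
    have h1 : γ '' K = K := by
      apply eq_of_subset_of_ncard_le
      · rintro _ ⟨z, hz, rfl⟩; exact hK z hz
      · rw [ncard_image_of_injective _ γ.injective]
      · exact toFinite _
    intro z hz
    rw [← h1] at hz
    obtain ⟨w, hw, hwz⟩ := hz
    exact γ.injective hwz ▸ hw
  -- If `γ p` is in `A`, then so is `p`: either the edge stays in its block or `p` is already in the
  -- block of `y`. So the preimage of `A` lies in `A`, and by finiteness they coincide.
  let A : Set X := {p | p ∈ K ∧ W p y}
  have h1 : γ ⁻¹' A ⊆ A := by
    rintro p ⟨hp, hpy⟩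
    refine ⟨hK' p hp, ?_⟩
    rcases h p (hK' p hp) with h2 | h2
    · exact W.trans' h2 hpy
    · exact h2
  have h2 : γ ⁻¹' A = A := by
    apply eq_of_subset_of_ncard_le h1
    · rw [ncard_preimage_of_injective_subset_range γ.injective]
      rw [γ.surjective.range_eq]; exact subset_univ _
  have h3 : y ∈ γ ⁻¹' A := by rw [h2]; exact ⟨hy, W.refl' y⟩
  exact W.symm' h3.2

/-- If the edges labelled by `F` are too few to connect `S` but together with `y` they do, then
a closed walk through `y` contains another edge connecting the same vertices. -/
theorem exists_edge_back {π : Setoid X} {S F K : Set X} {y : X}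
    (hF : ∀ W : Setoid X, π ≤ W → (∀ z ∈ F, W z (γ z)) → W y (γ y) → ∀ p ∈ S, ∀ q ∈ S, W p q)
    (hb : blocks (edgeSetoid γ π) F + 1 < blocks π S) (hK : ∀ z ∈ K, γ z ∈ K) (hy : y ∈ K)
    (hKF : ∀ z ∈ K, z ∈ F ∨ π z (γ z) ∨ edgeSetoid γ π z y) :
    ∃ z ∈ K, z ≠ y ∧ edgeSetoid γ π z y := by
  obtain ⟨W, h1, h2, h3⟩ := exists_join_edges (γ := γ) π S F
  -- The edges in `F` leave at least two blocks, so `y` must cross between blocks of `W`. The closed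
  -- walk has to cross back, and only an edge equivalent to `y` can do this.
  have h4 : ¬ W y (γ y) := fun h4 => by
    have := blocks_le_one (hF W h1 h2 h4)
    omega
  by_contra! hcon
  refine h4 (rel_gamma_of_closed hK hy fun z hz => ?_)
  rcases hKF z hz with h5 | h5 | h5
  · exact Or.inl (h2 z h5)
  · exact Or.inl (h1 h5)
  · right
    by_cases hzy : z = y
    · exact hzy ▸ W.refl' z
    · exact absurd h5 (hcon z hz hzy)

/-- In a tree, a closed walk contains every edge at least twice. -/
theorem Connects.exists_edge_back {π : Setoid X} {S K : Set X} {y : X} (h : Connects γ π S)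
    (hb : blocks (edgeSetoid γ π) S + 1 ≤ blocks π S) (hK : ∀ z ∈ K, γ z ∈ K) (hKS : K ⊆ S)
    (hy : y ∈ K) : ∃ z ∈ K, z ≠ y ∧ edgeSetoid γ π z y := by
  refine LimitGraphs.exists_edge_back (S := S) (F := S \ {z | edgeSetoid γ π z y}) ?_ ?_ hK hy ?_
  · intro W h1 h2 h3
    refine h W h1 fun z hz => ?_
    by_cases hzy : edgeSetoid γ π z y
    · exact rel_gamma_of_edgeSetoid h1 ((edgeSetoid γ π).symm' hzy) h3
    · exact h2 z ⟨hz, hzy⟩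
  · have := blocks_diff_class (edgeSetoid γ π) (hKS hy)
    omega
  · intro z hz
    by_cases hzy : edgeSetoid γ π z y
    · exact Or.inr (Or.inr hzy)
    · exact Or.inl ⟨hKS hz, hzy⟩

end EdgeClasses
end LimitGraphs

namespace LimitGraphs
open Set

/-! ### Pairings as fixed point free involutions -/

section Pairings

variable {X : Type*}

theorem cycles_apply {g : Equiv.Perm X} {x y : X} : cycles g x y ↔ g.SameCycle x y := Iff.rfl

theorem cycles_le_iff [Finite X] {g : Equiv.Perm X} {W : Setoid X} :
    cycles g ≤ W ↔ ∀ p, W p (g p) := by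
  constructor
  · intro h p
    exact h (cycles_apply.2 (Equiv.Perm.sameCycle_apply_right.2 (Equiv.Perm.SameCycle.refl g p)))
  · intro h x y hxy
    obtain ⟨n, hn⟩ := (cycles_apply.1 hxy).exists_nat_pow_eq
    rw [← hn]
    clear hn hxy
    induction n with
    | zero => exact W.refl' x
    | succ n ih =>
      rw [pow_succ', Equiv.Perm.mul_apply]
      exact W.trans' ih (h _)

/-- A fixed point free involution. -/
def IsMatching (σ : Equiv.Perm X) : Prop := ∀ x, σ x ≠ x ∧ σ (σ x) = x

theorem IsMatching.cycles_apply {σ : Equiv.Perm X} (h : IsMatching σ) {x y : X} :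
    cycles σ x y ↔ y = x ∨ y = σ x := by
  constructor
  · rintro ⟨n, rfl⟩
    have h2 : σ ^ (2 : ℤ) = 1 := by
      ext z
      simp [zpow_ofNat, pow_two, (h z).2]
    rcases Int.even_or_odd' n with ⟨k, rfl | rfl⟩
    · left; rw [zpow_mul, h2]; simp
    · right; rw [zpow_add, zpow_mul, h2]; simp
  · rintro (rfl | rfl)
    · exact Equiv.Perm.SameCycle.refl _ _
    · exact Equiv.Perm.sameCycle_apply_right.2 (Equiv.Perm.SameCycle.refl _ _)

theorem cycles_self_apply (σ : Equiv.Perm X) (x : X) : cycles σ x (σ x) :=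
  Equiv.Perm.sameCycle_apply_right.2 (Equiv.Perm.SameCycle.refl _ _)

theorem cycles_of_apply_eq {σ : Equiv.Perm X} {x : X} (h : σ x = x) {y : X} :
    cycles σ x y ↔ y = x := by
  constructor
  · rintro ⟨n, rfl⟩
    exact Equiv.Perm.zpow_apply_eq_self_of_apply_eq_self h n
  · rintro rfl
    exact Equiv.Perm.SameCycle.refl _ _

theorem cycles_of_apply_apply_eq {σ : Equiv.Perm X} {x : X} (h : σ (σ x) = x) {y : X} :
    cycles σ x y ↔ y = x ∨ y = σ x := by
  constructor
  · rintro ⟨n, rfl⟩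
    have h2 : (σ ^ (2 : ℤ)) x = x := by simp [zpow_ofNat, pow_two, h]
    rcases Int.even_or_odd' n with ⟨k, rfl | rfl⟩
    · left; rw [zpow_mul]; exact Equiv.Perm.zpow_apply_eq_self_of_apply_eq_self h2 k
    · right
      rw [add_comm, zpow_add, zpow_mul, Equiv.Perm.mul_apply,
        Equiv.Perm.zpow_apply_eq_self_of_apply_eq_self h2 k, zpow_one]
  · rintro (rfl | rfl)
    · exact Equiv.Perm.SameCycle.refl _ _
    · exact cycles_self_apply _ _

theorem cycleSize_mk (σ : Equiv.Perm X) (x : X) :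
    cycleSize σ (Quotient.mk (cycles σ) x) = {y | cycles σ x y}.ncard := by
  rw [cycleSize]
  congr 1
  ext y
  exact mk_eq_mk.trans ⟨(cycles σ).symm', (cycles σ).symm'⟩

theorem cycleSize_eq_one_iff {σ : Equiv.Perm X} {x : X} :
    cycleSize σ (Quotient.mk (cycles σ) x) = 1 ↔ σ x = x := by
  rw [cycleSize_mk]
  constructor
  · intro h
    obtain ⟨a, ha⟩ := ncard_eq_one.1 h
    have h1 : x ∈ {y | cycles σ x y} := (cycles σ).refl' x
    have h2 : σ x ∈ {y | cycles σ x y} := cycles_self_apply σ x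
    rw [ha] at h1 h2
    exact (mem_singleton_iff.1 h2).trans (mem_singleton_iff.1 h1).symm
  · intro h
    have : {y | cycles σ x y} = {x} := by
      ext y; exact cycles_of_apply_eq h
    rw [this, ncard_singleton]

theorem cycleSize_eq_two_iff {σ : Equiv.Perm X} {x : X} :
    cycleSize σ (Quotient.mk (cycles σ) x) = 2 ↔ σ x ≠ x ∧ σ (σ x) = x := by
  constructor
  · intro h
    have hx : σ x ≠ x := fun hx => by
      rw [cycleSize_eq_one_iff.2 hx] at h; omega
    refine ⟨hx, ?_⟩
    rw [cycleSize_mk] at h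
    obtain ⟨a, b, hab, hs⟩ := ncard_eq_two.1 h
    have h1 : x ∈ {y | cycles σ x y} := (cycles σ).refl' x
    have h2 : σ x ∈ {y | cycles σ x y} := cycles_self_apply σ x
    have h3 : σ (σ x) ∈ {y | cycles σ x y} :=
      (cycles σ).trans' (cycles_self_apply σ x) (cycles_self_apply σ _)
    have h4 : σ (σ x) ≠ σ x := fun h => hx (σ.injective h)
    rw [hs] at h1 h2 h3
    simp only [mem_insert_iff, mem_singleton_iff] at h1 h2 h3
    grind
  · rintro ⟨h1, h2⟩
    rw [cycleSize_mk]
    have : {y | cycles σ x y} = {x, σ x} := by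
      ext y; exact cycles_of_apply_apply_eq h2
    rw [this, ncard_pair h1.symm]

theorem isPairing_iff {σ : Equiv.Perm X} : IsPairing σ ↔ IsMatching σ := by
  constructor
  · intro h x
    exact cycleSize_eq_two_iff.1 (h _)
  · intro h c
    obtain ⟨x, rfl⟩ := Quotient.mk_surjective c
    exact cycleSize_eq_two_iff.2 (h x)

theorem IsMatching.two_mul_blocks [Finite X] {σ : Equiv.Perm X} (h : IsMatching σ) :
    2 * blocks (cycles σ) univ = Nat.card X := by
  classical
  have := Fintype.ofFinite X
  have h1 : Nat.card X = ∑ c : Quotient (cycles σ), cycleSize σ c := by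
    rw [Nat.card_eq_fintype_card, ← Finset.card_univ,
      Finset.card_eq_sum_card_fiberwise (f := Quotient.mk (cycles σ)) (t := Finset.univ) (by simp)]
    refine Finset.sum_congr rfl fun c _ => ?_
    rw [cycleSize, ← ncard_coe_finset]
    congr 1
    ext x; simp
  rw [h1, Finset.sum_congr rfl fun c _ => isPairing_iff.2 h c, blocks_univ, numBlocks]
  simp [mul_comm]

end Pairings

/-! ### Orientations and the quotient obtained from a partitioned permutation -/

section Merging

variable {X : Type*} (γ : Equiv.Perm X)

/-- Orientations of the edges for which paired edges are opposite. -/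
def orientations (σ : Equiv.Perm X) : Set (X → Bool) := {f | ∀ x, f (σ x) = !f x}

/-- The partition of the vertices for which paired edges are opposite, and edges in the same block
of `V` are identified according to the orientation `f`. -/
def merged (V : Setoid X) (σ : Equiv.Perm X) (f : X → Bool) : Setoid X :=
  sInf {W | cycles (γ * σ) ≤ W ∧ ∀ x y, V x y → f x = f y → W x y ∧ W (γ x) (γ y)}

variable {γ} {V : Setoid X} {σ : Equiv.Perm X} {f : X → Bool}

theorem cycles_le_merged : cycles (γ * σ) ≤ merged γ V σ f :=
  le_sInf fun _ h => h.1

theorem merged_rel {x y : X} (h : V x y) (hf : f x = f y) :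
    merged γ V σ f x y ∧ merged γ V σ f (γ x) (γ y) := by
  constructor
  · exact fun W hW => (hW.2 x y h hf).1
  · exact fun W hW => (hW.2 x y h hf).2

theorem merged_le {W : Setoid X} (h : cycles (γ * σ) ≤ W)
    (h' : ∀ x y, V x y → f x = f y → W x y ∧ W (γ x) (γ y)) : merged γ V σ f ≤ W :=
  sInf_le ⟨h, h'⟩

theorem rel_of_cycles_le [Finite X] {π : Setoid X} (h : cycles (γ * σ) ≤ π) (x : X) :
    π x (γ (σ x)) := cycles_le_iff.1 h x

/-- Two edges in a block of `V` with the same orientation are identified in parallel. If the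
orientations differ, then `σ y` has the orientation of `x`, and it is opposite to `y`; so `x` and
`y` still have the same end points. -/
theorem le_edgeSetoid_merged [Finite X] (hσ : IsMatching σ) (hV : cycles σ ≤ V)
    (hf : f ∈ orientations σ) : V ≤ edgeSetoid γ (merged γ V σ f) := by
  intro x y hxy
  rw [edgeSetoid_apply]
  by_cases h : f x = f y
  · exact Or.inl (merged_rel hxy h)
  · right
    have h1 : f x = f (σ y) := by
      rw [hf y]; revert h; cases f x <;> cases f y <;> simp
    have h2 := merged_rel (γ := γ) (σ := σ) (V.trans' hxy (hV (cycles_self_apply σ y))) h1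
    have h3 := rel_of_cycles_le (cycles_le_merged (γ := γ) (V := V) (σ := σ) (f := f)) (σ y)
    rw [(hσ y).2] at h3
    have h4 := rel_of_cycles_le (cycles_le_merged (γ := γ) (V := V) (σ := σ) (f := f)) y
    let W := merged γ V σ f
    exact ⟨W.trans' h2.1 h3, W.trans' h4 (W.symm' h2.2)⟩

theorem orientations_nonempty (hσ : IsMatching σ) : (orientations σ).Nonempty := by
  classical
  -- The chosen representative of each pair is the positive edge.
  refine ⟨fun x => decide (x = (Quotient.mk (cycles σ) x).out), fun x => ?_⟩
  have h1 : Quotient.mk (cycles σ) (σ x) = Quotient.mk (cycles σ) x :=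
    Quotient.sound ((cycles σ).symm' (cycles_self_apply σ x))
  have h2 : cycles σ x (Quotient.mk (cycles σ) x).out :=
    (cycles σ).symm' (Quotient.mk_out (s := cycles σ) x)
  simp only [h1]
  rcases hσ.cycles_apply.1 h2 with h3 | h3
  · rw [h3]; simp [(hσ x).1]
  · rw [h3]; simp [(hσ x).1.symm]

/-- Two orientations are equivalent when they differ by reversing all edges in some blocks. -/
def SameUpTo (V : Setoid X) (f f' : X → Bool) : Prop :=
  ∀ x y, V x y → (f x = f y ↔ f' x = f' y)

/-- Equivalent orientations form a torsor under Boolean functions on the blocks of `V`, acting by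
`xor`. -/
theorem ncard_sameUpTo [Finite X] (hV : cycles σ ≤ V) (hf : f ∈ orientations σ) :
    {f' ∈ orientations σ | SameUpTo V f' f}.ncard = 2 ^ blocks V univ := by
  have h1 : {f' ∈ orientations σ | SameUpTo V f' f} =
      (fun (g : Quotient V → Bool) x => xor (f x) (g (Quotient.mk V x))) '' univ := by
    ext f'
    constructor
    · rintro ⟨h1, h2⟩
      refine ⟨Quotient.lift (fun x => xor (f x) (f' x)) ?_, mem_univ _, ?_⟩
      · intro x y hxy
        have := h2 x y hxy
        revert this
        cases f x <;> cases f y <;> cases f' x <;> cases f' y <;> simp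
      · funext x
        simp [Quotient.lift_mk]
    · rintro ⟨g, -, rfl⟩
      constructor
      · intro x
        have h3 : Quotient.mk V (σ x) = Quotient.mk V x :=
          Quotient.sound (V.symm' (hV (cycles_self_apply σ x)))
        simp only [h3, hf x]
        cases f x <;> simp
      · intro x y hxy
        have h3 : Quotient.mk V x = Quotient.mk V y := Quotient.sound hxy
        simp only [h3]
        cases f x <;> cases f y <;> simp
  have := Fintype.ofFinite (Quotient V)
  rw [h1, ncard_image_of_injective, ncard_univ, blocks_univ, numBlocks, Nat.card_fun]
  · simp
  · intro g g' h
    funext c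
    obtain ⟨x, rfl⟩ := Quotient.mk_surjective c
    have := congrFun h x
    simpa using this

theorem ncard_orientations [Finite X] (hσ : IsMatching σ) :
    (orientations σ).ncard = 2 ^ blocks (cycles σ) univ := by
  obtain ⟨f, hf⟩ := orientations_nonempty hσ
  rw [← ncard_sameUpTo le_rfl hf]
  congr 1
  ext f'
  refine ⟨fun h => ⟨h, fun x y hxy => ?_⟩, fun h => h.1⟩
  rcases hσ.cycles_apply.1 hxy with rfl | rfl
  · simp
  · rw [h x, hf x]; simp

theorem merged_congr {f' : X → Bool} (h : SameUpTo V f f') :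
    merged γ V σ f = merged γ V σ f' := by
  apply le_antisymm
  · exact merged_le cycles_le_merged fun x y hxy hf => merged_rel hxy ((h x y hxy).1 hf)
  · exact merged_le cycles_le_merged fun x y hxy hf => merged_rel hxy ((h x y hxy).2 hf)

/-- The fibres of `merged γ V σ` are the classes of `SameUpTo V`, each of size `2 ^ blocks V univ`.
The hypothesis keeps loops out of blocks of `V` that contain more than one pair, since reversing a
loop changes nothing. -/
theorem ncard_merged [Finite X] (hσ : IsMatching σ) (hV : cycles σ ≤ V)
    (h : ∀ f ∈ orientations σ, ∀ x y, V x y → merged γ V σ f x (γ x) → y = x ∨ y = σ x) :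
    (merged γ V σ '' orientations σ).ncard * 2 ^ blocks V univ = 2 ^ blocks (cycles σ) univ := by
  classical
  have := Fintype.ofFinite X
  have key : ∀ f ∈ orientations σ, ∀ f' ∈ orientations σ,
      (merged γ V σ f' = merged γ V σ f ↔ SameUpTo V f' f) := by
    intro f hf f' hf'
    refine ⟨fun he => ?_, merged_congr⟩
    have aux : ∀ f ∈ orientations σ, ∀ f' ∈ orientations σ, merged γ V σ f' = merged γ V σ f →
        ∀ x y, V x y → f' x = f' y → f x = f y := by
      intro f hf f' hf' he x y hxy hxy'
      by_contra hne
      have h1 : f x = f (σ y) := by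
        rw [hf y]; revert hne; cases f x <;> cases f y <;> simp
      have h2 := merged_rel (γ := γ) (σ := σ) (V.trans' hxy (hV (cycles_self_apply σ y))) h1
      have h3 := merged_rel (γ := γ) (σ := σ) hxy hxy'
      rw [he] at h3
      have h4 := rel_of_cycles_le (cycles_le_merged (γ := γ) (V := V) (σ := σ) (f := f)) y
      let W := merged γ V σ f
      -- If one orientation identifies `x` with `y` and the other identifies `x` with the reverse of
      -- `y`, and both give the same quotient, then the two ends of `x` coincide.
      have h5 : W x (γ x) := W.trans' h3.1 (W.trans' h4 (W.symm' h2.2))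
      rcases h f hf x y hxy h5 with rfl | rfl
      · exact hne rfl
      · rw [hf' x] at hxy'; simp at hxy'
    exact fun x y hxy => ⟨aux f hf f' hf' he x y hxy, aux f' hf' f hf he.symm x y hxy⟩
  rw [← ncard_orientations hσ]
  set A := (orientations σ).toFinset with hA
  have h1 : (orientations σ).ncard = A.card := ncard_eq_toFinset_card' _
  have h2 : (merged γ V σ '' orientations σ).ncard = (A.image (merged γ V σ)).card := by
    rw [← ncard_coe_finset]; congr 1; simp [hA]
  rw [h1, h2, Finset.card_eq_sum_card_image (merged γ V σ) A, Finset.sum_const_nat]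
  intro π hπ
  obtain ⟨f, hf, rfl⟩ := Finset.mem_image.1 hπ
  have hf' : f ∈ orientations σ := by simpa [hA] using hf
  rw [← ncard_sameUpTo hV hf', ← ncard_coe_finset]
  congr 1
  ext f'
  simp only [Finset.coe_filter, mem_ofPred_eq, hA, mem_toFinset]
  constructor
  · rintro ⟨h3, h4⟩; exact ⟨h3, (key f hf' f' h3).1 h4⟩
  · rintro ⟨h3, h4⟩; exact ⟨h3, (key f hf' f' h3).2 h4⟩

/-- Every partition for which paired edges are opposite is refined by a merged one. -/
theorem exists_merged_le [Finite X] (hσ : IsMatching σ) {π : Setoid X}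
    (h : cycles (γ * σ) ≤ π) : ∃ f ∈ orientations σ, merged γ (edgeSetoid γ π) σ f ≤ π := by
  classical
  obtain ⟨f₀, hf₀⟩ := orientations_nonempty hσ
  let r : X → X := fun x => (Quotient.mk (edgeSetoid γ π) x).out
  have hr : ∀ x, edgeSetoid γ π x (r x) := fun x =>
    (edgeSetoid γ π).symm' (Quotient.mk_out (s := edgeSetoid γ π) x)
  have hrr : ∀ x y, edgeSetoid γ π x y → r x = r y := fun x y hxy => by
    simp only [r]; rw [Quotient.sound (s := edgeSetoid γ π) hxy]
  have hop : ∀ x, π x (γ (σ x)) := rel_of_cycles_le h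
  have hop' : ∀ x, π (σ x) (γ x) := fun x => by
    have := hop (σ x); rwa [(hσ x).2] at this
  have hEσ : ∀ x, edgeSetoid γ π x (σ x) := fun x =>
    edgeSetoid_apply.2 (Or.inr ⟨hop x, hop' x⟩)
  have hloop : ∀ x y, edgeSetoid γ π x y → π x (γ x) → π y (γ y) := fun x y hxy hx =>
    rel_gamma_of_edgeSetoid le_rfl hxy hx
  -- Away from loops, an edge is positive when it has the same target as the representative of its
  -- class. On loops this test says nothing, and any orientation compatible with `σ` will do.
  refine ⟨fun x => if π x (γ x) then f₀ x else decide (π x (r x)), ?_, ?_⟩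
  · intro x
    by_cases hx : π x (γ x)
    · have hx' : π (σ x) (γ (σ x)) := hloop _ _ (hEσ x) hx
      simp [hx, hx', hf₀ x]
    · have hx' : ¬ π (σ x) (γ (σ x)) := fun h' =>
        hx (hloop _ _ ((edgeSetoid γ π).symm' (hEσ x)) h')
      have hrσ : r (σ x) = r x := (hrr _ _ (hEσ x)).symm
      simp only [hx, hx', if_false, hrσ]
      have h1 : ¬ π (r x) (γ (r x)) := fun h' =>
        hx (hloop _ _ ((edgeSetoid γ π).symm' (hr x)) h')
      rcases edgeSetoid_apply.1 (hr x) with ⟨h2, h3⟩ | ⟨h2, h3⟩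
      · have h4 : ¬ π (σ x) (r x) := fun h4 =>
          h1 (π.trans' (π.symm' h4) (π.trans' (hop' x) h3))
        simp [h2, h4]
      · have h4 : ¬ π x (r x) := fun h4 => h1 (π.trans' (π.symm' h4) h2)
        have h5 : π (σ x) (r x) := π.trans' (hop' x) (π.symm' h3)
        simp [h4, h5]
  · refine merged_le h fun x y hxy hf => ?_
    by_cases hx : π x (γ x)
    · have hy := hloop x y hxy hx
      rcases edgeSetoid_apply.1 hxy with h2 | ⟨h2, h3⟩
      · exact h2
      · have h4 : π x y := π.trans' h2 (π.symm' hy)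
        exact ⟨h4, π.trans' (π.symm' hx) (π.trans' h4 hy)⟩
    · have hy : ¬ π y (γ y) := fun h' => hx (hloop _ _ ((edgeSetoid γ π).symm' hxy) h')
      simp only [hx, hy, if_false, ← hrr x y hxy, decide_eq_decide] at hf
      rcases edgeSetoid_apply.1 hxy with h2 | ⟨h2, h3⟩
      · exact h2
      · exfalso
        have h1 : ¬ π (r x) (γ (r x)) := fun h' =>
          hx (hloop _ _ ((edgeSetoid γ π).symm' (hr x)) h')
        rcases edgeSetoid_apply.1 (hr x) with ⟨h4, h5⟩ | ⟨h4, h5⟩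
        · have h6 := hf.1 h4
          exact hy (π.trans' h6 (π.trans' (π.symm' h4) h2))
        · have h6 : π y (r x) := π.trans' h3 (π.symm' h5)
          have h7 := hf.2 h6
          exact h1 (π.trans' (π.symm' h7) h4)

end Merging
end LimitGraphs

namespace LimitGraphs
open Set

/-! ### Connectedness and parity of cuts in unoriented graphs -/

section GraphLemmas

variable {α β : Type*}

/-- Apply the hypothesis to reachability, extended by equality off the vertex set. Connectedness can
thus be tested on equivalence relations, which matches `Connects`. -/
theorem isConnected_of_setoid {G : Graph α β} (hne : G.vertexSet.Nonempty)
    (h : ∀ r : Setoid α, (∀ e u v, G.IsLink e u v → r u v) →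
      ∀ u ∈ G.vertexSet, ∀ v ∈ G.vertexSet, r u v) : IsConnected G := by
  let r : Setoid α :=
    { r := fun u v => u = v ∨ ∃ (hu : u ∈ G.vertexSet) (hv : v ∈ G.vertexSet),
        G.toSimpleGraph.Reachable ⟨u, hu⟩ ⟨v, hv⟩
      iseqv := by
        refine ⟨fun u => Or.inl rfl, ?_, ?_⟩
        · rintro u v (h | ⟨hu, hv, h⟩)
          · exact Or.inl h.symm
          · exact Or.inr ⟨hv, hu, h.symm⟩
        · rintro u v w (rfl | ⟨hu, hv, h⟩) (rfl | ⟨hv', hw, h'⟩)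
          · exact Or.inl rfl
          · exact Or.inr ⟨hv', hw, h'⟩
          · exact Or.inr ⟨hu, hv, h⟩
          · exact Or.inr ⟨hu, hw, h.trans h'⟩ }
  have hr := h r (fun e u v he => by
    by_cases huv : u = v
    · exact Or.inl huv
    · refine Or.inr ⟨he.left_mem, he.right_mem, SimpleGraph.Adj.reachable ?_⟩
      rw [Graph.toSimpleGraph_adj]
      exact ⟨fun hh => huv (congrArg Subtype.val hh), he.adj⟩)
  have := hne.to_subtype
  refine ⟨?_⟩
  rintro ⟨u, hu⟩ ⟨v, hv⟩
  rcases hr u hu v hv with h1 | ⟨_, _, h1⟩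
  · subst h1; exact SimpleGraph.Reachable.refl _
  · exact h1

variable [Finite α] [Finite β]

/-- Every circuit crosses a cut an even number of times; in particular not exactly once. -/
theorem circuit_cut {G C : Graph α β} (hC : IsCircuit G C) (P : α → Prop) {e₀ : β} {a b : α}
    (hab : C.IsLink e₀ a b)
    (h : ∀ e u v, C.IsLink e u v → e ≠ e₀ → (P u ↔ P v)) : P a ↔ P b := by
  classical
  have := Fintype.ofFinite α
  have := Fintype.ofFinite β
  by_contra hP
  let inc : β → α → ℕ := fun e v => (if C.Inc e v then 1 else 0) + (if C.IsLoopAt e v then 1 else 0)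
  have hdeg : ∀ v, degree C v = ∑ e, inc e v := by
    intro v
    rw [degree, ncard_eq_toFinset_card', ncard_eq_toFinset_card', Finset.sum_add_distrib,
      ← Finset.card_filter, ← Finset.card_filter]
    congr 2 <;> ext e <;> simp
  -- Handshake argument on one side of the cut: the degree sum is even, every edge other than `e₀`
  -- contributes 0 or 2, and `e₀` would contribute 1 if it crossed.
  have hsum : ∑ v ∈ Finset.univ.filter (fun v => v ∈ C.vertexSet ∧ P v), degree C v =
      2 * (Finset.univ.filter (fun v => v ∈ C.vertexSet ∧ P v)).card := by
    rw [Finset.sum_congr rfl (g := fun _ => 2) fun v hv => hC.2.2 v (Finset.mem_filter.1 hv).2.1]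
    simp [mul_comm]
  have hlink : ∀ e u v, C.IsLink e u v →
      ∑ w ∈ Finset.univ.filter (fun v => v ∈ C.vertexSet ∧ P v), inc e w =
        (if P u then 1 else 0) + (if P v then 1 else 0) := by
    intro e u v he
    have h1 : ∀ w, inc e w = (if w = u then 1 else 0) + (if w = v then 1 else 0) := by
      intro w
      have hi : C.Inc e w ↔ w = u ∨ w = v := by
        constructor
        · intro hw; exact hw.eq_or_eq_of_isLink he
        · rintro (rfl | rfl)
          · exact he.inc_left
          · exact he.inc_right
      have hl : C.IsLoopAt e w ↔ w = u ∧ w = v := by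
        constructor
        · intro hw
          exact ⟨hw.eq_of_inc he.inc_left, hw.eq_of_inc he.inc_right⟩
        · rintro ⟨rfl, rfl⟩; exact he
      simp only [inc, hi, hl]
      by_cases hu : w = u <;> by_cases hv : w = v <;> simp only [hu, hv, true_or, or_true, or_self,
        true_and, and_true, and_self, if_true, if_false, Nat.add_zero]; omega
    simp only [h1, Finset.sum_add_distrib, Finset.sum_ite_eq', Finset.mem_filter, Finset.mem_univ,
      true_and, he.left_mem, he.right_mem]
  have hpar : ∀ e, e ≠ e₀ →
      Even (∑ w ∈ Finset.univ.filter (fun v => v ∈ C.vertexSet ∧ P v), inc e w) := by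
    intro e he
    by_cases hmem : e ∈ C.edgeSet
    · obtain ⟨u, v, huv⟩ := Graph.exists_isLink_of_mem_edgeSet hmem
      rw [hlink e u v huv]
      have := h e u v huv he
      by_cases hu : P u
      · simp [hu, this.1 hu]
      · simp [hu, mt this.2 hu]
    · have : ∀ w, inc e w = 0 := by
        intro w
        have h1 : ¬ C.Inc e w := fun h1 => hmem h1.edge_mem
        have h2 : ¬ C.IsLoopAt e w := fun h1 => hmem h1.edge_mem
        simp [inc, h1, h2]
      simp [this]
  simp only [hdeg] at hsum
  rw [Finset.sum_comm, ← Finset.add_sum_erase _ _ (Finset.mem_univ e₀), hlink e₀ a b hab] at hsum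
  have h3 : Even (∑ e ∈ Finset.univ.erase e₀,
      ∑ w ∈ Finset.univ.filter (fun v => v ∈ C.vertexSet ∧ P v), inc e w) :=
    Finset.even_sum _ fun e he => hpar e (Finset.ne_of_mem_erase he)
  obtain ⟨k, hk⟩ := h3
  by_cases ha : P a <;> by_cases hb : P b
  · exact hP ⟨fun _ => hb, fun _ => ha⟩
  · simp only [ha, hb, if_true, if_false] at hsum; omega
  · simp only [ha, hb, if_true, if_false] at hsum; omega
  · exact hP ⟨fun h => absurd h ha, fun h => absurd h hb⟩

end GraphLemmas

/-! ### Trees and circuits in elementarizations, characterized by counting -/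

section Elementarization

variable {V E : Type*}

theorem isLink_elementarization {T : OrientedGraph V E} {ε : Sym2 V} {u v : V} :
    T.elementarization.IsLink ε u v ↔ ε = s(u, v) ∧ ε ∈ T.elementarization.edgeSet := Iff.rfl

theorem isConnected_elementarization {T : OrientedGraph V E} (hne : T.vertexSet.Nonempty)
    (h : ∀ r : Setoid V, (∀ e ∈ T.edgeSet, r (T.source e) (T.target e)) →
      ∀ u ∈ T.vertexSet, ∀ v ∈ T.vertexSet, r u v) : IsConnected T.elementarization := by
  refine isConnected_of_setoid hne fun r hr => h r fun e he => ?_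
  exact hr _ _ _ ⟨rfl, e, he, rfl⟩

/-- Edges are labelled by their end points, so passing to the simple graph loses the loops and
nothing else. -/
theorem card_edgeSet_toSimpleGraph (G : Graph V (Sym2 V))
    (hG : ∀ ε u v, G.IsLink ε u v ↔ ε = s(u, v) ∧ ε ∈ G.edgeSet) :
    Nat.card G.toSimpleGraph.edgeSet = {ε ∈ G.edgeSet | ¬ ε.IsDiag}.ncard := by
  rw [Nat.card_coe_set_eq,
    ← ncard_image_of_injective _ (Sym2.map.injective Subtype.val_injective)]
  congr 1
  ext ε
  induction ε with
  | h u v =>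
    constructor
    · rintro ⟨e, he, hmap⟩
      induction e with
      | h x y =>
        rw [SimpleGraph.mem_edgeSet, Graph.toSimpleGraph_adj] at he
        obtain ⟨hne, ε, hε⟩ := he
        rw [Sym2.map_mk] at hmap
        have h1 := (hG _ _ _).1 hε
        rw [h1.1] at h1
        rw [← hmap]
        exact ⟨h1.2, fun hd => hne (Subtype.ext (Sym2.mk_isDiag_iff.1 hd))⟩
    · rintro ⟨h1, h2⟩
      have h3 : G.IsLink s(u, v) u v := (hG _ _ _).2 ⟨rfl, h1⟩
      refine ⟨s(⟨u, h3.left_mem⟩, ⟨v, h3.right_mem⟩), ?_, rfl⟩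
      rw [SimpleGraph.mem_edgeSet, Graph.toSimpleGraph_adj]
      exact ⟨fun h4 => h2 (Sym2.mk_isDiag_iff.2 (congrArg Subtype.val h4)), h3.adj⟩

variable [Finite V]

/-- The underlying simple graph is connected and so has at least (vertices − 1) edges, none of them
a loop. If the total edge count attains this bound there are no loops, and the simple graph is a
tree. -/
theorem isTree_elementarization_iff {T : OrientedGraph V E}
    (hc : IsConnected T.elementarization) :
    IsTree T.elementarization ↔
      T.elementarization.edgeSet.ncard + 1 = T.vertexSet.ncard := by
  have h1 := card_edgeSet_toSimpleGraph T.elementarization fun _ _ _ => isLink_elementarization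
  have h2 : Nat.card T.elementarization.vertexSet = T.vertexSet.ncard := Nat.card_coe_set_eq _
  constructor
  · rintro ⟨hl, ht⟩
    rw [SimpleGraph.isTree_iff_connected_and_card, h1, h2] at ht
    rw [← ht.2]
    congr 2
    ext ε
    refine ⟨fun h => ⟨h, ?_⟩, fun h => h.1⟩
    induction ε with
    | h u v =>
      intro hd
      have : u = v := Sym2.mk_isDiag_iff.1 hd
      subst this
      exact hl.not_isLoopAt s(u, u) u ⟨rfl, h⟩
  · intro h
    have h3 : {ε ∈ T.elementarization.edgeSet | ¬ ε.IsDiag}.ncard ≤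
        T.elementarization.edgeSet.ncard := ncard_le_ncard (fun _ h => h.1) (toFinite _)
    have h4 := SimpleGraph.Connected.card_vert_le_card_edgeSet_add_one hc
    rw [h1, h2] at h4
    refine ⟨⟨fun ε u hl => ?_⟩, ?_⟩
    · have h5 := eq_of_subset_of_ncard_le
        (s := {ε ∈ T.elementarization.edgeSet | ¬ ε.IsDiag}) (t := T.elementarization.edgeSet)
        (fun _ h => h.1) (by omega) (toFinite _)
      have h6 := isLink_elementarization.1 hl
      have h7 : ε ∈ {ε ∈ T.elementarization.edgeSet | ¬ ε.IsDiag} := h5.symm ▸ h6.2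
      exact h7.2 (h6.1 ▸ Sym2.mk_isDiag_iff.2 rfl)
    · rw [SimpleGraph.isTree_iff_connected_and_card, h1, h2]
      exact ⟨hc, by omega⟩

omit [Finite V] in
theorem exists_loop_circuit {T : OrientedGraph V E} {U : V}
    (h : s(U, U) ∈ T.elementarization.edgeSet) :
    ∃ C, IsCircuit T.elementarization C ∧ C.edgeSet = {s(U, U)} := by
  have hlink : T.elementarization.IsLink s(U, U) U U := ⟨rfl, h⟩
  let C : Graph V (Sym2 V) :=
    { vertexSet := {U}
      IsLink := fun ε x y => ε = s(U, U) ∧ x = U ∧ y = U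
      edgeSet := {s(U, U)}
      isLink_symm := fun ε _ => ⟨fun x y h => ⟨h.1, h.2.2, h.2.1⟩⟩
      eq_or_eq_of_isLink_of_isLink := fun ε x y v w h h' => Or.inl (h.2.1.trans h'.2.1.symm)
      edge_mem_iff_exists_isLink := fun ε =>
        ⟨fun h => ⟨U, U, h, rfl, rfl⟩, fun ⟨_, _, h, _⟩ => h⟩
      left_mem_of_isLink := fun ε x y h => h.2.1 }
  refine ⟨C, ⟨⟨?_, ?_⟩, ?_, ?_⟩, rfl⟩
  · intro x hx
    rw [show x = U from hx]
    exact hlink.left_mem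
  · rintro ε x y ⟨h1, h2, h3⟩
    rw [h1, h2, h3]
    exact hlink
  · refine isConnected_of_setoid ⟨U, rfl⟩ ?_
    intro r _ x hx y hy
    rw [show x = U from hx, show y = U from hy]
  · intro x hx
    rw [show x = U from hx]
    have h1 : C.incidenceSet U = {s(U, U)} := by
      ext ε
      exact ⟨fun ⟨_, h, _⟩ => h, fun h => ⟨U, h, rfl, rfl⟩⟩
    have h2 : C.loopSet U = {s(U, U)} := by
      ext ε
      exact ⟨fun h => h.1, fun h => ⟨h, rfl, rfl⟩⟩
    rw [degree, h1, h2, ncard_singleton]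

/-- A connected graph with as many vertices as edges contains a loop or a circuit with at least
three edges. -/
theorem exists_circuit {T : OrientedGraph V E} (hT : IsUnicircuit T.elementarization) :
    ∃ C, IsCircuit T.elementarization C ∧
      ((∃ U, C.edgeSet = {s(U, U)}) ∨ 3 ≤ C.edgeSet.ncard) := by
  by_cases hloop : ∃ U, s(U, U) ∈ T.elementarization.edgeSet
  · obtain ⟨U, hU⟩ := hloop
    obtain ⟨C, hC, hCU⟩ := exists_loop_circuit hU
    exact ⟨C, hC, Or.inl ⟨U, hCU⟩⟩
  push Not at hloop
  -- Without loops, equal numbers of vertices and edges rule out a tree, so the simple graph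
  -- contains a cycle, which has length at least three. Its subgraph is the required circuit.
  have hnt : ¬ IsTree T.elementarization := fun ht => by
    have h1 := (isTree_elementarization_iff hT.1).1 ht
    have h2 : T.vertexSet.ncard = T.elementarization.edgeSet.ncard := hT.2
    omega
  have hna : ¬ T.elementarization.toSimpleGraph.IsAcyclic := fun ha =>
    hnt ⟨⟨fun ε u hl => by
      have h6 := isLink_elementarization.1 hl
      exact hloop u (h6.1 ▸ h6.2)⟩, hT.1, ha⟩
  rw [SimpleGraph.IsAcyclic] at hna
  push Not at hna
  obtain ⟨u, w, hw⟩ := hna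
  let H := w.toSubgraph
  let C : Graph V (Sym2 V) :=
    { vertexSet := Subtype.val '' H.verts
      IsLink := fun ε x y => ε = s(x, y) ∧ ∃ hx hy, H.Adj ⟨x, hx⟩ ⟨y, hy⟩
      edgeSet := {ε | ∃ x y, ε = s(x, y) ∧ ∃ hx hy, H.Adj ⟨x, hx⟩ ⟨y, hy⟩}
      isLink_symm := fun ε _ =>
        ⟨fun x y ⟨h, hx, hy, ha⟩ => ⟨h.trans Sym2.eq_swap, hy, hx, H.adj_symm ha⟩⟩
      eq_or_eq_of_isLink_of_isLink := fun ε x y v w h h' => by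
        have h2 := h.1.symm.trans h'.1
        rw [Sym2.eq_iff] at h2
        exact h2.imp (fun h => h.1) (fun h => h.1)
      edge_mem_iff_exists_isLink := fun ε => Iff.rfl
      left_mem_of_isLink := fun ε x y ⟨_, hx, hy, ha⟩ => ⟨⟨x, hx⟩, H.edge_vert ha, rfl⟩ }
  have hlink : ∀ ε x y, C.IsLink ε x y → T.elementarization.IsLink ε x y := by
    rintro ε x y ⟨rfl, hx, hy, ha⟩
    have h1 := H.adj_sub ha
    rw [Graph.toSimpleGraph_adj] at h1
    obtain ⟨-, ε, hε⟩ := h1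
    obtain ⟨h2, h3⟩ := isLink_elementarization.1 hε
    exact ⟨rfl, h2 ▸ h3⟩
  refine ⟨C, ⟨⟨?_, ?_⟩, ?_, ?_⟩, Or.inr ?_⟩
  · rintro _ ⟨x, -, rfl⟩; exact x.2
  · exact hlink
  · have hconn : H.coe.Connected := (SimpleGraph.Walk.toSubgraph_connected w).coe
    have hu : u ∈ H.verts := SimpleGraph.Walk.start_mem_verts_toSubgraph w
    refine isConnected_of_setoid ⟨u, ⟨u, hu, rfl⟩⟩ ?_
    rintro r hr _ ⟨x, hx, rfl⟩ _ ⟨y, hy, rfl⟩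
    obtain ⟨p⟩ := hconn.preconnected ⟨x, hx⟩ ⟨y, hy⟩
    have aux : ∀ a b : H.verts, H.coe.Walk a b → r a.1.1 b.1.1 := by
      intro a b p
      induction p with
      | nil => exact r.refl' _
      | cons hab _ ih => exact r.trans' (hr _ _ _ ⟨rfl, _, _, hab⟩) ih
    exact aux _ _ p
  · rintro _ ⟨x, hx, rfl⟩
    have h1 : C.loopSet x = ∅ := by
      rw [eq_empty_iff_forall_notMem]
      rintro ε hε
      obtain ⟨h2, h3⟩ := isLink_elementarization.1 (hlink _ _ _ hε)
      exact hloop _ (h2 ▸ h3)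
    have h2 : C.incidenceSet x = (fun y : T.elementarization.vertexSet => s(x.1, y.1)) ''
        (H.neighborSet x) := by
      ext ε
      constructor
      · rintro ⟨y, rfl, hx, hy, ha⟩
        exact ⟨⟨y, hy⟩, ha, rfl⟩
      · rintro ⟨y, ha, rfl⟩
        exact ⟨y, rfl, x.2, y.2, ha⟩
    have h3 := hw.ncard_neighborSet_toSubgraph_eq_two
      ((SimpleGraph.Walk.mem_verts_toSubgraph w).1 hx)
    rw [degree, h1, h2, ncard_image_of_injective, ncard_empty]
    · exact h3
    · intro y z hyz
      rcases Sym2.eq_iff.1 hyz with h | h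
      · exact Subtype.ext h.2
      · exact Subtype.ext (h.2.trans h.1)
  · have h1 : C.edgeSet = Sym2.map Subtype.val '' {e | e ∈ w.edges} := by
      ext ε
      constructor
      · rintro ⟨x, y, rfl, hx, hy, ha⟩
        exact ⟨s(⟨x, hx⟩, ⟨y, hy⟩), (SimpleGraph.Walk.mem_edges_toSubgraph w).1 ha, rfl⟩
      · rintro ⟨e, he, rfl⟩
        induction e with
        | h x y =>
          exact ⟨x, y, rfl, x.2, y.2, (SimpleGraph.Walk.mem_edges_toSubgraph w).2 he⟩
    rw [h1, ncard_image_of_injective _ (Sym2.map.injective Subtype.val_injective)]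
    classical
    have h2 : {e | e ∈ w.edges} = (w.edges.toFinset : Set _) := by ext; simp
    rw [h2, ncard_coe_finset, List.toFinset_card_of_nodup hw.edges_nodup,
      SimpleGraph.Walk.length_edges]
    exact hw.three_le_length

end Elementarization
end LimitGraphs

namespace LimitGraphs
open Set

/-! ### Translating graph conditions into conditions on partitions -/

section Dictionary

variable {X : Type*} {γ : Equiv.Perm X} {π : Setoid X}

variable (γ π) in
/-- The edges with labels in `S` come in pairs of opposite edges, and edges from distinct pairs are
not equivalent. -/
def IsDoubledOn (S : Set X) : Prop :=
  ∀ x ∈ S, ∃ y ∈ S, y ≠ x ∧ π x (γ y) ∧ π y (γ x) ∧ ∀ z ∈ S, edgeSetoid γ π z x → z = x ∨ z = y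

theorem ends_eq_iff {T : OrientedGraph (Quotient π) X} (hs : ∀ x, T.source x = Quotient.mk π (γ x))
    (ht : ∀ x, T.target x = Quotient.mk π x) {x y : X} :
    T.ends x = T.ends y ↔ edgeSetoid γ π x y := by
  simp only [OrientedGraph.ends, hs, ht]
  rfl

theorem ncard_edgeSet_elementarization {T : OrientedGraph (Quotient π) X}
    (hs : ∀ x, T.source x = Quotient.mk π (γ x)) (ht : ∀ x, T.target x = Quotient.mk π x) :
    T.elementarization.edgeSet.ncard = blocks (edgeSetoid γ π) T.edgeSet := by
  rw [blocks_eq_ncard_image T.ends fun p _ q _ => (ends_eq_iff hs ht).symm]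
  rfl

theorem opposite_iff {T : OrientedGraph (Quotient π) X} (hs : ∀ x, T.source x = Quotient.mk π (γ x))
    (ht : ∀ x, T.target x = Quotient.mk π x) {x y : X} :
    T.Opposite x y ↔ π x (γ y) ∧ π y (γ x) := by
  rw [OrientedGraph.Opposite, hs, hs, ht, ht, mk_eq_mk, mk_eq_mk]
  exact ⟨fun h => ⟨h.2, π.symm' h.1⟩, fun h => ⟨π.symm' h.2, h.1⟩⟩

theorem isDoubled_iff {T : OrientedGraph (Quotient π) X}
    (hs : ∀ x, T.source x = Quotient.mk π (γ x)) (ht : ∀ x, T.target x = Quotient.mk π x) :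
    T.IsDoubled ↔ IsDoubledOn γ π T.edgeSet := by
  have hmem : ∀ x, ∀ z, z ∈ T.edgeClass (T.ends x) ↔ z ∈ T.edgeSet ∧ edgeSetoid γ π z x :=
    fun x z => and_congr_right fun _ => ends_eq_iff hs ht
  constructor
  · intro h x hx
    obtain ⟨e, f, hef, hc, ho⟩ := h (T.ends x) ⟨x, hx, rfl⟩
    rw [opposite_iff hs ht] at ho
    have h1 : ∀ z, z ∈ T.edgeSet ∧ edgeSetoid γ π z x ↔ z = e ∨ z = f := fun z => by
      rw [← hmem, hc]; rfl
    rcases (h1 x).1 ⟨hx, (edgeSetoid γ π).refl' x⟩ with rfl | rfl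
    · exact ⟨f, ((h1 f).2 (Or.inr rfl)).1, hef.symm, ho.1, ho.2,
        fun z hz hzx => (h1 z).1 ⟨hz, hzx⟩⟩
    · exact ⟨e, ((h1 e).2 (Or.inl rfl)).1, hef, ho.2, ho.1,
        fun z hz hzx => ((h1 z).1 ⟨hz, hzx⟩).symm⟩
  · rintro h _ ⟨x, hx, rfl⟩
    obtain ⟨y, hy, hyx, h1, h2, h3⟩ := h x hx
    refine ⟨x, y, hyx.symm, ?_, (opposite_iff hs ht).2 ⟨h1, h2⟩⟩
    ext z
    rw [hmem]
    constructor
    · rintro ⟨hz, hzx⟩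
      exact h3 z hz hzx
    · rintro (rfl | rfl)
      · exact ⟨hx, (edgeSetoid γ π).refl' _⟩
      · exact ⟨hy, edgeSetoid_apply.2 (Or.inr ⟨h2, h1⟩)⟩

end Dictionary

/-! ### The graphs of the basic cycles and their unions -/

section Sectors

variable {m : Fin 3 → ℕ}

/-- The union of the basic cycles with index in `J`. -/
def sector (m : Fin 3 → ℕ) (J : Set (Fin 3)) : Set (Point m) := {x | x.1 ∈ J}

theorem mem_sector {J : Set (Fin 3)} {x : Point m} : x ∈ sector m J ↔ x.1 ∈ J := Iff.rfl

theorem gamma_mem_sector {J : Set (Fin 3)} : ∀ z ∈ sector m J, gamma m z ∈ sector m J :=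
  fun _ hz => hz

theorem finRotate_mk {N : ℕ} (n : ℕ) (h : n + 1 < N) :
    finRotate N ⟨n, by omega⟩ = ⟨n + 1, h⟩ := by
  obtain ⟨k, rfl⟩ : ∃ k, N = k + 1 := ⟨N - 1, by omega⟩
  exact finRotate_of_lt (by omega)

/-- Walk along the basic cycle from position 0. The closing edge of the cycle is not needed. -/
theorem rel_of_fst_eq {W : Setoid (Point m)} {j : Fin 3} (h : ∀ z : Point m, z.1 = j → W z (gamma m z))
    {x y : Point m} (hx : x.1 = j) (hy : y.1 = j) : W x y := by
  obtain ⟨j', a⟩ := x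
  obtain ⟨j'', b⟩ := y
  subst hx
  simp only at hy
  subst hy
  have key : ∀ n (hn : n < m j''), W ⟨j'', ⟨0, by omega⟩⟩ ⟨j'', ⟨n, hn⟩⟩ := by
    intro n
    induction n with
    | zero => intro hn; exact W.refl' _
    | succ n ih =>
      intro hn
      refine W.trans' (ih (by omega)) ?_
      have h1 := h ⟨j'', ⟨n, by omega⟩⟩ rfl
      have h2 : gamma m ⟨j'', ⟨n, by omega⟩⟩ = ⟨j'', ⟨n + 1, hn⟩⟩ := by
        exact congrArg (Sigma.mk j'') (finRotate_mk n hn)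
      rwa [h2] at h1
  exact W.trans' (W.symm' (key a.1 a.2)) (key b.1 b.2)

theorem cycles_gamma_apply {x y : Point m} : cycles (gamma m) x y ↔ x.1 = y.1 := by
  constructor
  · intro h
    exact (cycles_le_iff (W := Setoid.ker fun x : Point m => x.1)).2 (fun p => rfl) h
  · intro h
    exact rel_of_fst_eq (fun z _ => cycles_self_apply _ z) rfl h.symm

theorem connects_singleton (π : Setoid (Point m)) (j : Fin 3) :
    Connects (gamma m) π (sector m {j}) :=
  fun _ _ h2 _ hp _ hq => rel_of_fst_eq (fun z hz => h2 z hz) hp hq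

theorem connects_pair {π : Setoid (Point m)} {j k : Fin 3} {x y : Point m} (hx : x.1 = j)
    (hy : y.1 = k) (hxy : π x y) : Connects (gamma m) π (sector m {j, k}) := by
  intro W h1 h2
  have hj : ∀ p : Point m, p.1 = j → W p x := fun p hp =>
    rel_of_fst_eq (fun z hz => h2 z (Or.inl hz)) hp hx
  have hk : ∀ p : Point m, p.1 = k → W p x := fun p hp =>
    W.trans' (rel_of_fst_eq (fun z hz => h2 z (Or.inr hz)) hp hy) (W.symm' (h1 hxy))
  have hp : ∀ p ∈ sector m {j, k}, W p x := fun p hp => hp.elim (hj p) (hk p)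
  exact fun p hp' q hq' => W.trans' (hp p hp') (W.symm' (hp q hq'))

theorem quotientGraph_source (π : Setoid (Point m)) (J : Set (Fin 3)) (x : Point m) :
    (quotientGraph π J).source x = Quotient.mk π (gamma m x) := rfl

theorem quotientGraph_target (π : Setoid (Point m)) (J : Set (Fin 3)) (x : Point m) :
    (quotientGraph π J).target x = Quotient.mk π x := rfl

theorem ncard_vertexSet (π : Setoid (Point m)) (J : Set (Fin 3)) :
    (quotientGraph π J).vertexSet.ncard = blocks π (sector m J) := rfl

theorem ncard_edgeSet (π : Setoid (Point m)) (J : Set (Fin 3)) :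
    (quotientGraph π J).elementarization.edgeSet.ncard =
      blocks (edgeSetoid (gamma m) π) (sector m J) :=
  ncard_edgeSet_elementarization (quotientGraph_source π J) (quotientGraph_target π J)

theorem isConnected_of_connects {π : Setoid (Point m)} {J : Set (Fin 3)}
    (h : Connects (gamma m) π (sector m J)) (hne : (sector m J).Nonempty) :
    IsConnected (quotientGraph π J).elementarization := by
  refine isConnected_elementarization (hne.image _) ?_
  rintro r hr _ ⟨p, hp, rfl⟩ _ ⟨q, hq, rfl⟩
  refine h (Setoid.comap (Quotient.mk π) r) ?_ ?_ p hp q hq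
  · intro a b hab
    rw [Setoid.comap_rel, Quotient.sound (s := π) hab]
  · intro z hz
    exact r.symm' (hr z hz)

theorem isDoubleTree_iff (hm : ∀ j, 0 < m j) {π : Setoid (Point m)} {j : Fin 3} :
    (quotientGraph π {j}).IsDoubleTree ↔
      blocks (edgeSetoid (gamma m) π) (sector m {j}) + 1 = blocks π (sector m {j}) ∧
        IsDoubledOn (gamma m) π (sector m {j}) := by
  have hc := isConnected_of_connects (connects_singleton π j) ⟨⟨j, ⟨0, hm j⟩⟩, rfl⟩
  rw [OrientedGraph.IsDoubleTree, isTree_elementarization_iff hc, ncard_edgeSet, ncard_vertexSet,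
    isDoubled_iff (quotientGraph_source π {j}) (quotientGraph_target π {j})]
  rfl

/-- The two loops form a single edge class, so restoring them to the double tree adds one edge and
no vertex, and "edges + 1 = vertices" becomes "edges = vertices". -/
theorem isDoubleUniloopAt_iff (hm : ∀ j, 0 < m j) {π : Setoid (Point m)} {i : Fin 3}
    {U : Quotient π} :
    (quotientGraph π {i}).IsDoubleUniloopAt U ↔
      ∃ x ∈ sector m {i}, Quotient.mk π x = U ∧ π x (gamma m x) ∧
        IsDoubledOn (gamma m) π (sector m {i}) ∧
        blocks π (sector m {i}) = blocks (edgeSetoid (gamma m) π) (sector m {i}) := by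
  set T := quotientGraph π {i} with hT
  set S := sector m {i} with hS
  set E := edgeSetoid (gamma m) π with hE
  have hends : ∀ x, T.ends x = s(U, U) ↔ Quotient.mk π x = U ∧ π x (gamma m x) := by
    intro x
    rw [OrientedGraph.ends, Sym2.eq_iff, or_self]
    show Quotient.mk π (gamma m x) = U ∧ Quotient.mk π x = U ↔ _
    constructor
    · rintro ⟨h1, h2⟩; exact ⟨h2, mk_eq_mk.1 (h2.trans h1.symm)⟩
    · rintro ⟨h1, h2⟩; exact ⟨(mk_eq_mk.2 h2).symm.trans h1, h1⟩
  have htree : ∀ F : Set (Point m), (∀ z ∈ F, π z (gamma m z)) →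
      ((T.deleteEdges F).IsDoubleTree ↔ blocks E (S \ F) + 1 = blocks π S ∧
        IsDoubledOn (gamma m) π (S \ F)) := by
    intro F hF
    have hc : IsConnected (T.deleteEdges F).elementarization := by
      refine isConnected_elementarization ⟨_, ⟨⟨i, ⟨0, hm i⟩⟩, rfl, rfl⟩⟩ ?_
      rintro r hr _ ⟨p, hp, rfl⟩ _ ⟨q, hq, rfl⟩
      refine connects_singleton π i (Setoid.comap (Quotient.mk π) r) ?_ ?_ p hp q hq
      · intro a b hab
        rw [Setoid.comap_rel, Quotient.sound (s := π) hab]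
      · intro z hz
        by_cases hzF : z ∈ F
        · rw [Setoid.comap_rel, Quotient.sound (s := π) (hF z hzF)]
        · exact r.symm' (hr z ⟨hz, hzF⟩)
    rw [OrientedGraph.IsDoubleTree, isTree_elementarization_iff hc,
      ncard_edgeSet_elementarization (T := T.deleteEdges F) (γ := gamma m) (fun _ => rfl)
        (fun _ => rfl),
      isDoubled_iff (T := T.deleteEdges F) (γ := gamma m) (fun _ => rfl) (fun _ => rfl)]
    rfl
  constructor
  · rintro ⟨e, he, f, hf, hef, h1, h2, h3⟩
    rw [hends] at h1 h2
    rw [htree {e, f} (by rintro z (rfl | rfl); exacts [h1.2, h2.2])] at h3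
    obtain ⟨h3, h4⟩ := h3
    have hEef : E f e := by
      have h5 : π f e := mk_eq_mk.1 (h2.1.trans h1.1.symm)
      exact edgeSetoid_apply.2 (Or.inl ⟨h5, π.trans' (π.symm' h2.2) (π.trans' h5 h1.2)⟩)
    have hle : S \ {z | E z e} ⊆ S \ {e, f} := by
      rintro z ⟨hz, hze⟩
      refine ⟨hz, ?_⟩
      rintro (rfl | rfl)
      · exact hze (E.refl' _)
      · exact hze hEef
    -- A further loop could be discarded together with `e` and `f` without disconnecting the graph,
    -- and then too few edges would remain. Hence `e` and `f` exhaust their class.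
    have hnl : ∀ z ∈ S \ {e, f}, ¬ π z (gamma m z) := by
      intro z hz hl
      obtain ⟨W, hW1, hW2, hW3⟩ := exists_join_edges (γ := gamma m) π S (S \ ({e, f} ∪ {w | E w z}))
      have h6 : blocks W S ≤ 1 := blocks_le_one (connects_singleton π i W hW1 fun w hw => by
        by_cases hwe : w ∈ ({e, f} : Set (Point m))
        · rcases hwe with rfl | rfl
          · exact hW1 h1.2
          · exact hW1 h2.2
        · by_cases hwz : E w z
          · exact rel_gamma_of_edgeSetoid hW1 (E.symm' hwz) (hW1 hl)
          · exact hW2 w ⟨hw, by rintro (h | h); exacts [hwe h, hwz h]⟩)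
      have h7 := blocks_diff_class E hz
      have h8 : S \ ({e, f} ∪ {w | E w z}) = (S \ {e, f}) \ {w | E w z} :=
        (_root_.sdiff_sdiff _ _ _).symm
      rw [h8] at hW3
      have hW4 : blocks π S ≤ blocks W S + blocks E ((S \ {e, f}) \ {w | E w z}) := hW3
      omega
    have hcl : ∀ z ∈ S, E z e → z = e ∨ z = f := by
      intro z hz hze
      by_contra hcon
      exact hnl z ⟨hz, hcon⟩ (rel_gamma_of_edgeSetoid le_rfl (E.symm' hze) h1.2)
    refine ⟨e, he, h1.1, h1.2, ?_, ?_⟩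
    · intro x hx
      by_cases hxe : x = e
      · subst hxe
        have h5 : π f x := mk_eq_mk.1 (h2.1.trans h1.1.symm)
        exact ⟨f, hf, hef.symm, π.trans' (π.symm' h5) h2.2, π.trans' h5 h1.2, hcl⟩
      · by_cases hxf : x = f
        · subst hxf
          have h5 : π x e := mk_eq_mk.1 (h2.1.trans h1.1.symm)
          exact ⟨e, he, hef, π.trans' h5 h1.2, π.trans' (π.symm' h5) h2.2,
            fun z hz hzx => (hcl z hz (E.trans' hzx hEef)).symm⟩
        · obtain ⟨y, hy, hyx, h5, h6, h7⟩ := h4 x ⟨hx, by rintro (h | h); exacts [hxe h, hxf h]⟩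
          refine ⟨y, hy.1, hyx, h5, h6, fun z hz hzx => h7 z ⟨hz, ?_⟩ hzx⟩
          intro hzef
          have hzl : π z (gamma m z) := by
            rcases hzef with rfl | rfl
            · exact h1.2
            · exact h2.2
          exact hnl x ⟨hx, by rintro (h | h); exacts [hxe h, hxf h]⟩
            (rel_gamma_of_edgeSetoid le_rfl hzx hzl)
    · have h5 : S \ {e, f} = S \ {z | E z e} := by
        refine Subset.antisymm ?_ hle
        rintro z ⟨hz, hzef⟩
        exact ⟨hz, fun h => hzef (hcl z hz h)⟩
      rw [h5] at h3
      rw [← h3]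
      exact blocks_diff_class E he
  · rintro ⟨x, hx, hxU, hl, hd, hb⟩
    obtain ⟨y, hy, hyx, h1, h2, h3⟩ := hd x hx
    have hyl : π y (gamma m y) := π.trans' h2 (π.trans' (π.symm' hl) h1)
    have hEyx : E y x := edgeSetoid_apply.2 (Or.inr ⟨h2, h1⟩)
    refine ⟨x, hx, y, hy, hyx.symm, (hends x).2 ⟨hxU, hl⟩,
      (hends y).2 ⟨(mk_eq_mk.2 (π.trans' h2 (π.symm' hl))).trans hxU, hyl⟩, ?_⟩
    rw [htree {x, y} (by rintro z (rfl | rfl); exacts [hl, hyl])]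
    have h5 : S \ {x, y} = S \ {z | E z x} := by
      ext z
      refine and_congr_right fun hz => not_congr ⟨?_, h3 z hz⟩
      rintro (rfl | rfl)
      · exact E.refl' _
      · exact hEyx
    rw [h5]
    refine ⟨by rw [hb]; exact blocks_diff_class E hx, ?_⟩
    rintro z ⟨hz, hzx⟩
    obtain ⟨w, hw, hwz, h6, h7, h8⟩ := hd z hz
    have hEwz : E w z := edgeSetoid_apply.2 (Or.inr ⟨h7, h6⟩)
    exact ⟨w, ⟨hw, fun h => hzx (E.trans' (E.symm' hEwz) h)⟩, hwz, h6, h7,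
      fun u hu huz => h8 u hu.1 huz⟩

theorem joinedAlongEdge_iff {π : Setoid (Point m)} {J K : Set (Fin 3)} {ε : Sym2 (Quotient π)} :
    (quotientGraph π J).JoinedAlongEdge (quotientGraph π K) ε ↔
      ∃ x ∈ sector m J, ∃ y ∈ sector m K, ε = s(Quotient.mk π (gamma m x), Quotient.mk π x) ∧
        edgeSetoid (gamma m) π x y ∧
        Quotient.mk π '' sector m J ∩ Quotient.mk π '' sector m K =
          {Quotient.mk π x, Quotient.mk π (gamma m x)} := by
  have hset : ∀ x : Point m, {v | v ∈ s(Quotient.mk π (gamma m x), Quotient.mk π x)} =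
      {Quotient.mk π x, Quotient.mk π (gamma m x)} := by
    intro x; ext v; simp [or_comm]
  constructor
  · rintro ⟨⟨x, hx, rfl⟩, ⟨y, hy, hxy⟩, h⟩
    refine ⟨x, hx, y, hy, rfl, ?_, h.trans (hset x)⟩
    exact hxy.symm
  · rintro ⟨x, hx, y, hy, rfl, hxy, h⟩
    exact ⟨⟨x, hx, rfl⟩, ⟨y, hy, hxy.symm⟩, h.trans (hset x).symm⟩

end Sectors
end LimitGraphs

namespace LimitGraphs
open Set

/-! ### Double unicircuit graphs -/

section Unicircuit

variable {m : Fin 3 → ℕ} {π : Setoid (Point m)} {j k : Fin 3}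

theorem IsDoubledOn.eq_of_ne {S : Set (Point m)} (h : IsDoubledOn (gamma m) π S) {x y z : Point m}
    (hx : x ∈ S) (hy : y ∈ S) (hz : z ∈ S) (hyx : edgeSetoid (gamma m) π y x) (hne : y ≠ x)
    (hzx : edgeSetoid (gamma m) π z x) : z = x ∨ z = y := by
  obtain ⟨w, -, -, -, -, h1⟩ := h x hx
  rcases h1 y hy hyx with rfl | rfl
  · exact absurd rfl hne
  · exact h1 z hz hzx

theorem rel_link_of_edge {x y : Point m} (h : edgeSetoid (gamma m) π x y) :
    ∃ z : Point m, z.1 = y.1 ∧ π x z := by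
  rcases edgeSetoid_apply.1 h with ⟨h1, -⟩ | ⟨h1, -⟩
  · exact ⟨y, rfl, h1⟩
  · exact ⟨gamma m y, rfl, h1⟩

theorem connects_pair_of_edge {x y : Point m} (hx : x.1 = j) (hy : y.1 = k)
    (h : edgeSetoid (gamma m) π x y) : Connects (gamma m) π (sector m {j, k}) := by
  obtain ⟨z, hz, hxz⟩ := rel_link_of_edge h
  exact connects_pair hx (hz.trans hy) hxz

/-- In a doubled unicircuit graph, an edge that does not belong to both closed walks is a cut
edge. -/
theorem false_of_not_cut (hjk : j ≠ k)
    (hb : blocks π (sector m {j, k}) = blocks (edgeSetoid (gamma m) π) (sector m {j, k}))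
    (hd : IsDoubledOn (gamma m) π (sector m {j, k})) {x y x₀ : Point m} (hx : x.1 = j)
    (hy : y.1 = k) (hxy : edgeSetoid (gamma m) π x y) (hx₀ : x₀ ∈ sector m {j, k})
    (hcl : ∀ z, edgeSetoid (gamma m) π z x₀ → z.1 ≠ k)
    (hcut : ∀ W : Setoid (Point m), π ≤ W →
      (∀ z ∈ sector m {j, k}, ¬ edgeSetoid (gamma m) π z x₀ → W z (gamma m z)) →
        W x₀ (gamma m x₀)) : False := by
  set S := sector m {j, k} with hS
  set E := edgeSetoid (gamma m) π with hE
  have hxS : x ∈ S := Or.inl hx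
  have hyS : y ∈ S := Or.inr hy
  have hyx₀ : ¬ E y x₀ := fun h => hcl y h hy
  have hyF : y ∈ S \ {z | E z x₀} := ⟨hyS, hyx₀⟩
  have h1 := blocks_diff_class E hx₀
  have h2 := blocks_diff_class E hyF
  have hF : ∀ W : Setoid (Point m), π ≤ W →
      (∀ z ∈ (S \ {z | E z x₀}) \ {z | E z y}, W z (gamma m z)) → W y (gamma m y) →
        ∀ p ∈ S, ∀ q ∈ S, W p q := by
    intro W hW1 hW2 hW3
    have hW4 : ∀ z ∈ S, ¬ E z x₀ → W z (gamma m z) := by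
      intro z hz hzx₀
      by_cases hzy : E z y
      · exact rel_gamma_of_edgeSetoid hW1 (E.symm' hzy) hW3
      · exact hW2 z ⟨⟨hz, hzx₀⟩, hzy⟩
    refine connects_pair_of_edge hx hy hxy W hW1 fun z hz => ?_
    by_cases hzx₀ : E z x₀
    · exact rel_gamma_of_edgeSetoid hW1 (E.symm' hzx₀) (hcut W hW1 hW4)
    · exact hW4 z hz hzx₀
  have hKF : ∀ z ∈ sector m {k}, z ∈ (S \ {z | E z x₀}) \ {z | E z y} ∨ π z (gamma m z) ∨ E z y := by
    intro z hz
    by_cases hzy : E z y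
    · exact Or.inr (Or.inr hzy)
    · exact Or.inl ⟨⟨Or.inr hz, fun h => hcl z h hz⟩, hzy⟩
  -- Without the class of `x₀` the graph is a connected tree. The closed walk of the `k`-th cycle
  -- avoids that class, so it must traverse the edge `y` twice; but the class of `y` is already
  -- filled by `y` and by `x`, which lies on the `j`-th cycle.
  obtain ⟨z, hz, hzy, hEz⟩ := exists_edge_back (K := sector m {k}) hF
    (show blocks E _ + 1 < _ by omega) gamma_mem_sector hy hKF
  rcases hd.eq_of_ne hyS hxS (Or.inr hz) hxy (by rintro rfl; exact hjk (hx.symm.trans hy)) hEz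
    with h | h
  · exact hzy h
  · exact hjk (hx.symm.trans (h ▸ hz))

theorem ends_eq_iff' {J : Set (Fin 3)} {x y : Point m} :
    (quotientGraph π J).ends x = (quotientGraph π J).ends y ↔ edgeSetoid (gamma m) π x y :=
  ends_eq_iff (quotientGraph_source π J) (quotientGraph_target π J)

/-- Removing an edge of a circuit does not disconnect. -/
theorem circuit_not_cut {J : Set (Fin 3)} {C : Graph (Quotient π) (Sym2 (Quotient π))}
    (hC : IsCircuit (quotientGraph π J).elementarization C) {x₀ : Point m}
    (hx₀ : (quotientGraph π J).ends x₀ ∈ C.edgeSet) (W : Setoid (Point m)) (hW : π ≤ W)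
    (h : ∀ z ∈ sector m J, ¬ edgeSetoid (gamma m) π z x₀ → W z (gamma m z)) :
    W x₀ (gamma m x₀) := by
  let P : Quotient π → Prop := fun c => W c.out x₀
  have hP : ∀ z, P (Quotient.mk π z) ↔ W z x₀ := fun z => by
    have hz : W (Quotient.mk π z).out z := hW (Quotient.mk_out (s := π) z)
    exact ⟨fun h => W.trans' (W.symm' hz) h, fun h => W.trans' hz h⟩
  obtain ⟨u, v, huv⟩ := Graph.exists_isLink_of_mem_edgeSet hx₀
  have hcut := circuit_cut hC P huv ?_
  · have h1 := (isLink_elementarization.1 (huv.mono hC.1)).1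
    change s(Quotient.mk π (gamma m x₀), Quotient.mk π x₀) = s(u, v) at h1
    have h2 : P (Quotient.mk π x₀) := (hP x₀).2 (W.refl' x₀)
    rcases Sym2.eq_iff.1 h1 with ⟨h3, h4⟩ | ⟨h3, h4⟩
    · exact W.symm' ((hP _).1 (h3 ▸ hcut.2 (h4 ▸ h2)))
    · exact W.symm' ((hP _).1 (h3 ▸ hcut.1 (h4 ▸ h2)))
  · intro ε u v hε hne
    obtain ⟨h1, e, he, h2⟩ := isLink_elementarization.1 (hε.mono hC.1)
    have h3 : ¬ edgeSetoid (gamma m) π e x₀ := fun h3 => hne (h2.symm.trans (ends_eq_iff'.2 h3))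
    have h4 := h e he h3
    have h5 : P (Quotient.mk π e) ↔ P (Quotient.mk π (gamma m e)) := by
      rw [hP, hP]
      exact ⟨fun h => W.trans' (W.symm' h4) h, fun h => W.trans' h4 h⟩
    have h6 : s(Quotient.mk π (gamma m e), Quotient.mk π e) = s(u, v) := h2.trans h1
    rcases Sym2.eq_iff.1 h6 with ⟨h7, h8⟩ | ⟨h7, h8⟩
    · rw [← h7, ← h8]; exact h5.symm
    · rw [← h7, ← h8]; exact h5

theorem mem_edgeClass_ends {J : Set (Fin 3)} {x y : Point m} :
    y ∈ (quotientGraph π J).edgeClass ((quotientGraph π J).ends x) ↔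
      y ∈ sector m J ∧ edgeSetoid (gamma m) π y x :=
  and_congr_right fun _ => ends_eq_iff'

/-- The condition on all circuit edges reduces to the existence of one edge shared by the two closed
walks. Given such an edge, `false_of_not_cut` makes every edge used by only one walk a cut edge,
whereas `circuit_not_cut` says that circuit edges are not. Conversely, any edge of a circuit is
shared. -/
theorem isDoubleUnicircuit_iff (hjk : j ≠ k) :
    IsDoubleUnicircuit π j k ↔
      blocks π (sector m {j, k}) = blocks (edgeSetoid (gamma m) π) (sector m {j, k}) ∧
        IsDoubledOn (gamma m) π (sector m {j, k}) ∧
        ∃ x y : Point m, x.1 = j ∧ y.1 = k ∧ edgeSetoid (gamma m) π x y := by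
  have hdbl : (quotientGraph π {j, k}).IsDoubled ↔ IsDoubledOn (gamma m) π (sector m {j, k}) :=
    isDoubled_iff (quotientGraph_source π _) (quotientGraph_target π _)
  constructor
  · rintro ⟨h1, h2, h3⟩
    refine ⟨?_, hdbl.1 h2, ?_⟩
    · rw [← ncard_edgeSet]; exact h1.2
    · obtain ⟨C, hC, hC'⟩ := exists_circuit h1
      obtain ⟨ε, hε⟩ : C.edgeSet.Nonempty := by
        rcases hC' with ⟨U, hU⟩ | hC'
        · exact hU ▸ singleton_nonempty _
        · exact nonempty_of_ncard_ne_zero (by omega)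
      obtain ⟨⟨x, hx, hxj⟩, y, hy, hyk⟩ := h3 C hC ε hε
      exact ⟨x, y, hxj, hyk, ends_eq_iff'.1 (hx.2.trans hy.2.symm)⟩
  · rintro ⟨hb, hd, x, y, hx, hy, hxy⟩
    have hconn := connects_pair_of_edge hx hy hxy
    refine ⟨⟨isConnected_of_connects hconn ⟨x, Or.inl hx⟩, ?_⟩, hdbl.2 hd, ?_⟩
    · rw [ncard_edgeSet]; exact hb
    · intro C hC ε hε
      obtain ⟨x₀, hx₀, rfl⟩ := hC.1.edgeSet_mono hε
      have hS : ∀ z, edgeSetoid (gamma m) π z x₀ → z ∈ sector m {j, k} →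
          z ∈ (quotientGraph π {j, k}).edgeClass ((quotientGraph π {j, k}).ends x₀) :=
        fun z hz hz' => mem_edgeClass_ends.2 ⟨hz', hz⟩
      constructor
      · by_contra! hcon
        have hcomm : ({k, j} : Set (Fin 3)) = {j, k} := pair_comm k j
        refine false_of_not_cut (j := k) (k := j) hjk.symm (by rw [hcomm]; exact hb)
          (by rw [hcomm]; exact hd) hy hx ((edgeSetoid (gamma m) π).symm' hxy)
          (by rw [hcomm]; exact hx₀)
          (fun z hz hzj => hcon z (hS z hz (Or.inl hzj)) hzj) ?_
        rw [hcomm]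
        exact circuit_not_cut hC hε
      · by_contra! hcon
        exact false_of_not_cut hjk hb hd hx hy hxy hx₀
          (fun z hz hzj => hcon z (hS z hz (Or.inr hzj)) hzj) (circuit_not_cut hC hε)

/-- A double unicircuit graph has a loop or three edges that belong to both closed walks. -/
theorem IsDoubleUnicircuit.loop_or_three (h : IsDoubleUnicircuit π j k) :
    (∃ y ∈ sector m {j, k}, π y (gamma m y)) ∨
      ∃ x : Fin 3 → Point m, (∀ i, (x i).1 = j) ∧
        (∀ i, ∃ y : Point m, y.1 = k ∧ edgeSetoid (gamma m) π (x i) y) ∧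
        ∀ i i', i ≠ i' → ¬ edgeSetoid (gamma m) π (x i) (x i') := by
  obtain ⟨C, hC, ⟨U, hU⟩ | h3⟩ := exists_circuit h.1
  · left
    obtain ⟨y, hy, hyU⟩ := hC.1.edgeSet_mono (hU ▸ mem_singleton _ : s(U, U) ∈ C.edgeSet)
    refine ⟨y, hy, ?_⟩
    change s(Quotient.mk π (gamma m y), Quotient.mk π y) = s(U, U) at hyU
    rw [Sym2.eq_iff, or_self] at hyU
    exact mk_eq_mk.1 (hyU.2.trans hyU.1.symm)
  · right
    obtain ⟨t, ht, htc⟩ := exists_subset_card_eq h3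
    obtain ⟨a, b, c, hab, hac, hbc, rfl⟩ := ncard_eq_three.1 htc
    have hex : ∀ i, ∃ x : Point m, x.1 = j ∧ (quotientGraph π {j, k}).ends x = ![a, b, c] i ∧
        ∃ y : Point m, y.1 = k ∧ edgeSetoid (gamma m) π x y := by
      intro i
      have hi : ![a, b, c] i ∈ C.edgeSet := by
        fin_cases i
        · exact ht (by simp)
        · exact ht (by simp)
        · exact ht (by simp)
      obtain ⟨⟨x, hx, hxj⟩, y, hy, hyk⟩ := h.2.2 C hC _ hi
      exact ⟨x, hxj, hx.2, y, hyk, ends_eq_iff'.1 (hx.2.trans hy.2.symm)⟩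
    choose x hx hxe hxy using hex
    refine ⟨x, hx, hxy, fun i i' hne hE => ?_⟩
    have hii : ![a, b, c] i = ![a, b, c] i' := by
      rw [← hxe, ← hxe]; exact ends_eq_iff'.2 hE
    fin_cases i <;> fin_cases i' <;> simp_all

/-- If a double unicircuit graph has a loop, then this is the only edge that belongs to both closed
walks. -/
theorem IsDoubleUnicircuit.edge_of_loop (hjk : j ≠ k) (h : IsDoubleUnicircuit π j k)
    {y : Point m} (hy : y ∈ sector m {j, k}) (hl : π y (gamma m y)) {u v : Point m}
    (hu : u ∈ sector m {j, k}) (hv : v ∈ sector m {j, k}) (huv : u.1 ≠ v.1)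
    (hE : edgeSetoid (gamma m) π v u) : edgeSetoid (gamma m) π u y := by
  obtain ⟨hb, hd, x₁, y₁, hx₁, hy₁, hxy⟩ := (isDoubleUnicircuit_iff hjk).1 h
  set S := sector m {j, k} with hS
  set E := edgeSetoid (gamma m) π
  by_contra hcon
  have huF : u ∈ S \ {z | E z y} := ⟨hu, hcon⟩
  have h1 := blocks_diff_class E hy
  have h2 := blocks_diff_class E huF
  have hF : ∀ W : Setoid (Point m), π ≤ W →
      (∀ z ∈ (S \ {z | E z y}) \ {z | E z u}, W z (gamma m z)) → W u (gamma m u) →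
        ∀ p ∈ S, ∀ q ∈ S, W p q := by
    intro W hW1 hW2 hW3
    refine connects_pair_of_edge hx₁ hy₁ hxy W hW1 fun z hz => ?_
    by_cases hzy : E z y
    · exact rel_gamma_of_edgeSetoid hW1 (E.symm' hzy) (hW1 hl)
    · by_cases hzu : E z u
      · exact rel_gamma_of_edgeSetoid hW1 (E.symm' hzu) hW3
      · exact hW2 z ⟨⟨hz, hzy⟩, hzu⟩
  have hKS : ∀ z ∈ sector m {u.1}, z ∈ S := by
    intro z hz
    rw [hS, mem_sector, show z.1 = u.1 from hz]; exact hu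
  have hKF : ∀ z ∈ sector m {u.1},
      z ∈ (S \ {z | E z y}) \ {z | E z u} ∨ π z (gamma m z) ∨ E z u := by
    intro z hz
    by_cases hzy : E z y
    · exact Or.inr (Or.inl (rel_gamma_of_edgeSetoid le_rfl (E.symm' hzy) hl))
    · by_cases hzu : E z u
      · exact Or.inr (Or.inr hzu)
      · exact Or.inl ⟨⟨hKS z hz, hzy⟩, hzu⟩
  -- Discarding the loop leaves a tree, in which the closed walk through `u` would traverse its edge
  -- twice. The class of `u` consists of `u` and `v`, and `v` is on the other walk.
  obtain ⟨z, hz, hzu, hEz⟩ := exists_edge_back (K := sector m {u.1}) hF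
    (show blocks E _ + 1 < _ by omega) gamma_mem_sector rfl hKF
  rcases hd.eq_of_ne hu hv (hKS z hz) hE (by rintro rfl; exact huv rfl) hEz with h3 | h3
  · exact hzu h3
  · subst h3; exact huv hz.symm

end Unicircuit
end LimitGraphs

namespace LimitGraphs
open Set

/-! ### Cycles of products: conjugation, transpositions and parity -/

section PermLemmas

theorem blocks_cycles_mul_comm {X : Type*} (a b : Equiv.Perm X) :
    blocks (cycles (a * b)) univ = blocks (cycles (b * a)) univ := by
  have h : ∀ x y, cycles (b * a) x y ↔ cycles (a * b) (a x) (a y) := by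
    intro x y
    have h1 : b * a = a⁻¹ * (a * b) * a⁻¹⁻¹ := by group
    rw [cycles_apply, cycles_apply, h1, Equiv.Perm.sameCycle_conj]
    simp
  rw [blocks_eq_ncard_image (W := cycles (b * a)) (fun x => Quotient.mk (cycles (a * b)) (a x))
    fun p _ q _ => (h p q).trans mk_eq_mk.symm, blocks]
  congr 1
  ext c
  constructor
  · rintro ⟨x, -, rfl⟩
    exact ⟨a⁻¹ x, mem_univ _, by simp⟩
  · rintro ⟨x, -, rfl⟩
    exact ⟨a x, mem_univ _, rfl⟩

variable {X : Type*} [Finite X]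

/-- A transposition of points from different cycles merges these two cycles and leaves the others
alone. -/
theorem cycles_mul_swap [DecidableEq X] {g : Equiv.Perm X} {a b : X} (hab : ¬ cycles g a b) :
    cycles (g * Equiv.swap a b) = glue (cycles g) a b := by
  have hne : a ≠ b := by rintro rfl; exact hab ((cycles g).refl' _)
  set g' := g * Equiv.swap a b with hg'
  have ha : g' a = g b := by simp [hg']
  have hb : g' b = g a := by simp [hg']
  have ho : ∀ p, p ≠ a → p ≠ b → g' p = g p := fun p h1 h2 => by
    simp [hg', Equiv.swap_apply_of_ne_of_ne h1 h2]
  apply le_antisymm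
  · rw [cycles_le_iff]
    intro p
    have hgl : ∀ p, glue (cycles g) a b p (g p) := fun p =>
      le_glue _ _ _ (cycles_self_apply g p)
    by_cases h1 : p = a
    · rw [h1, ha]
      exact (glue _ _ _).trans' (glue_self _ _ _) (hgl b)
    · by_cases h2 : p = b
      · rw [h2, hb]
        exact (glue _ _ _).trans' ((glue _ _ _).symm' (glue_self _ _ _)) (hgl a)
      · rw [ho p h1 h2]; exact hgl p
  · have hba : cycles g' b a := by
      by_contra hcon
      -- If the new cycle through `b` missed `a`, the permutations `g` and `g'` would agree on `A`,
      -- so `g` would permute `A`. But `g a = g' b` lies in `A`, while its only preimage under `g`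
      -- is `a`, which does not.
      let A : Set X := {p | cycles g p a ∧ cycles g' b p}
      have hA : ∀ p ∈ A, p ≠ a ∧ p ≠ b := by
        rintro p ⟨h1, h2⟩
        constructor
        · rintro rfl; exact hcon h2
        · rintro rfl; exact hab ((cycles g).symm' h1)
      have h1 : g '' A ⊆ A := by
        rintro _ ⟨p, hp, rfl⟩
        refine ⟨(cycles g).trans' ((cycles g).symm' (cycles_self_apply g p)) hp.1, ?_⟩
        rw [← ho p (hA p hp).1 (hA p hp).2]
        exact (cycles g').trans' hp.2 (cycles_self_apply g' p)
      have h2 : g '' A = A := eq_of_subset_of_ncard_le h1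
        (by rw [ncard_image_of_injective _ g.injective]) (toFinite _)
      have h3 : g a ∈ A :=
        ⟨(cycles g).symm' (cycles_self_apply g a), hb ▸ cycles_self_apply g' b⟩
      rw [← h2] at h3
      obtain ⟨p, hp, hpa⟩ := h3
      exact (hA p hp).1 (g.injective hpa)
    refine glue_le (cycles_le_iff.2 fun p => ?_) ((cycles g').symm' hba)
    by_cases h1 : p = a
    · rw [h1, ← hb]
      exact (cycles g').trans' ((cycles g').symm' hba) (cycles_self_apply g' b)
    · by_cases h2 : p = b
      · rw [h2, ← ha]
        exact (cycles g').trans' hba (cycles_self_apply g' a)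
      · rw [← ho p h1 h2]; exact cycles_self_apply g' p

/-- The cycle type records only nontrivial cycles. Every fixed point adds one to the number of
points and one to the number of cycles, which cancels in the parity. -/
theorem sign_eq_neg_one_pow [Fintype X] [DecidableEq X] (g : Equiv.Perm X) :
    Equiv.Perm.sign g = (-1) ^ (Nat.card X + blocks (cycles g) univ) := by
  have h1 : blocks (cycles g) univ = blocks (cycles g) {x | g x ≠ x} + blocks (cycles g) {x | g x = x} := by
    rw [← blocks_union_of_not_rel]
    · congr 1; ext x; simp [em']
    · intro p hp q hq hpq
      have := (cycles_of_apply_eq hq).1 ((cycles g).symm' hpq)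
      rw [this] at hp
      exact hp hq
  have h2 : blocks (cycles g) {x | g x = x} = {x | g x = x}.ncard := by
    rw [blocks_eq_ncard_image (fun x => x), image_id']
    intro p hp q _
    exact (cycles_of_apply_eq hp).trans eq_comm
  have h3 : blocks (cycles g) {x | g x ≠ x} = Multiset.card g.cycleType := by
    rw [blocks_eq_ncard_image (fun x => g.cycleOf x), Equiv.Perm.cycleType, Multiset.card_map,
      Finset.card_val, ← ncard_coe_finset]
    · congr 1
      ext c
      simp only [mem_image, mem_ofPred_eq, Finset.mem_coe]
      constructor
      · rintro ⟨x, hx, rfl⟩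
        exact Equiv.Perm.cycleOf_mem_cycleFactorsFinset_iff.2 (Equiv.Perm.mem_support.2 hx)
      · intro hc
        obtain ⟨h4, h5⟩ := Equiv.Perm.mem_cycleFactorsFinset_iff.1 hc
        obtain ⟨x, hx⟩ := h4.nonempty_support
        refine ⟨x, ?_, ?_⟩
        · rw [← h5 x hx]; exact Equiv.Perm.mem_support.1 hx
        · exact (Equiv.Perm.cycle_is_cycleOf hx hc).symm
    · intro p hp q _
      constructor
      · intro h; exact Equiv.Perm.SameCycle.cycleOf_eq h
      · intro h
        have h4 : p ∈ (g.cycleOf q).support := by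
          rw [← show g.cycleOf p = g.cycleOf q from h, Equiv.Perm.mem_support_cycleOf_iff]
          exact ⟨Equiv.Perm.SameCycle.refl _ _, Equiv.Perm.mem_support.2 hp⟩
        exact (Equiv.Perm.mem_support_cycleOf_iff.1 h4).1.symm
  have h4 : {x | g x = x}.ncard + g.support.card = Nat.card X := by
    rw [← ncard_coe_finset, ← ncard_add_ncard_compl {x | g x = x}]
    congr 2
    ext x; simp
  rw [Equiv.Perm.sign_of_cycleType, Equiv.Perm.sum_cycleType, h1, h2, h3, ← h4]
  have h5 : ({x | g x = x}.ncard + g.support.card + (g.cycleType.card + {x | g x = x}.ncard)) =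
      (g.support.card + g.cycleType.card) + 2 * {x | g x = x}.ncard := by ring
  rw [h5, pow_add _ _ (2 * _), pow_mul]
  simp

/-- Multiplicativity of the sign. This is the evenness of the Euler characteristic;
`exists_isAnnular` uses it to select one value from a range of three. -/
theorem even_blocks_cycles_mul (a b : Equiv.Perm X) :
    Even (blocks (cycles (a * b)) univ + blocks (cycles a) univ + blocks (cycles b) univ
      + Nat.card X) := by
  classical
  have := Fintype.ofFinite X
  have h := Equiv.Perm.sign_mul a b
  rw [sign_eq_neg_one_pow, sign_eq_neg_one_pow, sign_eq_neg_one_pow, ← pow_add] at h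
  by_contra hodd
  rw [Nat.not_even_iff_odd] at hodd
  rcases Nat.even_or_odd (Nat.card X + blocks (cycles (a * b)) univ) with he | he
  · have ho : Odd (Nat.card X + blocks (cycles a) univ + (Nat.card X + blocks (cycles b) univ)) := by
      obtain ⟨k, hk⟩ := he
      obtain ⟨l, hl⟩ := hodd
      exact ⟨l + Nat.card X - k, by omega⟩
    rw [he.neg_one_pow, ho.neg_one_pow] at h
    exact absurd h (by decide)
  · have ho : Even (Nat.card X + blocks (cycles a) univ + (Nat.card X + blocks (cycles b) univ)) := by
      obtain ⟨k, hk⟩ := he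
      obtain ⟨l, hl⟩ := hodd
      exact ⟨l + Nat.card X - k, by omega⟩
    rw [he.neg_one_pow, ho.neg_one_pow] at h
    exact absurd h (by decide)

omit [Finite X] in
theorem ncard_cyclesIn {V : Setoid X} {σ : Equiv.Perm X} (h : cycles σ ≤ V) (x : X) :
    cyclesIn V σ (Quotient.mk V x) = Quotient.mk (cycles σ) '' {p | V p x} := by
  ext c
  obtain ⟨p, rfl⟩ := Quotient.mk_surjective c
  constructor
  · intro hp
    exact ⟨p, mk_eq_mk.1 (hp p rfl), rfl⟩
  · rintro ⟨q, hq, hqp⟩ y hy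
    exact mk_eq_mk.2 (V.trans' (h (mk_eq_mk.1 (hy.trans hqp.symm))) hq)

end PermLemmas

/-! ### The three basic cycles and the non-crossing condition on discs -/

section Index

variable {m : Fin 3 → ℕ}

theorem exists_third {i j : Fin 3} (h : i ≠ j) :
    ∃ k, i ≠ k ∧ j ≠ k ∧ ∀ l, l = i ∨ l = j ∨ l = k := by
  revert i j; decide

theorem forall_fin_three {i j k : Fin 3} (hij : i ≠ j) (hik : i ≠ k) (hjk : j ≠ k) (l : Fin 3) :
    l = i ∨ l = j ∨ l = k := by
  revert i j k l; decide

theorem sector_union {i j k : Fin 3} (hij : i ≠ j) (hik : i ≠ k) (hjk : j ≠ k) :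
    sector m {i} ∪ sector m {j, k} = univ := by
  ext x
  simpa [mem_sector] using forall_fin_three hij hik hjk x.1

theorem sector_pair (j k : Fin 3) : sector m {j} ∪ sector m {k} = sector m {j, k} := rfl

theorem sum_blocks {W : Setoid (Point m)} (hW : ∀ p q, W p q → p.1 = q.1) {i j k : Fin 3}
    (hij : i ≠ j) (hik : i ≠ k) (hjk : j ≠ k) :
    blocks W univ = blocks W (sector m {i}) + blocks W (sector m {j}) + blocks W (sector m {k}) := by
  rw [← sector_union hij hik hjk, ← sector_pair, blocks_union_of_not_rel, blocks_union_of_not_rel,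
    add_assoc]
  · intro p hp q hq h
    exact hjk ((show p.1 = j from hp).symm.trans ((hW p q h).trans hq))
  · rintro p hp q (hq | hq) h
    · exact hij ((show p.1 = i from hp).symm.trans ((hW p q h).trans hq))
    · exact hik ((show p.1 = i from hp).symm.trans ((hW p q h).trans hq))

theorem sum_blocks_isolate {W : Setoid (Point m)} {i j k : Fin 3}
    (hij : i ≠ j) (hik : i ≠ k) (hjk : j ≠ k) (hW : ∀ p q, W p q → (p.1 = i ↔ q.1 = i)) :
    blocks W univ = blocks W (sector m {i}) + blocks W (sector m {j, k}) := by
  rw [← sector_union hij hik hjk, blocks_union_of_not_rel]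
  intro p hp q hq h
  have := (hW p q h).1 hp
  rcases hq with hq | hq
  · exact hij (this.symm.trans hq)
  · exact hik (this.symm.trans hq)

theorem blocks_cycles_gamma (hm : ∀ j, 0 < m j) : blocks (cycles (gamma m)) univ = 3 := by
  rw [blocks_eq_ncard_image (fun x : Point m => x.1) fun p _ q _ => cycles_gamma_apply]
  have : (fun x : Point m => x.1) '' univ = univ := by
    rw [eq_univ_iff_forall]
    exact fun j => ⟨⟨j, ⟨0, hm j⟩⟩, mem_univ _, rfl⟩
  rw [this, ncard_univ]; simp

theorem card_point (m : Fin 3 → ℕ) : Nat.card (Point m) = ∑ j, m j := by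
  simp [Point]

/-- If `V` never linked a basic cycle satisfying `P` to one that does not, both `V` and `cycles
(gamma m)` would refine the kernel of `P`, so their join would not be the top partition. -/
theorem exists_link {V : Setoid (Point m)} (hm : ∀ j, 0 < m j) (P : Fin 3 → Prop)
    (h : V ⊔ cycles (gamma m) = ⊤) (h1 : ∃ i, P i) (h2 : ∃ i, ¬ P i) :
    ∃ p q, V p q ∧ P p.1 ∧ ¬ P q.1 := by
  by_contra! hcon
  obtain ⟨i, hi⟩ := h1
  obtain ⟨j, hj⟩ := h2
  have h3 : V ⊔ cycles (gamma m) ≤ Setoid.ker fun x : Point m => P x.1 := by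
    apply sup_le
    · intro p q hpq
      exact propext ⟨hcon p q hpq, hcon q p (V.symm' hpq)⟩
    · intro p q hpq
      rw [Setoid.ker_def, cycles_gamma_apply.1 hpq]
  rw [h] at h3
  have h4 : P i = P j := h3 (x := ⟨i, ⟨0, hm i⟩⟩) (y := ⟨j, ⟨0, hm j⟩⟩) trivial
  exact hj (h4 ▸ hi)

theorem sup_gamma_eq_top {V : Setoid (Point m)} {x y y' z : Point m} (hxy : x.1 ≠ y.1)
    (hxz : z.1 ≠ x.1) (hyz : z.1 ≠ y.1) (hy' : y'.1 ≠ z.1) (h1 : V x y) (h2 : V y' z) :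
    V ⊔ cycles (gamma m) = ⊤ := by
  rw [eq_top_iff]
  set W := V ⊔ cycles (gamma m) with hW
  have hV : V ≤ W := le_sup_left
  have hg : ∀ p q : Point m, p.1 = q.1 → W p q := fun p q h =>
    (le_sup_right : cycles (gamma m) ≤ W) (cycles_gamma_apply.2 h)
  have hzx : W z x := by
    rcases forall_fin_three hxy hxz.symm hyz.symm y'.1 with h | h | h
    · exact W.trans' (W.symm' (hV h2)) (hg _ _ h)
    · exact W.trans' (W.symm' (hV h2)) (W.trans' (hg _ _ h) (W.symm' (hV h1)))
    · exact absurd h hy'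
  have hall : ∀ p, W p x := by
    intro p
    rcases forall_fin_three hxy hxz.symm hyz.symm p.1 with h | h | h
    · exact hg _ _ h
    · exact W.trans' (hg _ _ h) (W.symm' (hV h1))
    · exact W.trans' (hg _ _ h) hzx
  exact fun p q _ => W.trans' (hall p) (W.symm' (hall q))

theorem blocks_le_card {X : Type*} [Finite X] (W : Setoid X) : blocks W univ ≤ Nat.card X := by
  rw [blocks_univ]
  exact Nat.card_le_card_of_surjective _ Quotient.mk_surjective

theorem mem_NCDiscs_iff (hm : ∀ j, 0 < m j) {σ : Equiv.Perm (Point m)} :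
    σ ∈ NCDiscs m ↔
      blocks (cycles σ) univ + blocks (cycles (σ⁻¹ * gamma m)) univ = Nat.card (Point m) + 3 ∧
        ∀ x, (σ x).1 = x.1 := by
  have h1 := blocks_le_card (cycles σ)
  have h2 := blocks_le_card (cycles (σ⁻¹ * gamma m))
  have h3 := blocks_le_card (cycles (gamma m))
  have h4 := blocks_cycles_gamma hm
  rw [NCDiscs]
  simp only [permLength, partitionLength, ← blocks_univ, mem_ofPred_eq]
  refine and_congr (by omega) ?_
  rw [cycles_le_iff]
  simp only [cycles_gamma_apply]
  exact forall_congr' fun x => eq_comm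

theorem cycles_fst_eq {σ : Equiv.Perm (Point m)} (h : ∀ x, (σ x).1 = x.1) {p q : Point m}
    (hpq : cycles σ p q) : p.1 = q.1 :=
  (cycles_le_iff (W := Setoid.ker fun x : Point m => x.1)).2 (fun p => (h p).symm) hpq

theorem IsMatching.inv_eq {X : Type*} {σ : Equiv.Perm X} (h : IsMatching σ) : σ⁻¹ = σ := by
  ext x
  rw [Equiv.Perm.inv_eq_iff_eq, (h x).2]

/-- For a pairing, `σ⁻¹ = σ` and twice the number of cycles is the number of points, so the geodesic
condition becomes a relation between two block counts. -/
theorem matching_mem_NCDiscs_iff (hm : ∀ j, 0 < m j) {σ : Equiv.Perm (Point m)}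
    (hσ : IsMatching σ) :
    σ ∈ NCDiscs m ↔ blocks (cycles (gamma m * σ)) univ = blocks (cycles σ) univ + 3 ∧
      ∀ x, (σ x).1 = x.1 := by
  have := hσ.two_mul_blocks
  rw [mem_NCDiscs_iff hm, hσ.inv_eq, blocks_cycles_mul_comm σ]
  refine and_congr_left fun _ => ?_
  omega

end Index
end LimitGraphs

namespace LimitGraphs
open Set

/-! ### Blocks of a glued partition -/

section GlueClasses

variable {X : Type*} {W : Setoid X} {a b p q : X}

theorem rel_of_glue (h : glue W a b p q) (hq : ¬ glue W a b q a) : W p q := by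
  rcases h with h | ⟨-, h⟩ | ⟨-, h⟩
  · exact h
  · exact absurd ((glue W a b).trans' (le_glue _ _ _ h) ((glue W a b).symm' (glue_self _ _ _))) hq
  · exact absurd (le_glue _ _ _ h) hq

theorem glue_left_iff : glue W a b p a ↔ W p a ∨ W p b := by
  constructor
  · rintro (h | ⟨h, -⟩ | ⟨h, -⟩)
    · exact Or.inl h
    · exact Or.inl h
    · exact Or.inr h
  · rintro (h | h)
    · exact le_glue _ _ _ h
    · exact (glue W a b).trans' (le_glue _ _ _ h) ((glue W a b).symm' (glue_self _ _ _))

theorem glue_right_iff : glue W a b p b ↔ W p a ∨ W p b := by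
  rw [glue_comm, glue_left_iff, or_comm]

theorem image_class_of_glue (hp : ¬ glue W a b p a) :
    {q | glue W a b q p} = {q | W q p} := by
  ext q
  exact ⟨fun h => rel_of_glue h hp, fun h => le_glue _ _ _ h⟩

theorem image_mk_class (W : Setoid X) (p : X) : Quotient.mk W '' {q | W q p} = {Quotient.mk W p} := by
  ext c
  constructor
  · rintro ⟨q, hq, rfl⟩; exact mk_eq_mk.2 hq
  · rintro rfl; exact ⟨p, W.refl' p, rfl⟩

end GlueClasses

/-! ### Partitioned permutations on three discs: two successive gluings -/

section TreeForms

variable {m : Fin 3 → ℕ} {V : Setoid (Point m)} {σ : Equiv.Perm (Point m)} {x y y' z : Point m}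

/-- `V` is obtained from the cycles of `σ` by joining the first two of the three basic cycles, and
then the third one to these. -/
def TreeForm (V : Setoid (Point m)) (σ : Equiv.Perm (Point m)) (x y y' z : Point m) : Prop :=
  x.1 ≠ y.1 ∧ z.1 ≠ x.1 ∧ z.1 ≠ y.1 ∧ y'.1 ≠ z.1 ∧ V = glue (glue (cycles σ) x y) y' z

theorem TreeForm.not_glue (h : TreeForm V σ x y y' z) (hσ : ∀ x, (σ x).1 = x.1) :
    ¬ glue (cycles σ) x y y' z := by
  obtain ⟨h1, h2, h3, h4, -⟩ := h
  rintro (h | ⟨-, h⟩ | ⟨-, h⟩)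
  · exact h4 (cycles_fst_eq hσ h)
  · exact h3 (cycles_fst_eq hσ h)
  · exact h2 (cycles_fst_eq hσ h)

theorem TreeForm.blocks_add_two (h : TreeForm V σ x y y' z) (hσ : ∀ x, (σ x).1 = x.1) :
    blocks V univ + 2 = blocks (cycles σ) univ := by
  have h1 := blocks_glue_univ (fun h' => h.1 (cycles_fst_eq hσ h') : ¬ cycles σ x y)
  have h2 := blocks_glue_univ (h.not_glue hσ)
  rw [h.2.2.2.2]
  omega

theorem TreeForm.cycles_le (h : TreeForm V σ x y y' z) : cycles σ ≤ V := by
  rw [h.2.2.2.2]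
  exact (le_glue _ _ _).trans (le_glue _ _ _)

theorem TreeForm.rel (h : TreeForm V σ x y y' z) : V x y ∧ V y' z := by
  rw [h.2.2.2.2]
  exact ⟨le_glue _ _ _ (glue_self _ _ _), glue_self _ _ _⟩

/-- Since `V` and `γ` generate the top partition, `V` links two of the basic cycles, and the third
one to one of these. The two gluings already lose two blocks, which by the count is everything. -/
theorem exists_treeForm (hm : ∀ j, 0 < m j) (hσ : ∀ x, (σ x).1 = x.1) (hle : cycles σ ≤ V)
    (hb : blocks V univ + 2 = blocks (cycles σ) univ) (htop : V ⊔ cycles (gamma m) = ⊤) :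
    ∃ x y y' z, TreeForm V σ x y y' z := by
  obtain ⟨x, y, hxy, h1, h2⟩ := exists_link hm (fun i => i = 0) htop ⟨0, rfl⟩ ⟨1, by decide⟩
  have hne : x.1 ≠ y.1 := fun h => h2 (h ▸ h1)
  obtain ⟨k, hik, hjk, hk⟩ := exists_third hne
  obtain ⟨z, y', hzy, h3, h4⟩ := exists_link hm (fun i => i = k) htop ⟨k, rfl⟩ ⟨x.1, hik⟩
  subst h3
  have hT : TreeForm (glue (glue (cycles σ) x y) y' z) σ x y y' z :=
    ⟨hne, hik.symm, hjk.symm, h4, rfl⟩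
  have hle' : glue (glue (cycles σ) x y) y' z ≤ V := glue_le (glue_le hle hxy) (V.symm' hzy)
  have hb' := hT.blocks_add_two hσ
  exact ⟨x, y, y', z, hne, hik.symm, hjk.symm, h4, (eq_of_blocks_le hle' (by omega)).symm⟩

/-- The number of cycles in the blocks of `V`, when the two joined edges coincide. -/
theorem TreeForm.ncard_of_rel (h : TreeForm V σ x y y' z) (hσ : ∀ x, (σ x).1 = x.1)
    (hV : V x y') : V = glue (glue (cycles σ) x y) x z ∧
      cyclesIn V σ (Quotient.mk V x) =
        {Quotient.mk (cycles σ) x, Quotient.mk (cycles σ) y, Quotient.mk (cycles σ) z} ∧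
      (cyclesIn V σ (Quotient.mk V x)).ncard = 3 ∧
      ∀ b, b ≠ Quotient.mk V x → (cyclesIn V σ b).ncard = 1 := by
  have hle := h.cycles_le
  have hng := h.not_glue hσ
  obtain ⟨h1, h2, h3, h4, h5⟩ := h
  have hxz : ¬ glue (cycles σ) x y x z := by
    rintro (h | ⟨-, h⟩ | ⟨-, h⟩)
    · exact h2 (cycles_fst_eq hσ h).symm
    · exact h3 (cycles_fst_eq hσ h)
    · exact h2 (cycles_fst_eq hσ h)
  have h6 : glue (cycles σ) x y y' x := by
    rw [h5, glue_left_iff] at hV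
    exact (glue _ _ _).symm' (hV.resolve_right hxz)
  have hV' : V = glue (glue (cycles σ) x y) x z := by
    rw [h5]; exact glue_congr h6 ((glue _ _ _).refl' z)
  have hcl : ∀ p, V p x ↔ cycles σ p x ∨ cycles σ p y ∨ cycles σ p z := by
    intro p
    rw [hV', glue_left_iff, glue_left_iff, or_assoc]
    have h7 : glue (cycles σ) x y p z ↔ cycles σ p z := by
      refine ⟨fun h => rel_of_glue h fun h => hxz ((glue _ _ _).symm' h), fun h => le_glue _ _ _ h⟩
    rw [h7]
  have himg : cyclesIn V σ (Quotient.mk V x) =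
      {Quotient.mk (cycles σ) x, Quotient.mk (cycles σ) y, Quotient.mk (cycles σ) z} := by
    rw [ncard_cyclesIn hle]
    ext c
    obtain ⟨p, rfl⟩ := Quotient.mk_surjective c
    simp only [mem_insert_iff, mem_singleton_iff, mk_eq_mk, ← hcl]
    constructor
    · rintro ⟨q, hq, hqp⟩; exact V.trans' (V.symm' (hle (mk_eq_mk.1 hqp))) hq
    · intro hp; exact ⟨p, hp, rfl⟩
  refine ⟨hV', himg, ?_, ?_⟩
  · rw [himg, ncard_eq_three]
    refine ⟨_, _, _, ?_, ?_, ?_, rfl⟩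
    · exact fun h => h1 (cycles_fst_eq hσ (mk_eq_mk.1 h))
    · exact fun h => h2 (cycles_fst_eq hσ (mk_eq_mk.1 h)).symm
    · exact fun h => h3 (cycles_fst_eq hσ (mk_eq_mk.1 h)).symm
  · intro b hb
    obtain ⟨w, rfl⟩ := Quotient.mk_surjective b
    have hw : ¬ V w x := fun h => hb (mk_eq_mk.2 h)
    have h8 : {p | V p w} = {p | cycles σ p w} := by
      rw [hV'] at hw ⊢
      rw [image_class_of_glue hw, image_class_of_glue fun h => hw (le_glue _ _ _ h)]
    rw [ncard_cyclesIn hle, h8, image_mk_class, ncard_singleton]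

/-- The number of cycles in the blocks of `V`, when the two joined edges are distinct. -/
theorem TreeForm.ncard_of_not_rel (h : TreeForm V σ x y y' z) (hσ : ∀ x, (σ x).1 = x.1)
    (hV : ¬ V x y') : (cyclesIn V σ (Quotient.mk V x)).ncard = 2 ∧
      (cyclesIn V σ (Quotient.mk V z)).ncard = 2 ∧ Quotient.mk V x ≠ Quotient.mk V z ∧
      ∀ b, b ≠ Quotient.mk V x → b ≠ Quotient.mk V z → (cyclesIn V σ b).ncard = 1 := by
  have hle := h.cycles_le
  have hrel := h.rel
  obtain ⟨h1, h2, h3, h4, h5⟩ := h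
  have hxz : ¬ V x z := fun h => hV (V.trans' h (V.symm' hrel.2))
  have hpair : ∀ a b w, a.1 ≠ b.1 → (∀ p, V p w ↔ cycles σ p a ∨ cycles σ p b) →
      (cyclesIn V σ (Quotient.mk V w)).ncard = 2 := by
    intro a b w hab hcl
    have himg : cyclesIn V σ (Quotient.mk V w) =
        {Quotient.mk (cycles σ) a, Quotient.mk (cycles σ) b} := by
      rw [ncard_cyclesIn hle]
      ext c
      obtain ⟨p, rfl⟩ := Quotient.mk_surjective c
      simp only [mem_insert_iff, mem_singleton_iff, mk_eq_mk, ← hcl]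
      constructor
      · rintro ⟨q, hq, hqp⟩; exact V.trans' (V.symm' (hle (mk_eq_mk.1 hqp))) hq
      · intro hp; exact ⟨p, hp, rfl⟩
    rw [himg, ncard_pair]
    exact fun h => hab (cycles_fst_eq hσ (mk_eq_mk.1 h))
  refine ⟨hpair x y x h1 fun p => ?_, hpair y' z z h4 fun p => ?_,
    fun h => hxz (mk_eq_mk.1 h), ?_⟩
  · rw [← glue_left_iff (W := cycles σ)]
    refine ⟨fun h => ?_, fun h => h5 ▸ le_glue _ _ _ h⟩
    rw [h5] at h hV
    exact rel_of_glue h hV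
  · have h6 : ¬ glue (cycles σ) x y y' x := fun h =>
      hV (V.symm' (h5 ▸ le_glue _ _ _ h))
    have h7 : ¬ glue (cycles σ) x y z x := fun h =>
      hxz (V.symm' (h5 ▸ le_glue _ _ _ h))
    rw [h5, glue_right_iff]
    refine or_congr ⟨fun h => rel_of_glue h h6, fun h => le_glue _ _ _ h⟩
      ⟨fun h => rel_of_glue h h7, fun h => le_glue _ _ _ h⟩
  · intro b hb hb'
    obtain ⟨w, rfl⟩ := Quotient.mk_surjective b
    have hw : ¬ V w x := fun h => hb (mk_eq_mk.2 h)
    have hw' : ¬ V w y' := fun h => hb' (mk_eq_mk.2 (V.trans' h hrel.2))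
    have h8 : {p | V p w} = {p | cycles σ p w} := by
      rw [h5] at hw hw' ⊢
      rw [image_class_of_glue hw', image_class_of_glue fun h => hw (le_glue _ _ _ h)]
    rw [ncard_cyclesIn hle, h8, image_mk_class, ncard_singleton]

theorem TreeForm.ncard_three_iff (h : TreeForm V σ x y y' z) (hσ : ∀ x, (σ x).1 = x.1) :
    {b | (cyclesIn V σ b).ncard = 3}.ncard = 1 ↔ V x y' := by
  by_cases hV : V x y'
  · obtain ⟨-, -, h2, h3⟩ := h.ncard_of_rel hσ hV
    have : {b | (cyclesIn V σ b).ncard = 3} = {Quotient.mk V x} := by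
      ext b
      refine ⟨fun hb => ?_, fun hb => ?_⟩
      · by_contra hne
        have h4 : (cyclesIn V σ b).ncard = 3 := hb
        rw [h3 b hne] at h4; omega
      · rw [mem_singleton_iff.1 hb]; exact h2
    simp [this, hV]
  · obtain ⟨h1, h2, -, h3⟩ := h.ncard_of_not_rel hσ hV
    have : {b | (cyclesIn V σ b).ncard = 3} = ∅ := by
      rw [eq_empty_iff_forall_notMem]
      intro b hb
      have h4 : (cyclesIn V σ b).ncard = 3 := hb
      by_cases hx : b = Quotient.mk V x
      · rw [hx, h1] at h4; omega
      · by_cases hz : b = Quotient.mk V z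
        · rw [hz, h2] at h4; omega
        · rw [h3 b hx hz] at h4; omega
    simp [this, hV]

theorem TreeForm.ncard_two_iff (h : TreeForm V σ x y y' z) (hσ : ∀ x, (σ x).1 = x.1) :
    {b | (cyclesIn V σ b).ncard = 2}.ncard = 2 ↔ ¬ V x y' := by
  by_cases hV : V x y'
  · obtain ⟨-, -, h2, h3⟩ := h.ncard_of_rel hσ hV
    have : {b | (cyclesIn V σ b).ncard = 2} = ∅ := by
      rw [eq_empty_iff_forall_notMem]
      intro b hb
      have h4 : (cyclesIn V σ b).ncard = 2 := hb
      by_cases hx : b = Quotient.mk V x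
      · rw [hx, h2] at h4; omega
      · rw [h3 b hx] at h4; omega
    simp [this, hV]
  · obtain ⟨h1, h2, hne, h3⟩ := h.ncard_of_not_rel hσ hV
    have : {b | (cyclesIn V σ b).ncard = 2} = {Quotient.mk V x, Quotient.mk V z} := by
      ext b
      refine ⟨fun hb => ?_, ?_⟩
      · have h4 : (cyclesIn V σ b).ncard = 2 := hb
        by_contra hcon
        simp only [mem_insert_iff, mem_singleton_iff, not_or] at hcon
        rw [h3 b hcon.1 hcon.2] at h4; omega
      · rintro (rfl | rfl)
        · exact h1
        · exact h2
    simp [this, hV, ncard_pair hne]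

theorem partitionLength_eq_iff (V : Setoid (Point m)) (σ : Equiv.Perm (Point m)) (n : ℕ)
    (hle : cycles σ ≤ V) :
    partitionLength V = permLength σ + n ↔ blocks V univ + n = blocks (cycles σ) univ := by
  have h1 := blocks_le_card (cycles σ)
  have h2 := blocks_anti hle univ
  rw [permLength, partitionLength, partitionLength, ← blocks_univ, ← blocks_univ]
  omega

/-- The number of cycles in a block is governed by whether the two gluings take place in the same
block of `V`: if they do, one block has three cycles, and otherwise two blocks have two each. -/
theorem mem_PS111_iff (hm : ∀ j, 0 < m j) :
    (V, σ) ∈ PS111 m ↔ σ ∈ NCDiscs m ∧ ∃ x y y' z, TreeForm V σ x y y' z ∧ V x y' := by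
  constructor
  · rintro ⟨h1, h2, h3, h4, h5⟩
    have hσ := ((mem_NCDiscs_iff hm).1 h2).2
    have h6 := (partitionLength_eq_iff V σ 2 h1).1 h3
    obtain ⟨x, y, y', z, h⟩ := exists_treeForm hm hσ h1 h6 h4
    exact ⟨h2, x, y, y', z, h, (h.ncard_three_iff hσ).1 h5⟩
  · rintro ⟨h1, x, y, y', z, h, h2⟩
    have hσ := ((mem_NCDiscs_iff hm).1 h1).2
    exact ⟨h.cycles_le, h1, (partitionLength_eq_iff V σ 2 h.cycles_le).2 (h.blocks_add_two hσ),
      sup_gamma_eq_top h.1 h.2.1 h.2.2.1 h.2.2.2.1 h.rel.1 h.rel.2, (h.ncard_three_iff hσ).2 h2⟩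

theorem mem_PS211_iff (hm : ∀ j, 0 < m j) :
    (V, σ) ∈ PS211 m ↔ σ ∈ NCDiscs m ∧ ∃ x y y' z, TreeForm V σ x y y' z ∧ ¬ V x y' := by
  constructor
  · rintro ⟨h1, h2, h3, h4, h5⟩
    have hσ := ((mem_NCDiscs_iff hm).1 h2).2
    have h6 := (partitionLength_eq_iff V σ 2 h1).1 h3
    obtain ⟨x, y, y', z, h⟩ := exists_treeForm hm hσ h1 h6 h4
    exact ⟨h2, x, y, y', z, h, (h.ncard_two_iff hσ).1 h5⟩
  · rintro ⟨h1, x, y, y', z, h, h2⟩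
    have hσ := ((mem_NCDiscs_iff hm).1 h1).2
    exact ⟨h.cycles_le, h1, (partitionLength_eq_iff V σ 2 h.cycles_le).2 (h.blocks_add_two hσ),
      sup_gamma_eq_top h.1 h.2.1 h.2.2.1 h.2.2.2.1 h.rel.1 h.rel.2, (h.ncard_two_iff hσ).2 h2⟩

/-- In a block of `V` there is at most one cycle of `σ` on every basic cycle. -/
theorem TreeForm.cycles_of_fst_eq (h : TreeForm V σ x y y' z) (hσ : ∀ x, (σ x).1 = x.1)
    {p q : Point m} (hpq : V p q) (hf : p.1 = q.1) : cycles σ p q := by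
  obtain ⟨h1, h2, h3, h4, rfl⟩ := h
  have key : ∀ p q : Point m, glue (cycles σ) x y p q → p.1 = q.1 → cycles σ p q := by
    rintro p q (h | ⟨h, h'⟩ | ⟨h, h'⟩) hf
    · exact h
    · exact absurd ((cycles_fst_eq hσ h).symm.trans (hf.trans (cycles_fst_eq hσ h'))) h1
    · exact absurd ((cycles_fst_eq hσ h').symm.trans (hf.symm.trans (cycles_fst_eq hσ h))) h1
  have key2 : ∀ p q : Point m, glue (cycles σ) x y p q → q.1 = z.1 → p.1 = z.1 := by
    rintro p q (h | ⟨h, h'⟩ | ⟨h, h'⟩) hf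
    · exact (cycles_fst_eq hσ h).trans hf
    · exact absurd (hf.symm.trans (cycles_fst_eq hσ h')) h3
    · exact absurd (hf.symm.trans (cycles_fst_eq hσ h')) h2
  rcases hpq with h | ⟨h, h'⟩ | ⟨h, h'⟩
  · exact key p q h hf
  · have h5 := key2 q z h' rfl
    exact absurd (key2 y' p ((glue _ _ _).symm' h) (hf.trans h5)) h4
  · have h5 := key2 p z h rfl
    exact absurd (key2 y' q ((glue _ _ _).symm' h') (hf.symm.trans h5)) h4

end TreeForms
end LimitGraphs

namespace LimitGraphs
open Set

/-! ### Tools for merged partitions, opposite pairings and shared edges -/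

section MergedGlue

variable {X : Type*} [Finite X] {γ σ : Equiv.Perm X} {f : X → Bool}

/-- The partition of the edges according to their end points in the quotient by `M`, where the
edges are oriented by `f`. -/
theorem exists_orientedEnds (hf : f ∈ orientations σ) (hσ : IsMatching σ) {M : Setoid X}
    (hM : cycles (γ * σ) ≤ M) :
    ∃ K : Setoid X, cycles σ ≤ K ∧ ∀ p q, f p = f q → (K p q ↔ M p q ∧ M (γ p) (γ q)) := by
  refine ⟨Setoid.ker fun p => if f p then (Quotient.mk M p, Quotient.mk M (γ p))
    else (Quotient.mk M (γ p), Quotient.mk M p), cycles_le_iff.2 fun p => ?_, fun p q hpq => ?_⟩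
  · have h1 := rel_of_cycles_le hM p
    have h2 := rel_of_cycles_le hM (σ p)
    rw [(hσ p).2] at h2
    rw [Setoid.ker_def, hf p]
    cases f p
    · simpa [mk_eq_mk] using ⟨M.symm' h2, h1⟩
    · simpa [mk_eq_mk] using ⟨h1, M.symm' h2⟩
  · rw [Setoid.ker_def, hpq]
    cases f q
    · simp [mk_eq_mk, and_comm]
    · simp [mk_eq_mk]

/-- Having the same oriented end points modulo `M` is an equivalence relation containing the pairs
of `σ`. It therefore suffices to check the identifications that generate `V`. -/
theorem merged_glue_le (hf : f ∈ orientations σ) (hσ : IsMatching σ) {M V : Setoid X}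
    (hM : cycles (γ * σ) ≤ M)
    (hV : ∀ K : Setoid X, cycles σ ≤ K →
      (∀ p q, f p = f q → M p q → M (γ p) (γ q) → K p q) → V ≤ K) : merged γ V σ f ≤ M := by
  obtain ⟨K, hK, hK'⟩ := exists_orientedEnds hf hσ hM
  have := hV K hK fun p q hpq h1 h2 => (hK' p q hpq).2 ⟨h1, h2⟩
  exact merged_le hM fun p q hpq hfpq => (hK' p q hfpq).1 (this hpq)

/-- A matching of opposite edges respecting a function `c`. -/
theorem exists_matching {ι : Type*} (c : X → ι) {π : Setoid X}
    (h : ∀ x, ∃ y, c y = c x ∧ y ≠ x ∧ π x (γ y) ∧ π y (γ x) ∧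
      ∀ z, c z = c x → edgeSetoid γ π z x → z = x ∨ z = y) :
    ∃ σ : Equiv.Perm X, IsMatching σ ∧ (∀ x, c (σ x) = c x) ∧ cycles (γ * σ) ≤ π ∧
      ∀ x z, c z = c x → edgeSetoid γ π z x → z = x ∨ z = σ x := by
  choose s hs1 hs2 hs3 hs4 hs5 using h
  have hinv : Function.Involutive s := by
    intro x
    have hE : edgeSetoid γ π x (s x) := edgeSetoid_apply.2 (Or.inr ⟨hs3 x, hs4 x⟩)
    rcases hs5 (s x) x (hs1 x).symm hE with h | h
    · exact absurd h.symm (hs2 x)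
    · exact h.symm
  exact ⟨hinv.toPerm, fun x => ⟨hs2 x, hinv x⟩, hs1, cycles_le_iff.2 hs3, hs5⟩

theorem cycles_le_edgeSetoid (hσ : IsMatching σ) {π : Setoid X} (h : cycles (γ * σ) ≤ π) :
    cycles σ ≤ edgeSetoid γ π := by
  refine cycles_le_iff.2 fun p => edgeSetoid_apply.2 (Or.inr ⟨rel_of_cycles_le h p, ?_⟩)
  have := rel_of_cycles_le h (σ p)
  rwa [(hσ p).2] at this

/-- The cycles of `σ` refine the edge classes. When there are no fewer classes than cycles on `S`,
each class is a single pair of opposite edges. -/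
theorem isDoubledOn_of_blocks (hσ : IsMatching σ) {π : Setoid X} (h : cycles (γ * σ) ≤ π)
    {S : Set X} (hS : ∀ x ∈ S, σ x ∈ S) (hb : blocks (cycles σ) S ≤ blocks (edgeSetoid γ π) S) :
    IsDoubledOn γ π S := by
  intro x hx
  have h2 := rel_of_cycles_le h (σ x)
  rw [(hσ x).2] at h2
  refine ⟨σ x, hS x hx, (hσ x).1, rel_of_cycles_le h x, h2, fun z hz hzx => ?_⟩
  exact hσ.cycles_apply.1 ((cycles σ).symm'
    (rel_of_blocks_le (cycles_le_edgeSetoid hσ h) hb hz hx hzx))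

omit [Finite X] in
theorem mem_image_mk_of_edge {π : Setoid X} {S : Set X} (hS : ∀ z ∈ S, γ z ∈ S) {x y : X}
    (hy : y ∈ S) (h : edgeSetoid γ π x y) :
    Quotient.mk π x ∈ Quotient.mk π '' S ∧ Quotient.mk π (γ x) ∈ Quotient.mk π '' S := by
  rcases edgeSetoid_apply.1 h with ⟨h1, h2⟩ | ⟨h1, h2⟩
  · exact ⟨⟨y, hy, mk_eq_mk.2 (π.symm' h1)⟩, ⟨γ y, hS y hy, mk_eq_mk.2 (π.symm' h2)⟩⟩
  · exact ⟨⟨γ y, hS y hy, mk_eq_mk.2 (π.symm' h1)⟩, ⟨y, hy, mk_eq_mk.2 h2⟩⟩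

omit [Finite X] in
theorem pair_subset_of_edge {π : Setoid X} {S T : Set X} (hS : ∀ z ∈ S, γ z ∈ S)
    (hT : ∀ z ∈ T, γ z ∈ T) {x y : X} (hx : x ∈ S) (hy : y ∈ T) (h : edgeSetoid γ π x y) :
    {Quotient.mk π x, Quotient.mk π (γ x)} ⊆ Quotient.mk π '' S ∩ Quotient.mk π '' T := by
  obtain ⟨h1, h2⟩ := mem_image_mk_of_edge hT hy h
  rintro _ (rfl | rfl)
  · exact ⟨⟨x, hx, rfl⟩, h1⟩
  · exact ⟨⟨γ x, hS x hx, rfl⟩, h2⟩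

/-- Two graphs joined along an edge share only this edge. -/
theorem ncard_common_edges {π : Setoid X} {S T : Set X} (hS : ∀ z ∈ S, γ z ∈ S)
    (hT : ∀ z ∈ T, γ z ∈ T) {x : X} (hl : ∀ z ∈ T, ¬ π z (γ z))
    (h : Quotient.mk π '' S ∩ Quotient.mk π '' T = {Quotient.mk π x, Quotient.mk π (γ x)}) :
    (Quotient.mk (edgeSetoid γ π) '' S ∩ Quotient.mk (edgeSetoid γ π) '' T).ncard ≤ 1 := by
  have h1 : Quotient.mk (edgeSetoid γ π) '' S ∩ Quotient.mk (edgeSetoid γ π) '' T ⊆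
      {Quotient.mk (edgeSetoid γ π) x} := by
    rintro _ ⟨⟨p, hp, rfl⟩, q, hq, hqp⟩
    have hE : edgeSetoid γ π q p := mk_eq_mk.1 hqp
    have h2 := pair_subset_of_edge hT hS hq hp hE
    rw [inter_comm, h] at h2
    have h3 := h2 (mem_insert _ _)
    have h4 := h2 (mem_insert_of_mem _ rfl)
    simp only [mem_insert_iff, mem_singleton_iff, mk_eq_mk] at h3 h4
    refine mk_eq_mk.2 ((edgeSetoid γ π).trans' ((edgeSetoid γ π).symm' hE) ?_)
    rw [edgeSetoid_apply]
    rcases h3 with h3 | h3 <;> rcases h4 with h4 | h4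
    · exact absurd (π.trans' h3 (π.symm' h4)) (hl q hq)
    · exact Or.inl ⟨h3, h4⟩
    · exact Or.inr ⟨h3, π.symm' h4⟩
    · exact absurd (π.trans' h3 (π.symm' h4)) (hl q hq)
  exact (ncard_le_ncard h1 (toFinite _)).trans (ncard_singleton _).le

theorem ncard_eq_mul {A B : Type*} [Finite A] [Finite B] {S : Set A} {T : Set B} {R : B → Set A}
    {c : ℕ} (h : ∀ a, a ∈ S ↔ ∃ b ∈ T, a ∈ R b)
    (hinj : ∀ b ∈ T, ∀ b' ∈ T, ∀ a ∈ R b, a ∈ R b' → b = b') (hc : ∀ b ∈ T, (R b).ncard = c) :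
    S.ncard = c * T.ncard := by
  classical
  have := Fintype.ofFinite A
  have := Fintype.ofFinite B
  have h1 : S.toFinset = T.toFinset.biUnion fun b => (R b).toFinset := by
    ext a; simp [h]
  rw [ncard_eq_toFinset_card', ncard_eq_toFinset_card' T, h1, Finset.card_biUnion,
    Finset.sum_const_nat (m := c), mul_comm]
  · intro b hb
    rw [← ncard_eq_toFinset_card']
    exact hc b (by simpa using hb)
  · intro b hb b' hb' hne
    rw [Function.onFun, Finset.disjoint_left]
    intro a ha ha'
    exact hne (hinj b (by simpa using hb) b' (by simpa using hb') a (by simpa using ha)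
      (by simpa using ha'))

end MergedGlue

/-! ### The 2-6-tree and 2-4-4-tree types -/

section Trees

variable {m : Fin 3 → ℕ} {V : Setoid (Point m)} {σ : Equiv.Perm (Point m)} {x y y' z : Point m}
  {f : Point m → Bool} {π : Setoid (Point m)}

/-- Replacing a gluing point by its partner under `σ` flips its orientation and does not change the
glued partition. -/
theorem TreeForm.exists_oriented (h : TreeForm V σ x y y' z) (hσ : ∀ x, (σ x).1 = x.1)
    (hf : f ∈ orientations σ) :
    ∃ y₁ z₁, TreeForm V σ x y₁ y' z₁ ∧ f x = f y₁ ∧ f y' = f z₁ := by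
  have aux : ∀ p q : Point m, ∃ q₁, cycles σ q q₁ ∧ q₁.1 = q.1 ∧ f p = f q₁ := by
    intro p q
    by_cases hpq : f p = f q
    · exact ⟨q, (cycles σ).refl' q, rfl, hpq⟩
    · refine ⟨σ q, cycles_self_apply σ q, hσ q, ?_⟩
      rw [hf q]; revert hpq; cases f p <;> cases f q <;> simp
  obtain ⟨h1, h2, h3, h4, h5⟩ := h
  obtain ⟨y₁, hy, hy1, hfy⟩ := aux x y
  obtain ⟨z₁, hz, hz1, hfz⟩ := aux y' z
  refine ⟨y₁, z₁, ⟨by rwa [hy1], by rwa [hz1], by rwa [hz1, hy1], by rwa [hz1], ?_⟩, hfy, hfz⟩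
  rw [h5, glue_congr ((cycles σ).refl' x) hy]
  exact glue_congr ((glue _ _ _).refl' _) (le_glue _ _ _ hz)

/-- The partition `cycles (γ * σ)` has `#σ + 3 = #V + 5` blocks. Two identifications of edges, with
two pairs of end points each, lose at most four. -/
theorem TreeForm.blocks_merged (h : TreeForm V σ x y y' z) (hσ : ∀ x, (σ x).1 = x.1)
    (hM : IsMatching σ) (hf : f ∈ orientations σ)
    (hb : blocks (cycles (gamma m * σ)) univ = blocks (cycles σ) univ + 3) :
    blocks V univ + 1 ≤ blocks (merged (gamma m) V σ f) univ := by
  obtain ⟨y₁, z₁, h1, hfy, hfz⟩ := h.exists_oriented hσ hf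
  have h2 := h1.blocks_add_two hσ
  set M₁ := glue (cycles (gamma m * σ)) x y₁
  set M₂ := glue M₁ (gamma m x) (gamma m y₁)
  set M₃ := glue M₂ y' z₁
  set M₄ := glue M₃ (gamma m y') (gamma m z₁)
  have b1 : _ ≤ blocks M₁ univ + 1 := blocks_le_blocks_glue _ _ _ univ
  have b2 : _ ≤ blocks M₂ univ + 1 := blocks_le_blocks_glue _ _ _ univ
  have b3 : _ ≤ blocks M₃ univ + 1 := blocks_le_blocks_glue _ _ _ univ
  have b4 : _ ≤ blocks M₄ univ + 1 := blocks_le_blocks_glue _ _ _ univ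
  have l1 : cycles (gamma m * σ) ≤ M₁ := le_glue _ _ _
  have l2 : M₁ ≤ M₂ := le_glue _ _ _
  have l3 : M₂ ≤ M₃ := le_glue _ _ _
  have l4 : M₃ ≤ M₄ := le_glue _ _ _
  have hle : merged (gamma m) V σ f ≤ M₄ := by
    refine merged_glue_le hf hM (l1.trans (l2.trans (l3.trans l4))) fun K hK hK' => ?_
    rw [h1.2.2.2.2]
    refine glue_le (glue_le hK (hK' _ _ hfy ?_ ?_)) (hK' _ _ hfz ?_ ?_)
    · exact l4 (l3 (l2 (glue_self _ _ _)))
    · exact l4 (l3 (glue_self _ _ _))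
    · exact l4 (glue_self _ _ _)
    · exact glue_self _ _ _
  have := blocks_anti hle univ
  omega

/-- The counts of vertices and edges force a tree made of three double trees. -/
theorem TreeForm.tree_structure (hm : ∀ j, 0 < m j) (h : TreeForm V σ x y y' z)
    (hσ : ∀ x, (σ x).1 = x.1) (hM : IsMatching σ) (hU : cycles (gamma m * σ) ≤ π)
    (hV : V ≤ edgeSetoid (gamma m) π) (hb : blocks V univ + 1 ≤ blocks π univ) :
    blocks π univ = blocks V univ + 1 ∧ edgeSetoid (gamma m) π = V ∧
      (∀ p, ¬ π p (gamma m p)) ∧ AllDoubleTrees π ∧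
      Quotient.mk π '' sector m {x.1} ∩ Quotient.mk π '' sector m {y.1} =
        {Quotient.mk π x, Quotient.mk π (gamma m x)} ∧
      Quotient.mk π '' sector m {x.1, y.1} ∩ Quotient.mk π '' sector m {z.1} =
        {Quotient.mk π z, Quotient.mk π (gamma m z)} := by
  set E := edgeSetoid (gamma m) π with hE
  have hrel := h.rel
  have hcount := h.blocks_add_two hσ
  have hconn : Connects (gamma m) π univ := by
    intro W h1 h2
    have h3 : V ⊔ cycles (gamma m) ≤ W := by
      refine sup_le (fun p q hpq => ?_) (cycles_le_iff.2 fun p => h2 p trivial)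
      rcases edgeSetoid_apply.1 (hV hpq) with ⟨h4, -⟩ | ⟨h4, -⟩
      · exact h1 h4
      · exact W.trans' (h1 h4) (W.symm' (h2 q trivial))
    rw [sup_gamma_eq_top h.1 h.2.1 h.2.2.1 h.2.2.2.1 hrel.1 hrel.2] at h3
    exact fun p _ q _ => h3 trivial
  have hle : blocks π univ ≤ blocks E univ + 1 := hconn.blocks_le
  have hVE := blocks_anti hV univ
  have hEV : E = V := (eq_of_blocks_le hV (by omega)).symm
  have hnl : ∀ p, ¬ π p (gamma m p) := fun p => hconn.not_loop (by change blocks E univ + 1 ≤ _; omega) (mem_univ p)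
  have hyx := h.1
  have hσE := cycles_le_edgeSetoid hM hU
  have hd : ∀ l, blocks π (sector m {l}) ≤ blocks E (sector m {l}) + 1 ∧
      blocks E (sector m {l}) ≤ blocks (cycles σ) (sector m {l}) := fun l =>
    ⟨(connects_singleton π l).blocks_le, blocks_anti hσE _⟩
  have hsum := sum_blocks (W := cycles σ) (fun p q => cycles_fst_eq hσ) h.1 h.2.1.symm h.2.2.1.symm
  have hu1 := blocks_union π (sector m {x.1}) (sector m {y.1})
  have hu2 := blocks_union π (sector m {x.1, y.1}) (sector m {z.1})
  rw [sector_pair] at hu1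
  rw [union_comm, sector_union h.2.1 h.2.2.1 h.1] at hu2
  have hs1 : {Quotient.mk π x, Quotient.mk π (gamma m x)} ⊆
      Quotient.mk π '' sector m {x.1} ∩ Quotient.mk π '' sector m {y.1} :=
    pair_subset_of_edge gamma_mem_sector gamma_mem_sector rfl rfl (hV hrel.1)
  have hs2 : {Quotient.mk π z, Quotient.mk π (gamma m z)} ⊆
      Quotient.mk π '' sector m {x.1, y.1} ∩ Quotient.mk π '' sector m {z.1} := by
    rw [inter_comm]
    refine pair_subset_of_edge gamma_mem_sector gamma_mem_sector rfl ?_ (E.symm' (hV hrel.2))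
    rcases forall_fin_three h.1 h.2.1.symm h.2.2.1.symm y'.1 with h1 | h1 | h1
    · exact Or.inl h1
    · exact Or.inr h1
    · exact absurd h1 h.2.2.2.1
  have hp : ∀ p, ({Quotient.mk π p, Quotient.mk π (gamma m p)} : Set (Quotient π)).ncard = 2 :=
    fun p => ncard_pair fun h => hnl p (mk_eq_mk.1 h)
  have hn1 := ncard_le_ncard hs1 (toFinite _)
  have hn2 := ncard_le_ncard hs2 (toFinite _)
  rw [hp] at hn1 hn2
  -- Each disc has at most one vertex more than pairs, giving `#σ + 3 = #V + 5` over the three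
  -- discs; the two joins share at least two vertices each. This leaves at most `#V + 1`, the
  -- assumed lower bound, so all these inequalities are equalities.
  have hx1 := hd x.1
  have hy1 := hd y.1
  have hz1 := hd z.1
  refine ⟨by omega, hEV, hnl, fun l => ?_,
    (eq_of_subset_of_ncard_le hs1 (by rw [hp]; omega) (toFinite _)).symm,
    (eq_of_subset_of_ncard_le hs2 (by rw [hp]; omega) (toFinite _)).symm⟩
  have hl : blocks E (sector m {l}) + 1 = blocks π (sector m {l}) ∧
      blocks (cycles σ) (sector m {l}) ≤ blocks E (sector m {l}) := by
    rcases forall_fin_three h.1 h.2.1.symm h.2.2.1.symm l with rfl | rfl | rfl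
    · omega
    · omega
    · omega
  exact (isDoubleTree_iff hm).2 ⟨hl.1, isDoubledOn_of_blocks hM hU
    (fun p hp => by rw [mem_sector, hσ]; exact hp) hl.2⟩

theorem joinedAlongEdge_of_edge {J K : Set (Fin 3)} (hx : x ∈ sector m J) (hy : y ∈ sector m K)
    (h : edgeSetoid (gamma m) π x y)
    (hs : Quotient.mk π '' sector m J ∩ Quotient.mk π '' sector m K ⊆
      {Quotient.mk π x, Quotient.mk π (gamma m x)}) :
    (quotientGraph π J).JoinedAlongEdge (quotientGraph π K)
      s(Quotient.mk π (gamma m x), Quotient.mk π x) :=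
  joinedAlongEdge_iff.2 ⟨x, hx, y, hy, rfl, h,
    hs.antisymm (pair_subset_of_edge gamma_mem_sector gamma_mem_sector hx hy h)⟩

theorem joinedAlongEdge_symm {J K : Set (Fin 3)} {ε : Sym2 (Quotient π)}
    (h : (quotientGraph π J).JoinedAlongEdge (quotientGraph π K) ε) :
    (quotientGraph π K).JoinedAlongEdge (quotientGraph π J) ε :=
  ⟨h.2.1, h.1, (inter_comm _ _).trans h.2.2⟩

theorem mem_T26_of_treeForm (hm : ∀ j, 0 < m j) (h : TreeForm V σ x y y' z)
    (hσ : ∀ x, (σ x).1 = x.1) (hM : IsMatching σ) (hU : cycles (gamma m * σ) ≤ π)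
    (hV : V ≤ edgeSetoid (gamma m) π) (hb : blocks V univ + 1 ≤ blocks π univ)
    (hxy' : V x y') : π ∈ T26 m := by
  obtain ⟨-, h1, h2, h3, h4, h5⟩ := h.tree_structure hm hσ hM hU hV hb
  have hrel := h.rel
  have hxz : edgeSetoid (gamma m) π z x := hV (V.symm' (V.trans' hxy' hrel.2))
  have hyz : edgeSetoid (gamma m) π z y := hV (V.trans' (V.symm' (V.trans' hxy' hrel.2)) hrel.1)
  have hzx : s(Quotient.mk π (gamma m z), Quotient.mk π z) =
      s(Quotient.mk π (gamma m x), Quotient.mk π x) := hxz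
  refine ⟨h3, s(Quotient.mk π (gamma m x), Quotient.mk π x), ?_⟩
  have j1 := joinedAlongEdge_of_edge (π := π) (J := {x.1}) (K := {y.1}) rfl rfl (hV hrel.1) h4.le
  have j2 := joinedAlongEdge_of_edge (π := π) (J := {z.1}) (K := {x.1}) rfl rfl hxz (by
    rw [inter_comm, ← h5]
    exact inter_subset_inter_left _ (image_mono fun p hp => Or.inl hp))
  have j3 := joinedAlongEdge_of_edge (π := π) (J := {z.1}) (K := {y.1}) rfl rfl hyz (by
    rw [inter_comm, ← h5]
    exact inter_subset_inter_left _ (image_mono fun p hp => Or.inr hp))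
  rw [hzx] at j2 j3
  intro i j hij
  rcases forall_fin_three h.1 h.2.1.symm h.2.2.1.symm i with rfl | rfl | rfl <;>
    rcases forall_fin_three h.1 h.2.1.symm h.2.2.1.symm j with rfl | rfl | rfl <;>
    first
      | exact absurd rfl hij
      | assumption
      | exact joinedAlongEdge_symm (by assumption)

theorem mem_T244_of_treeForm (hm : ∀ j, 0 < m j) (h : TreeForm V σ x y y' z)
    (hσ : ∀ x, (σ x).1 = x.1) (hM : IsMatching σ) (hU : cycles (gamma m * σ) ≤ π)
    (hV : V ≤ edgeSetoid (gamma m) π) (hb : blocks V univ + 1 ≤ blocks π univ)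
    (hxy' : ¬ V x y') : π ∈ T244 m := by
  obtain ⟨-, h1, h2, h3, h4, h5⟩ := h.tree_structure hm hσ hM hU hV hb
  have hrel := h.rel
  have hy' : y' ∈ sector m {x.1, y.1} := by
    rcases forall_fin_three h.1 h.2.1.symm h.2.2.1.symm y'.1 with h1 | h1 | h1
    · exact Or.inl h1
    · exact Or.inr h1
    · exact absurd h1 h.2.2.2.1
  refine ⟨h3, x.1, y.1, z.1, h.1, h.2.1.symm, h.2.2.1.symm, _, _, fun he => hxy' ?_,
    joinedAlongEdge_of_edge rfl rfl (hV hrel.1) h4.le,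
    joinedAlongEdge_symm (joinedAlongEdge_of_edge (x := z) (y := y') rfl hy'
      ((edgeSetoid (gamma m) π).symm' (hV hrel.2)) (by rw [inter_comm]; exact h5.le))⟩
  have h6 : edgeSetoid (gamma m) π x z := he
  rw [h1] at h6
  exact V.trans' h6 (V.symm' hrel.2)

/-- Three double trees joined along edges come from a non-crossing pairing. -/
theorem exists_treeForm_of_joined (hm : ∀ j, 0 < m j) (hT : AllDoubleTrees π) {i j k : Fin 3}
    (hij : i ≠ j) (hik : i ≠ k) (hjk : j ≠ k) {ε ε' : Sym2 (Quotient π)}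
    (h1 : (quotientGraph π {i}).JoinedAlongEdge (quotientGraph π {j}) ε)
    (h2 : (quotientGraph π {i, j}).JoinedAlongEdge (quotientGraph π {k}) ε') :
    ∃ σ x y y' z, IsMatching σ ∧ σ ∈ NCDiscs m ∧ cycles (gamma m * σ) ≤ π ∧
      TreeForm (edgeSetoid (gamma m) π) σ x y y' z ∧
      blocks π univ = blocks (edgeSetoid (gamma m) π) univ + 1 ∧
      (edgeSetoid (gamma m) π x y' ↔ ε = ε') := by
  set E := edgeSetoid (gamma m) π with hE
  have hT' : ∀ l, blocks E (sector m {l}) + 1 = blocks π (sector m {l}) ∧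
      IsDoubledOn (gamma m) π (sector m {l}) := fun l => (isDoubleTree_iff hm).1 (hT l)
  have hnl : ∀ p, ¬ π p (gamma m p) := fun p =>
    (connects_singleton π p.1).not_loop (hT' p.1).1.le rfl
  obtain ⟨σ, hM, hσ, hU, huniq⟩ := exists_matching (γ := gamma m) (π := π) (fun x : Point m => x.1)
    fun x => by
      obtain ⟨y, hy, h3, h4, h5, h6⟩ := (hT' x.1).2 x rfl
      exact ⟨y, hy, h3, h4, h5, h6⟩
  have hσE := cycles_le_edgeSetoid hM hU
  have hs : ∀ l, blocks E (sector m {l}) = blocks (cycles σ) (sector m {l}) := by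
    intro l
    refine blocks_congr fun p hp q hq => ⟨fun h => ?_, fun h => hσE h⟩
    exact (cycles σ).symm' (hM.cycles_apply.2
      (huniq q p ((show p.1 = l from hp).trans (show q.1 = l from hq).symm) h))
  have hfst : ∀ x, ((gamma m * σ) x).1 = x.1 := fun x => hσ x
  have hsumU := sum_blocks (W := cycles (gamma m * σ)) (fun p q => cycles_fst_eq hfst) hij hik hjk
  have hsum := sum_blocks (W := cycles σ) (fun p q => cycles_fst_eq hσ) hij hik hjk
  -- Sandwich: the coarser `π` already has one vertex more than pairs on this disc, and
  -- connectedness allows no more than that.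
  have hUb : ∀ l, blocks (cycles (gamma m * σ)) (sector m {l}) =
      blocks (cycles σ) (sector m {l}) + 1 := by
    intro l
    have h3 := (connects_singleton (cycles (gamma m * σ)) l).blocks_le
    have h4 := blocks_anti (cycles_le_edgeSetoid (γ := gamma m) hM le_rfl) (sector m {l})
    have h5 := blocks_anti hU (sector m {l})
    have h6 := (hT' l).1
    have h7 := hs l
    omega
  have hbU : blocks (cycles (gamma m * σ)) univ = blocks (cycles σ) univ + 3 := by
    rw [hsumU, hUb, hUb, hUb]; omega
  obtain ⟨x, hx, y, hy, hε, hxy, hi1⟩ := joinedAlongEdge_iff.1 h1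
  obtain ⟨y', hy', z, hz, hε', hyz, hi2⟩ := joinedAlongEdge_iff.1 h2
  obtain rfl : x.1 = i := hx
  obtain rfl : y.1 = j := hy
  obtain rfl : z.1 = k := hz
  have hform : TreeForm (glue (glue (cycles σ) x y) y' z) σ x y y' z := by
    refine ⟨hij, hik.symm, hjk.symm, fun h => ?_, rfl⟩
    rcases hy' with h3 | h3
    · exact hik (h3.symm.trans h)
    · exact hjk ((show y'.1 = y.1 from h3).symm.trans h)
  have hle : glue (glue (cycles σ) x y) y' z ≤ E := glue_le (glue_le hσE hxy) hyz
  have hform' := hform.blocks_add_two hσ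
  have hc1 : (Quotient.mk E '' sector m {x.1} ∩ Quotient.mk E '' sector m {y.1}).ncard ≤ 1 :=
    ncard_common_edges (γ := gamma m) gamma_mem_sector gamma_mem_sector
    (fun z _ => hnl z) hi1
  have hc2 : (Quotient.mk E '' sector m {x.1, y.1} ∩ Quotient.mk E '' sector m {z.1}).ncard ≤ 1 :=
    ncard_common_edges (γ := gamma m) gamma_mem_sector gamma_mem_sector
    (fun z _ => hnl z) hi2
  have e1 := blocks_union E (sector m {x.1}) (sector m {y.1})
  have e2 := blocks_union E (sector m {x.1, y.1}) (sector m {z.1})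
  have p1 := blocks_union π (sector m {x.1}) (sector m {y.1})
  have p2 := blocks_union π (sector m {x.1, y.1}) (sector m {z.1})
  have hp : ∀ p, ({Quotient.mk π p, Quotient.mk π (gamma m p)} : Set (Quotient π)).ncard = 2 :=
    fun p => ncard_pair fun h => hnl p (mk_eq_mk.1 h)
  have hunion : sector m {x.1, y.1} ∪ sector m {z.1} = univ := by
    rw [union_comm]; exact sector_union hik.symm hjk.symm hij
  rw [sector_pair] at e1 p1
  rw [hunion] at e2 p2
  rw [hi1, hp] at p1
  rw [hi2, hp] at p2
  have a1 := hT' x.1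
  have a2 := hT' y.1
  have a3 := hT' z.1
  have s1 := hs x.1
  have s2 := hs y.1
  have s3 := hs z.1
  -- Each join shares at most one edge, so by inclusion–exclusion `E` has at least `#σ - 2` blocks,
  -- the number of blocks of the glued partition.
  have hEb : blocks (glue (glue (cycles σ) x y) y' z) univ ≤ blocks E univ := by omega
  have hEeq := eq_of_blocks_le hle hEb
  refine ⟨σ, x, y, y', z, hM, (matching_mem_NCDiscs_iff hm hM).2 ⟨hbU, hσ⟩, hU, hEeq ▸ hform, ?_, ?_⟩
  · have hbE : blocks (glue (glue (cycles σ) x y) y' z) univ = blocks E univ := by rw [hEeq]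
    omega
  · rw [hε, hε']; rfl

/-- The partitions of tree type are merged partitions. -/
theorem exists_merged_eq (hm : ∀ j, 0 < m j) (hM : IsMatching σ) (hσ : σ ∈ NCDiscs m)
    (hU : cycles (gamma m * σ) ≤ π) (h : TreeForm (edgeSetoid (gamma m) π) σ x y y' z)
    (hb : blocks π univ = blocks (edgeSetoid (gamma m) π) univ + 1) :
    π ∈ merged (gamma m) (edgeSetoid (gamma m) π) σ '' orientations σ := by
  obtain ⟨hbU, hfst⟩ := (matching_mem_NCDiscs_iff hm hM).1 hσ
  obtain ⟨f, hf, hle⟩ := exists_merged_le hM hU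
  refine ⟨f, hf, eq_of_blocks_le hle ?_⟩
  have h1 := h.tree_structure hm hfst hM cycles_le_merged (le_edgeSetoid_merged hM h.cycles_le hf)
    (h.blocks_merged hfst hM hf hbU)
  rw [hb]
  exact h1.1.le

theorem TreeForm.edgeSetoid_merged (hm : ∀ j, 0 < m j) (h : TreeForm V σ x y y' z)
    (hM : IsMatching σ) (hσ : σ ∈ NCDiscs m) (hf : f ∈ orientations σ) :
    edgeSetoid (gamma m) (merged (gamma m) V σ f) = V ∧
      ∀ p, ¬ merged (gamma m) V σ f p (gamma m p) := by
  obtain ⟨hbU, hfst⟩ := (matching_mem_NCDiscs_iff hm hM).1 hσ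
  have h1 := h.tree_structure hm hfst hM cycles_le_merged (le_edgeSetoid_merged hM h.cycles_le hf)
    (h.blocks_merged hfst hM hf hbU)
  exact ⟨h1.2.1, h1.2.2.1⟩

theorem mem_T26_iff (hm : ∀ j, 0 < m j) :
    π ∈ T26 m ↔ ∃ p ∈ PS111NC2 m, π ∈ merged (gamma m) p.1 p.2 '' orientations p.2 := by
  constructor
  · rintro ⟨hT, ε, hε⟩
    have h01 := hε 0 1 (by decide)
    have h02 := hε 0 2 (by decide)
    have h12 := hε 1 2 (by decide)
    -- Being joined pairwise along one edge is the case `ε = ε'` of two successive joins: both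
    -- intersections with the third graph are the end points of `ε`.
    have h2 : (quotientGraph π {0, 1}).JoinedAlongEdge (quotientGraph π {2}) ε := by
      refine ⟨?_, h02.2.1, ?_⟩
      · obtain ⟨e, he, hee⟩ := h02.1
        exact ⟨e, Or.inl he, hee⟩
      · have h3 : (quotientGraph π {0, 1}).vertexSet =
            (quotientGraph π {0}).vertexSet ∪ (quotientGraph π {1}).vertexSet := by
          change Quotient.mk π '' sector m {0, 1} = Quotient.mk π '' sector m {0} ∪
            Quotient.mk π '' sector m {1}
          rw [← image_union, sector_pair]
        rw [h3, union_inter_distrib_right, h02.2.2, h12.2.2, union_self]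
    obtain ⟨σ, x, y, y', z, hM, hσ, hU, hform, hb, hiff⟩ :=
      exists_treeForm_of_joined hm hT (by decide) (by decide) (by decide) h01 h2
    exact ⟨(edgeSetoid (gamma m) π, σ), ⟨(mem_PS111_iff hm).2 ⟨hσ, x, y, y', z, hform, hiff.2 rfl⟩,
      isPairing_iff.2 hM⟩, exists_merged_eq hm hM hσ hU hform hb⟩
  · rintro ⟨⟨V, σ⟩, ⟨hp, hM⟩, f, hf, rfl⟩
    have hM := isPairing_iff.1 hM
    obtain ⟨hσ, x, y, y', z, h, hV⟩ := (mem_PS111_iff hm).1 hp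
    obtain ⟨hbU, hfst⟩ := (matching_mem_NCDiscs_iff hm hM).1 hσ
    exact mem_T26_of_treeForm hm h hfst hM cycles_le_merged (le_edgeSetoid_merged hM h.cycles_le hf)
      (h.blocks_merged hfst hM hf hbU) hV

theorem mem_T244_iff (hm : ∀ j, 0 < m j) :
    π ∈ T244 m ↔ ∃ p ∈ PS211NC2 m, π ∈ merged (gamma m) p.1 p.2 '' orientations p.2 := by
  constructor
  · rintro ⟨hT, i, j, k, hij, hik, hjk, ε, ε', hne, h1, h2⟩
    obtain ⟨σ, x, y, y', z, hM, hσ, hU, hform, hb, hiff⟩ :=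
      exists_treeForm_of_joined hm hT hij hik hjk h1 h2
    exact ⟨(edgeSetoid (gamma m) π, σ), ⟨(mem_PS211_iff hm).2 ⟨hσ, x, y, y', z, hform,
      fun h => hne (hiff.1 h)⟩, isPairing_iff.2 hM⟩, exists_merged_eq hm hM hσ hU hform hb⟩
  · rintro ⟨⟨V, σ⟩, ⟨hp, hM⟩, f, hf, rfl⟩
    have hM := isPairing_iff.1 hM
    obtain ⟨hσ, x, y, y', z, h, hV⟩ := (mem_PS211_iff hm).1 hp
    obtain ⟨hbU, hfst⟩ := (matching_mem_NCDiscs_iff hm hM).1 hσ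
    exact mem_T244_of_treeForm hm h hfst hM cycles_le_merged
      (le_edgeSetoid_merged hM h.cycles_le hf) (h.blocks_merged hfst hM hf hbU) hV

theorem IsMatching.ext_of_cycles {X : Type*} {σ σ' : Equiv.Perm X} (h : IsMatching σ)
    (h' : IsMatching σ') (hc : ∀ x, cycles σ' x (σ x)) : σ = σ' := by
  ext x
  rcases h'.cycles_apply.1 (hc x) with h1 | h1
  · exact absurd h1 (h x).1
  · exact h1

instance {X : Type*} [Finite X] : Finite (Setoid X) :=
  Finite.of_injective (fun (r : Setoid X) (x y : X) => r x y) fun _ _ h =>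
    Setoid.ext fun x y => iff_of_eq (congrFun (congrFun h x) y)

/-- The count of the partitions of tree type. -/
theorem ncard_trees (hm : ∀ j, 0 < m j) {A : Set (Setoid (Point m))}
    {B : Set (Setoid (Point m) × Equiv.Perm (Point m))}
    (hA : ∀ π, π ∈ A ↔ ∃ p ∈ B, π ∈ merged (gamma m) p.1 p.2 '' orientations p.2)
    (hB : ∀ p ∈ B, IsMatching p.2 ∧ p.2 ∈ NCDiscs m ∧ ∃ x y y' z, TreeForm p.1 p.2 x y y' z) :
    A.ncard = 4 * B.ncard := by
  refine ncard_eq_mul hA ?_ ?_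
  · rintro ⟨V, σ⟩ hb ⟨V', σ'⟩ hb' π ⟨f, hf, rfl⟩ ⟨f', hf', he⟩
    obtain ⟨hM, hσ, x, y, y', z, hform⟩ := hB _ hb
    obtain ⟨hM', hσ', x', y₁, y₁', z', hform'⟩ := hB _ hb'
    have h1 := (hform.edgeSetoid_merged hm hM hσ hf).1
    have h2 := (hform'.edgeSetoid_merged hm hM' hσ' hf').1
    simp only at he h1 h2 hM hM' hσ hσ' hform hform'
    obtain rfl : V = V' := by rw [← h1, ← h2, he]
    have hfst := ((mem_NCDiscs_iff hm).1 hσ).2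
    have hfst' := ((mem_NCDiscs_iff hm).1 hσ').2
    -- A block of `V` contains at most one cycle on each disc, so `V` determines the pairing.
    rw [hM.ext_of_cycles hM' fun x => hform'.cycles_of_fst_eq hfst'
      (hform.cycles_le (cycles_self_apply σ x)) (hfst x).symm]
  · rintro ⟨V, σ⟩ hb
    obtain ⟨hM, hσ, x, y, y', z, hform⟩ := hB _ hb
    have hfst := ((mem_NCDiscs_iff hm).1 hσ).2
    have h1 := ncard_merged (γ := gamma m) hM hform.cycles_le fun f hf x y _ h =>
      absurd h ((hform.edgeSetoid_merged hm hM hσ hf).2 x)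
    have h2 := hform.blocks_add_two hfst
    simp only at h1 h2 ⊢
    rw [← h2, pow_add, mul_comm] at h1
    exact Nat.eq_of_mul_eq_mul_left (by positivity) h1

theorem ncard_T26 (hm : ∀ j, 0 < m j) : (T26 m).ncard = 4 * (PS111NC2 m).ncard := by
  refine ncard_trees hm (fun π => mem_T26_iff hm) ?_
  rintro ⟨V, σ⟩ ⟨hp, hM⟩
  obtain ⟨hσ, x, y, y', z, h, -⟩ := (mem_PS111_iff hm).1 hp
  exact ⟨isPairing_iff.1 hM, hσ, x, y, y', z, h⟩

theorem ncard_T244 (hm : ∀ j, 0 < m j) : (T244 m).ncard = 4 * (PS211NC2 m).ncard := by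
  refine ncard_trees hm (fun π => mem_T244_iff hm) ?_
  rintro ⟨V, σ⟩ ⟨hp, hM⟩
  obtain ⟨hσ, x, y, y', z, h, -⟩ := (mem_PS211_iff hm).1 hp
  exact ⟨isPairing_iff.1 hM, hσ, x, y, y', z, h⟩

end Trees
end LimitGraphs

namespace LimitGraphs
open Set

/-! ### Non-crossing pairings of an annulus and a disc; through strings -/

section Annulus

variable {m : Fin 3 → ℕ} {V : Setoid (Point m)} {σ : Equiv.Perm (Point m)} {x y u v : Point m}
  {π : Setoid (Point m)} {j k l : Fin 3}

/-- `σ` is a non-crossing pairing of the union of an annulus and the disc with index `k`. -/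
def IsAnnular (k : Fin 3) (σ : Equiv.Perm (Point m)) : Prop :=
  IsMatching σ ∧ blocks (cycles (gamma m * σ)) univ = blocks (cycles σ) univ + 1 ∧
    (∀ x, (σ x).1 = k ↔ x.1 = k) ∧ ∃ u, (σ u).1 ≠ u.1

theorem mem_sector_pair_iff (hkj : k ≠ j) (hkl : k ≠ l) (hjl : j ≠ l) :
    x ∈ sector m {j, l} ↔ x.1 ≠ k := by
  refine ⟨fun h => ?_, fun h => ?_⟩
  · rcases h with h | h
    · exact fun h' => hkj (h'.symm.trans h)
    · exact fun h' => hkl (h'.symm.trans h)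
  · rcases forall_fin_three hkj hkl hjl x.1 with h1 | h1 | h1
    · exact absurd h1 h
    · exact Or.inl h1
    · exact Or.inr h1

theorem exists_two_others (k : Fin 3) : ∃ j l, k ≠ j ∧ k ≠ l ∧ j ≠ l := by
  revert k; decide

theorem IsAnnular.fst_ne (h : IsAnnular k σ) (hu : (σ u).1 ≠ u.1) : u.1 ≠ k := fun h1 =>
  hu (((h.2.2.1 u).2 h1).trans h1.symm)

theorem IsMatching.fst_iff (hσ : IsMatching σ) (hk : ∀ x, (σ x).1 = k ↔ x.1 = k) {p q : Point m}
    (h : cycles σ p q) : p.1 = k ↔ q.1 = k := by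
  rcases hσ.cycles_apply.1 h with rfl | rfl
  · rfl
  · exact (hk p).symm

theorem IsAnnular.fst_iff (h : IsAnnular k σ) {p q : Point m} (hpq : cycles σ p q) :
    p.1 = k ↔ q.1 = k := h.1.fst_iff h.2.2.1 hpq

theorem IsAnnular.not_cycles (h : IsAnnular k σ) (hx : x.1 = k) (hy : y.1 ≠ k) :
    ¬ cycles σ x y := fun h1 => hy ((h.fst_iff h1).1 hx)

theorem IsAnnular.blocks_glue (h : IsAnnular k σ) (hx : x.1 = k) (hy : y.1 ≠ k) :
    blocks (glue (cycles σ) x y) univ + 1 = blocks (cycles σ) univ :=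
  blocks_glue_univ (h.not_cycles hx hy)

theorem matching_mem_NCAnnulusDisc_iff (hm : ∀ j, 0 < m j) (hσ : IsMatching σ) :
    σ ∈ NCAnnulusDisc m k ↔ IsAnnular k σ := by
  have h1 : numBlocks (cycles σ) + numBlocks (cycles (σ⁻¹ * gamma m)) = (∑ j, m j) + 1 ↔
      blocks (cycles (gamma m * σ)) univ = blocks (cycles σ) univ + 1 := by
    rw [← blocks_univ, ← blocks_univ, hσ.inv_eq, blocks_cycles_mul_comm, ← card_point m,
      ← hσ.two_mul_blocks]
    omega
  rw [NCAnnulusDisc, mem_ofPred_eq, h1, IsAnnular]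
  refine ⟨fun ⟨h2, h3⟩ => ⟨hσ, h2, fun x => ?_, ?_⟩, fun ⟨_, h2, h3, u, hu⟩ => ⟨h2, ?_⟩⟩
  · have h4 : isolate m k x (σ x) := h3 ▸ (le_sup_left : cycles σ ≤ _) (cycles_self_apply σ x)
    exact (iff_of_eq (show (x.1 = k) = ((σ x).1 = k) from h4)).symm
  · by_contra! h4
    have h5 : cycles σ ⊔ cycles (gamma m) ≤ Setoid.ker fun x : Point m => x.1 :=
      sup_le (cycles_le_iff.2 fun p => (h4 p).symm) (cycles_le_iff.2 fun p => rfl)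
    obtain ⟨j, l, hj, hl, hjl⟩ := exists_two_others k
    refine hjl (h5 (x := ⟨j, 0, hm j⟩) (y := ⟨l, 0, hm l⟩) ?_)
    rw [h3]
    exact propext (iff_of_false hj.symm hl.symm)
  · refine le_antisymm (sup_le (cycles_le_iff.2 fun p => ?_) (cycles_le_iff.2 fun p => ?_)) ?_
    · exact propext (h3 p).symm
    · exact rfl
    · intro p q hpq
      have hpq : p.1 = k ↔ q.1 = k := iff_of_eq hpq
      have hγ : ∀ p q : Point m, p.1 = q.1 → (cycles σ ⊔ cycles (gamma m)) p q := fun p q h =>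
        (le_sup_right : cycles (gamma m) ≤ _) (cycles_gamma_apply.2 h)
      have hs : (cycles σ ⊔ cycles (gamma m)) (σ u) u :=
        (cycles σ ⊔ cycles (gamma m)).symm'
          ((le_sup_left : cycles σ ≤ _) (cycles_self_apply σ u))
      by_cases hp : p.1 = k
      · exact hγ p q (hp.trans (hpq.1 hp).symm)
      · have huk : u.1 ≠ k := fun h => hu (((h3 u).2 h).trans h.symm)
        have key : ∀ p : Point m, p.1 ≠ k → (cycles σ ⊔ cycles (gamma m)) p u := by
          intro p hp
          rcases forall_fin_three huk.symm (fun h => huk ((h3 u).1 h.symm)) hu.symm p.1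
            with h | h | h
          · exact absurd h hp
          · exact hγ p u h
          · exact (cycles σ ⊔ cycles (gamma m)).trans' (hγ p _ h) hs
        exact (cycles σ ⊔ cycles (gamma m)).trans' (key p hp)
          ((cycles σ ⊔ cycles (gamma m)).symm' (key q fun h => hp (hpq.2 h)))

/-- To join the isolated cycle, `V` must link it to the annulus; it has only one block fewer than
`σ`, so this link is a single gluing. -/
theorem mem_PS11NC2_iff (hm : ∀ j, 0 < m j) :
    (V, σ) ∈ PS11NC2 m ↔
      ∃ k x y, IsAnnular k σ ∧ x.1 = k ∧ y.1 ≠ k ∧ V = glue (cycles σ) x y := by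
  constructor
  · rintro ⟨⟨hle, k, h1, h2, h3⟩, hσ⟩
    have hA := (matching_mem_NCAnnulusDisc_iff hm (isPairing_iff.1 hσ)).1 h1
    have h2 := (partitionLength_eq_iff V σ 1 hle).1 h2
    have h4 : ∃ p q, V p q ∧ p.1 = k ∧ q.1 ≠ k := by
      by_contra! h4
      have h5 : V ⊔ isolate m k ≤ isolate m k := by
        refine sup_le (fun p q hpq => propext ⟨fun hp => ?_, fun hq => ?_⟩) le_rfl
        · exact h4 p q hpq hp
        · exact h4 q p (V.symm' hpq) hq
      rw [h3] at h5
      have h6 : ∃ j : Fin 3, j ≠ k := exists_ne k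
      obtain ⟨j, hj⟩ := h6
      have h7 : isolate m k ⟨j, 0, hm j⟩ ⟨k, 0, hm k⟩ := h5 trivial
      exact hj ((iff_of_eq (show (j = k) = (k = k) from h7)).2 rfl)
    obtain ⟨x, y, hxy, hx, hy⟩ := h4
    refine ⟨k, x, y, hA, hx, hy, (eq_of_blocks_le (glue_le hle hxy) ?_).symm⟩
    have : blocks (glue (cycles σ) x y) univ + 1 = blocks (cycles σ) univ := hA.blocks_glue hx hy
    change blocks V univ + 1 = blocks (cycles σ) univ at h2
    change blocks (glue (cycles σ) x y) univ ≤ blocks V univ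
    omega
  · rintro ⟨k, x, y, hA, hx, hy, rfl⟩
    refine ⟨⟨le_glue _ _ _, k, (matching_mem_NCAnnulusDisc_iff hm hA.1).2 hA,
      (partitionLength_eq_iff _ σ 1 (le_glue _ _ _)).2 (hA.blocks_glue hx hy), ?_⟩,
      isPairing_iff.2 hA.1⟩
    rw [eq_top_iff]
    set W := glue (cycles σ) x y ⊔ isolate m k
    have h1 : W x y := (le_sup_left : glue (cycles σ) x y ≤ W) (glue_self _ _ _)
    have h2 : ∀ p, W p x := by
      intro p
      by_cases hp : p.1 = k
      · exact (le_sup_right : isolate m k ≤ W) (propext (iff_of_true hp hx))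
      · exact W.trans' ((le_sup_right : isolate m k ≤ W) (propext (iff_of_false hp hy)))
          (W.symm' h1)
    exact fun p q _ => W.trans' (h2 p) (W.symm' (h2 q))

theorem mk_mem_throughStrings (hσ : IsMatching σ) :
    Quotient.mk (cycles σ) u ∈ throughStrings σ ↔ (σ u).1 ≠ u.1 := by
  constructor
  · rintro ⟨p, q, hp, hq, hpq⟩ h
    have hp := hσ.cycles_apply.1 (mk_eq_mk.1 hp.symm)
    have hq := hσ.cycles_apply.1 (mk_eq_mk.1 hq.symm)
    apply hpq
    rcases hp with rfl | rfl <;> rcases hq with rfl | rfl <;> simp [h]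
  · exact fun h => ⟨σ u, u, mk_eq_mk.2 ((cycles σ).symm' (cycles_self_apply σ u)), rfl, h⟩

theorem throughStrings_eq_singleton (hσ : IsMatching σ) :
    throughStrings σ = {Quotient.mk (cycles σ) y} ↔ ∀ u, (σ u).1 ≠ u.1 ↔ u = y ∨ u = σ y := by
  have h : ∀ u, Quotient.mk (cycles σ) u = Quotient.mk (cycles σ) y ↔ u = y ∨ u = σ y := fun u => by
    rw [eq_comm, mk_eq_mk, hσ.cycles_apply]
  rw [Set.ext_iff]
  refine ⟨fun h1 u => ?_, fun h1 c => ?_⟩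
  · rw [← mk_mem_throughStrings hσ, h1, mem_singleton_iff, h]
  · induction c using Quotient.ind with
    | _ u => exact (mk_mem_throughStrings hσ).trans ((h1 u).trans (h u).symm)

/-- The only cycle that can be glued to a through string lies on the isolated cycle of `γ`. Hence
its block meets the basic cycle of `u` in `u` alone. -/
theorem IsAnnular.eq_of_through (h : IsAnnular k σ) (hx : x.1 = k) (hu : (σ u).1 ≠ u.1)
    (huv : glue (cycles σ) x y u v) (hv : v.1 = u.1) : v = u := by
  rcases huv with h1 | ⟨h1, -⟩ | ⟨-, h1⟩
  · rcases h.1.cycles_apply.1 h1 with h2 | h2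
    · exact h2
    · exact absurd (h2 ▸ hv) hu
  · exact absurd ((h.fst_iff h1).2 hx) (h.fst_ne hu)
  · exact absurd (hv ▸ (h.fst_iff h1).2 hx) (h.fst_ne hu)

theorem IsAnnular.cycles_of_glue (h : IsAnnular k σ) (hx : x.1 = k) (hy : y.1 ≠ k)
    (huv : glue (cycles σ) x y u v) (hk : u.1 = k ↔ v.1 = k) : cycles σ u v := by
  rcases huv with h1 | ⟨h1, h2⟩ | ⟨h1, h2⟩
  · exact h1
  · exact absurd ((h.fst_iff h2).1 (hk.1 ((h.fst_iff h1).2 hx))) hy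
  · exact absurd ((h.fst_iff h1).1 (hk.2 ((h.fst_iff h2).2 hx))) hy

/-- The partition determines the pairing. -/
theorem eq_of_mem_PS11NC2 (hm : ∀ j, 0 < m j) {σ' : Equiv.Perm (Point m)}
    (h : (V, σ) ∈ PS11NC2 m) (h' : (V, σ') ∈ PS11NC2 m) : σ = σ' := by
  obtain ⟨k, x, y, hA, hx, hy, hV⟩ := (mem_PS11NC2_iff hm).1 h
  obtain ⟨k', x', y', hA', hx', hy', hV'⟩ := (mem_PS11NC2_iff hm).1 h'
  have hle' : cycles σ' ≤ V := hV' ▸ le_glue _ _ _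
  have hk : k' = k := by
    by_contra hne
    -- If the isolated cycles differed, `σ'` would pair an end `u` of a through string of `σ` with
    -- another point of the same basic cycle, inside one block of `V`. But the through strings of
    -- `σ` have ends on both basic cycles other than the `k`-th.
    have key : ∀ u, (σ u).1 ≠ u.1 → u.1 ≠ k' := by
      intro u hu huk
      have h1 : V u (σ' u) := hle' (cycles_self_apply σ' u)
      rw [hV] at h1
      exact (hA'.1 u).1 (hA.eq_of_through hx hu h1 (((hA'.2.2.1 u).2 huk).trans huk.symm))
    obtain ⟨u, hu⟩ := hA.2.2.2
    have hu' : (σ (σ u)).1 ≠ (σ u).1 := by rw [(hA.1 u).2]; exact hu.symm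
    rcases forall_fin_three hu (hA.fst_ne hu') (hA.fst_ne hu) k' with h1 | h1 | h1
    · exact key _ hu' h1.symm
    · exact key _ hu h1.symm
    · exact hne h1
  subst hk
  refine hA.1.ext_of_cycles hA'.1 fun p => ?_
  have h1 : V p (σ p) := hV ▸ le_glue _ _ _ (cycles_self_apply σ p)
  rw [hV'] at h1
  exact hA'.cycles_of_glue hx' hy' h1 (hA.2.2.1 p).symm

theorem mem_PS11NC2Through_iff (hm : ∀ j, 0 < m j) :
    (V, σ) ∈ PS11NC2Through m ↔
      ∃ k x y, IsAnnular k σ ∧ x.1 = k ∧ y.1 ≠ k ∧ V = glue (cycles σ) x y ∧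
        ∀ u, (σ u).1 ≠ u.1 ↔ u = y ∨ u = σ y := by
  constructor
  · rintro ⟨h, c₁, c₂, k', ht, hk', hc₂, b, hb⟩
    obtain ⟨k, x, y, hA, hx, hy, hV⟩ := (mem_PS11NC2_iff hm).1 h
    have hA' := (matching_mem_NCAnnulusDisc_iff hm hA.1).1 hk'
    refine ⟨k, x, y, hA, hx, hy, hV, ?_⟩
    induction c₁ using Quotient.ind with
    | _ u =>
    induction c₂ using Quotient.ind with
    | _ v =>
    induction b using Quotient.ind with
    | _ w =>
    change cyclesIn V σ (Quotient.mk V w) = _ at hb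
    have hle : cycles σ ≤ V := hV ▸ le_glue _ _ _
    rw [ncard_cyclesIn hle] at hb
    have hw : ∀ p, Quotient.mk (cycles σ) p ∈ Quotient.mk (cycles σ) '' {p | V p w} → V p w := by
      rintro p ⟨q, hq, hqp⟩
      exact V.trans' (V.symm' (hle (mk_eq_mk.1 hqp))) hq
    have huv : V u v := V.trans' (hw u (hb ▸ Or.inl rfl)) (V.symm' (hw v (hb ▸ Or.inr rfl)))
    have hu : (σ u).1 ≠ u.1 := (mk_mem_throughStrings hA.1).1 (ht ▸ rfl)
    have hv : v.1 = k' := hc₂ v rfl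
    have hkk : k' = k := by
      rcases forall_fin_three hu (fun h => hA.fst_ne hu ((hA.2.2.1 u).1 h)) (hA.fst_ne hu) k'
        with h1 | h1 | h1
      · exact absurd ((hA'.2.2.1 u).1 h1.symm) (hA'.fst_ne hu)
      · exact absurd h1.symm (hA'.fst_ne hu)
      · exact h1
    subst hkk
    have huy : cycles σ u y := by
      rw [hV] at huv
      rcases huv with h1 | ⟨h1, -⟩ | ⟨h1, -⟩
      · exact absurd ((hA.fst_iff h1).2 hv) (hA.fst_ne hu)
      · exact absurd ((hA.fst_iff h1).2 hx) (hA.fst_ne hu)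
      · exact h1
    refine (throughStrings_eq_singleton hA.1).1 (ht.trans ?_)
    rw [singleton_eq_singleton_iff]
    exact mk_eq_mk.2 huy
  · rintro ⟨k, x, y, hA, hx, hy, hV, ht⟩
    refine ⟨(mem_PS11NC2_iff hm).2 ⟨k, x, y, hA, hx, hy, hV⟩, Quotient.mk _ y, Quotient.mk _ x, k,
      (throughStrings_eq_singleton hA.1).2 ht, (matching_mem_NCAnnulusDisc_iff hm hA.1).2 hA,
      fun p hp => (hA.fst_iff (mk_eq_mk.1 hp)).2 hx, Quotient.mk V x, ?_⟩
    change cyclesIn V σ (Quotient.mk V x) = _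
    have hle : cycles σ ≤ V := hV ▸ le_glue _ _ _
    rw [ncard_cyclesIn hle, hV]
    ext c
    constructor
    · rintro ⟨p, hp, rfl⟩
      rcases hp with h1 | ⟨h1, -⟩ | ⟨h1, -⟩
      · exact Or.inr (mk_eq_mk.2 h1)
      · exact Or.inr (mk_eq_mk.2 h1)
      · exact Or.inl (mk_eq_mk.2 h1)
    · rintro (rfl | rfl)
      · exact ⟨y, (glue _ _ _).symm' (glue_self _ _ _), rfl⟩
      · exact ⟨x, (glue _ _ _).refl' x, rfl⟩

theorem ncard_throughStrings_of_through (hσ : IsMatching σ)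
    (h : ∀ u, (σ u).1 ≠ u.1 ↔ u = y ∨ u = σ y) : (throughStrings σ).ncard = 1 := by
  rw [(throughStrings_eq_singleton hσ).2 h, ncard_singleton]

theorem IsAnnular.connects (h : IsAnnular k σ) (hkj : k ≠ j) (hkl : k ≠ l) (hjl : j ≠ l)
    (hU : cycles (gamma m * σ) ≤ π) : Connects (gamma m) π (sector m {j, l}) := by
  obtain ⟨u, hu⟩ := h.2.2.2
  have hu' : (σ (σ u)).1 ≠ (σ u).1 := by rw [(h.1 u).2]; exact hu.symm
  have hE : edgeSetoid (gamma m) π u (σ u) := cycles_le_edgeSetoid h.1 hU (cycles_self_apply σ u)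
  have e1 := (mem_sector_pair_iff hkj hkl hjl).2 (h.fst_ne hu)
  have e2 := (mem_sector_pair_iff hkj hkl hjl).2 (h.fst_ne hu')
  rcases e1 with e1 | e1 <;> rcases e2 with e2 | e2
  · exact absurd (e2.trans e1.symm) hu
  · exact connects_pair_of_edge e1 e2 hE
  · exact connects_pair_of_edge e2 e1 ((edgeSetoid _ π).symm' hE)
  · exact absurd (e2.trans e1.symm) hu

/-- In a tree, a through string is doubled by an edge that goes back. -/
theorem IsAnnular.exists_back (h : IsAnnular k σ) (hkj : k ≠ j) (hkl : k ≠ l) (hjl : j ≠ l)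
    (hU : cycles (gamma m * σ) ≤ π)
    (hb : blocks (edgeSetoid (gamma m) π) (sector m {j, l}) + 1 ≤ blocks π (sector m {j, l}))
    (hu : (σ u).1 ≠ u.1) : ∃ z, z.1 = u.1 ∧ z ≠ u ∧ edgeSetoid (gamma m) π z u ∧
      ¬ cycles σ z u := by
  have hus := (mem_sector_pair_iff hkj hkl hjl).2 (h.fst_ne hu)
  obtain ⟨z, hz, hzu, hE⟩ := (h.connects hkj hkl hjl hU).exists_edge_back (K := sector m {u.1}) hb
    gamma_mem_sector (fun p hp => by rw [mem_sector, show p.1 = u.1 from hp]; exact hus) rfl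
  refine ⟨z, hz, hzu, hE, fun hc => ?_⟩
  rcases h.1.cycles_apply.1 ((cycles σ).symm' hc) with h1 | h1
  · exact hzu h1
  · exact hu (h1 ▸ hz)

/-- The disc and the annulus each have at most one vertex more than pairs, and the total excess is
one. It belongs to the disc: an excess on the annulus would make it a tree with all pairs giving
distinct edges, and a through string would have no edge leading back. -/
theorem IsAnnular.blocks_eq (h : IsAnnular k σ) (hkj : k ≠ j) (hkl : k ≠ l) (hjl : j ≠ l) :
    blocks (cycles σ) univ =
      blocks (cycles σ) (sector m {k}) + blocks (cycles σ) (sector m {j, l}) ∧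
    blocks (cycles (gamma m * σ)) (sector m {k}) = blocks (cycles σ) (sector m {k}) + 1 ∧
    blocks (cycles (gamma m * σ)) (sector m {j, l}) = blocks (cycles σ) (sector m {j, l}) := by
  have h1 := sum_blocks_isolate (W := cycles σ) hkj hkl hjl fun p q => h.fst_iff
  have h2 := sum_blocks_isolate (W := cycles (gamma m * σ)) hkj hkl hjl fun p q hpq =>
    iff_of_eq (show (Setoid.ker fun p : Point m => p.1 = k) p q from
      cycles_le_iff.2 (fun p => propext (h.2.2.1 p).symm) hpq)
  have h3 := h.2.1
  have h4 := (connects_singleton (cycles (gamma m * σ)) k).blocks_le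
  have h5 := (h.connects hkj hkl hjl le_rfl).blocks_le
  have h6 := cycles_le_edgeSetoid h.1 (le_refl (cycles (gamma m * σ)))
  have h7 := blocks_anti h6 (sector m {k})
  have h8 := blocks_anti h6 (sector m {j, l})
  have h9 : blocks (cycles (gamma m * σ)) (sector m {j, l}) ≠
      blocks (cycles σ) (sector m {j, l}) + 1 := by
    intro h9
    obtain ⟨u, hu⟩ := h.2.2.2
    obtain ⟨z, hz, -, hE, hc⟩ := h.exists_back hkj hkl hjl le_rfl (by omega) hu
    have hus := (mem_sector_pair_iff hkj hkl hjl).2 (h.fst_ne hu)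
    exact hc (rel_of_blocks_le h6 (by omega)
      (by rw [mem_sector, hz]; exact hus) hus hE)
  omega

theorem isAnnular_mem_sector (h : ∀ x, (σ x).1 = k ↔ x.1 = k) (hkj : k ≠ j) (hkl : k ≠ l)
    (hjl : j ≠ l) : ∀ x ∈ sector m {j, l}, σ x ∈ sector m {j, l} := by
  intro x
  rw [mem_sector_pair_iff hkj hkl hjl, mem_sector_pair_iff hkj hkl hjl, ne_eq, ne_eq, h x]
  exact id

/-- If the edges of the annulus form a tree, then there are exactly two through strings. -/
theorem IsAnnular.ncard_eq_two (h : IsAnnular k σ) (hkj : k ≠ j) (hkl : k ≠ l) (hjl : j ≠ l)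
    (hb : blocks (edgeSetoid (gamma m) (cycles (gamma m * σ))) (sector m {j, l}) + 1 =
      blocks (cycles (gamma m * σ)) (sector m {j, l})) : (throughStrings σ).ncard = 2 := by
  set E := edgeSetoid (gamma m) (cycles (gamma m * σ)) with hEdef
  have h6 : cycles σ ≤ E := cycles_le_edgeSetoid h.1 le_rfl
  obtain ⟨-, -, h1⟩ := h.blocks_eq hkj hkl hjl
  obtain ⟨u, hu⟩ := h.2.2.2
  have hu' : (σ (σ u)).1 ≠ (σ u).1 := by rw [(h.1 u).2]; exact hu.symm
  have hback := fun {w} (hw : (σ w).1 ≠ w.1) => h.exists_back hkj hkl hjl le_rfl hb.le hw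
  obtain ⟨z, hz, hzu, hE, hc⟩ := hback hu
  have hmem : ∀ {w}, w.1 ≠ k → w ∈ sector m {j, l} := (mem_sector_pair_iff hkj hkl hjl).2
  -- On the annulus there is exactly one edge class fewer than there are pairs, so identifying the
  -- pairs of `z` and `u` accounts for all coincidences.
  have hEglue : ∀ {p q}, p.1 ≠ k → q.1 ≠ k → E p q → glue (cycles σ) z u p q := by
    intro p q hp hq
    refine rel_of_blocks_le (glue_le h6 hE) (S := sector m {j, l}) ?_ (hmem hp) (hmem hq)
    have hg : blocks (glue (cycles σ) z u) (sector m {j, l}) + 1 ≤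
        blocks (cycles σ) (sector m {j, l}) := by
      by_contra hlt
      refine hc (rel_of_blocks_le (le_glue _ z u) (S := sector m {j, l}) (by omega)
        (hmem (hz ▸ h.fst_ne hu)) (hmem (h.fst_ne hu)) (glue_self _ _ _))
    omega
  -- The other end `σ u` also needs an edge leading back, and the only available pair is that of
  -- `z`. So this pair meets both basic cycles.
  have hzt : (σ z).1 ≠ z.1 := by
    intro hzt
    obtain ⟨w, hw, hwu, hwE, hwc⟩ := hback hu'
    have hg := hEglue (hw ▸ h.fst_ne hu') (h.fst_ne hu') hwE
    rcases hg with h2 | ⟨h2, -⟩ | ⟨-, h2⟩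
    · exact hwc h2
    · rcases h.1.cycles_apply.1 ((cycles σ).symm' h2) with h3 | h3
      · exact hu (hw.symm.trans (h3 ▸ hz))
      · exact hu (hw.symm.trans (h3 ▸ hzt.trans hz))
    · exact hc ((cycles σ).symm' ((cycles σ).trans' (cycles_self_apply σ u) h2))
  have hset : throughStrings σ = {Quotient.mk (cycles σ) z, Quotient.mk (cycles σ) u} := by
    ext c
    induction c using Quotient.ind with
    | _ v =>
    refine (mk_mem_throughStrings h.1).trans ⟨fun hv => ?_, ?_⟩
    · obtain ⟨w, hw, hwv, hwE, hwc⟩ := hback hv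
      rcases hEglue (hw ▸ h.fst_ne hv) (h.fst_ne hv) hwE with h2 | ⟨-, h2⟩ | ⟨-, h2⟩
      · exact absurd h2 hwc
      · exact Or.inr (mk_eq_mk.2 h2)
      · exact Or.inl (mk_eq_mk.2 h2)
    · rintro (h2 | h2)
      · have := (mk_mem_throughStrings h.1).2 hzt
        rw [← h2] at this
        exact (mk_mem_throughStrings h.1).1 this
      · have := (mk_mem_throughStrings h.1).2 hu
        rw [← h2] at this
        exact (mk_mem_throughStrings h.1).1 this
  rw [hset, ncard_pair]
  exact fun h2 => hc (mk_eq_mk.1 h2)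

/-- The pairing of the edges of a double unicircuit graph with a loop has this loop as its only
through string. -/
theorem IsDoubleUnicircuit.through_of_loop (hD : IsDoubleUnicircuit π j l) (hkj : k ≠ j)
    (hkl : k ≠ l) (hjl : j ≠ l) (h : IsAnnular k σ) (hU : cycles (gamma m * σ) ≤ π)
    (hE : ∀ p q, p.1 ≠ k → q.1 ≠ k → edgeSetoid (gamma m) π p q → cycles σ p q)
    (hy : y.1 ≠ k) (hl : π y (gamma m y)) (u : Point m) :
    (σ u).1 ≠ u.1 ↔ u = y ∨ u = σ y := by
  have key : ∀ u, (σ u).1 ≠ u.1 → u = y ∨ u = σ y := by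
    intro u hu
    have hu' : (σ (σ u)).1 ≠ (σ u).1 := by rw [(h.1 u).2]; exact hu.symm
    have hEu : edgeSetoid (gamma m) π (σ u) u := cycles_le_edgeSetoid h.1 hU
      ((cycles σ).symm' (cycles_self_apply σ u))
    have hmem : ∀ {w}, w.1 ≠ k → w ∈ sector m {j, l} := (mem_sector_pair_iff hkj hkl hjl).2
    have := hD.edge_of_loop hjl (hmem hy) hl (hmem (h.fst_ne hu)) (hmem (h.fst_ne hu')) hu.symm hEu
    exact h.1.cycles_apply.1 ((cycles σ).symm' (hE _ _ (h.fst_ne hu) hy this))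
  refine ⟨key u, ?_⟩
  obtain ⟨v, hv⟩ := h.2.2.2
  have hv' : (σ (σ v)).1 ≠ (σ v).1 := by rw [(h.1 v).2]; exact hv.symm
  have hyt : (σ y).1 ≠ y.1 := by
    rcases key v hv with rfl | rfl
    · exact hv
    · rwa [(h.1 y).2] at hv'
  rintro (rfl | rfl)
  · exact hyt
  · rw [(h.1 y).2]; exact hyt.symm

/-- Edges shared by both closed walks are through strings. A loop is the only one when there is a
loop; otherwise the circuit provides three distinct ones. -/
theorem IsDoubleUnicircuit.ncard_ne_two (hD : IsDoubleUnicircuit π j l) (hkj : k ≠ j)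
    (hkl : k ≠ l) (hjl : j ≠ l) (h : IsAnnular k σ) (hU : cycles (gamma m * σ) ≤ π)
    (hE : ∀ p q, p.1 ≠ k → q.1 ≠ k → edgeSetoid (gamma m) π p q → cycles σ p q) :
    (throughStrings σ).ncard ≠ 2 := by
  have hmem : ∀ {w}, w ∈ sector m {j, l} ↔ w.1 ≠ k := mem_sector_pair_iff hkj hkl hjl
  rcases hD.loop_or_three with ⟨y, hy, hl⟩ | ⟨x, hx, hxl, hne⟩
  · rw [ncard_throughStrings_of_through h.1
      (hD.through_of_loop hkj hkl hjl h hU hE (hmem.1 hy) hl)]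
    decide
  · have h1 : ∀ i, Quotient.mk (cycles σ) (x i) ∈ throughStrings σ := by
      intro i
      obtain ⟨y, hy, hxy⟩ := hxl i
      have hyk : y.1 ≠ k := hy ▸ hkl.symm
      have hxk : (x i).1 ≠ k := hx i ▸ hkj.symm
      rw [mk_mem_throughStrings h.1]
      rcases h.1.cycles_apply.1 (hE _ _ hxk hyk hxy) with h2 | h2
      · exact absurd ((hx i).symm.trans ((h2 ▸ rfl : (x i).1 = y.1).trans hy)) hjl
      · rw [← h2, hy, hx i]; exact hjl.symm
    have hinj : Function.Injective fun i => Quotient.mk (cycles σ) (x i) := by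
      intro i i' hii
      by_contra hc
      exact hne i i' hc (cycles_le_edgeSetoid h.1 hU (mk_eq_mk.1 hii))
    have h2 : (range fun i => Quotient.mk (cycles σ) (x i)).ncard = 3 := by
      rw [← image_univ, ncard_image_of_injective _ hinj, ncard_univ, Nat.card_eq_fintype_card,
        Fintype.card_fin]
    have h3 := ncard_le_ncard (range_subset_iff.2 h1) (toFinite _)
    omega

/-- There are at most as many edges as pairs, and by connectedness at least one fewer than vertices,
which are as many as pairs. The smaller value is the tree, with two through strings. -/
theorem IsAnnular.edges_of_ncard_ne (h : IsAnnular k σ) (hkj : k ≠ j) (hkl : k ≠ l) (hjl : j ≠ l)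
    (h2 : (throughStrings σ).ncard ≠ 2) :
    blocks (edgeSetoid (gamma m) (cycles (gamma m * σ))) (sector m {j, l}) =
      blocks (cycles σ) (sector m {j, l}) := by
  have h3 := (h.connects hkj hkl hjl le_rfl).blocks_le
  have h4 := blocks_anti (cycles_le_edgeSetoid h.1 (le_refl (cycles (gamma m * σ))))
    (sector m {j, l})
  have h5 := (h.blocks_eq hkj hkl hjl).2.2
  have h6 := mt (h.ncard_eq_two hkj hkl hjl) h2
  omega

theorem IsAnnular.isDoubleUnicircuit (h : IsAnnular k σ) (hkj : k ≠ j) (hkl : k ≠ l) (hjl : j ≠ l)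
    (hU : cycles (gamma m * σ) ≤ π)
    (hb : blocks π (sector m {j, l}) = blocks (cycles σ) (sector m {j, l}))
    (hE : blocks (edgeSetoid (gamma m) π) (sector m {j, l}) =
      blocks (cycles σ) (sector m {j, l})) : IsDoubleUnicircuit π j l := by
  refine (isDoubleUnicircuit_iff hjl).2 ⟨hb.trans hE.symm, isDoubledOn_of_blocks h.1 hU
    (isAnnular_mem_sector h.2.2.1 hkj hkl hjl) hE.ge, ?_⟩
  obtain ⟨u, hu⟩ := h.2.2.2
  have hu' : (σ (σ u)).1 ≠ (σ u).1 := by rw [(h.1 u).2]; exact hu.symm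
  have hEu : edgeSetoid (gamma m) π u (σ u) := cycles_le_edgeSetoid h.1 hU (cycles_self_apply σ u)
  have e1 := (mem_sector_pair_iff hkj hkl hjl).2 (h.fst_ne hu)
  have e2 := (mem_sector_pair_iff hkj hkl hjl).2 (h.fst_ne hu')
  rcases e1 with e1 | e1 <;> rcases e2 with e2 | e2
  · exact absurd (e2.trans e1.symm) hu
  · exact ⟨_, _, e1, e2, hEu⟩
  · exact ⟨_, _, e2, e1, (edgeSetoid _ π).symm' hEu⟩
  · exact absurd (e2.trans e1.symm) hu

/-- A single through string is a loop. -/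
theorem IsAnnular.loop_of_through (h : IsAnnular k σ) (ht : ∀ u, (σ u).1 ≠ u.1 ↔ u = y ∨ u = σ y) :
    cycles (gamma m * σ) y (gamma m y) := by
  obtain ⟨j, l, hkj, hkl, hjl⟩ := exists_two_others k
  have h1 := ncard_throughStrings_of_through h.1 ht
  have hE := h.edges_of_ncard_ne hkj hkl hjl (by omega)
  have hD := h.isDoubleUnicircuit hkj hkl hjl le_rfl (h.blocks_eq hkj hkl hjl).2.2 hE
  have hσE := cycles_le_edgeSetoid h.1 (le_refl (cycles (gamma m * σ)))
  have hmem : ∀ {w}, w ∈ sector m {j, l} ↔ w.1 ≠ k := mem_sector_pair_iff hkj hkl hjl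
  have hEc : ∀ p q, p.1 ≠ k → q.1 ≠ k →
      edgeSetoid (gamma m) (cycles (gamma m * σ)) p q → cycles σ p q := fun p q hp hq =>
    rel_of_blocks_le hσE hE.ge (hmem.2 hp) (hmem.2 hq)
  rcases hD.loop_or_three with ⟨z, hz, hl⟩ | ⟨x, hx, hxl, hne⟩
  · have h2 := (hD.through_of_loop hkj hkl hjl h le_rfl hEc (hmem.1 hz) hl y).1
      ((ht y).2 (Or.inl rfl))
    exact rel_gamma_of_edgeSetoid le_rfl (hσE (h.1.cycles_apply.2 h2)) hl
  · have h1 : ∀ i, cycles σ y (x i) := by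
      intro i
      obtain ⟨w, hw, hxy⟩ := hxl i
      refine h.1.cycles_apply.2 ((ht _).1 ?_)
      rcases h.1.cycles_apply.1 (hEc _ _ (hx i ▸ hkj.symm) (hw ▸ hkl.symm) hxy) with h2 | h2
      · exact absurd ((hx i).symm.trans ((h2 ▸ rfl : (x i).1 = w.1).trans hw)) hjl
      · rw [← h2, hw, hx i]; exact hjl.symm
    exact absurd (hσE ((cycles σ).trans' ((cycles σ).symm' (h1 0)) (h1 1))) (hne 0 1 (by decide))

end Annulus
end LimitGraphs

namespace LimitGraphs
open Set

/-! ### The 2-4 unicircuit and 2-4 uniloop types -/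

section Unicircuit

variable {m : Fin 3 → ℕ} {V : Setoid (Point m)} {σ : Equiv.Perm (Point m)} {x y u v : Point m}
  {π : Setoid (Point m)} {i j k l : Fin 3} {f : Point m → Bool}

/-- The isolated basic cycle is the one that no through string meets. -/
theorem IsAnnular.eq (h : IsAnnular k σ) (h' : IsAnnular l σ) : l = k := by
  obtain ⟨u, hu⟩ := h.2.2.2
  rcases forall_fin_three hu (fun h1 => h.fst_ne hu ((h.2.2.1 u).1 h1)) (h.fst_ne hu) l
    with h1 | h1 | h1
  · exact absurd ((h'.2.2.1 u).1 h1.symm) (h'.fst_ne hu)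
  · exact absurd h1.symm (h'.fst_ne hu)
  · exact h1

theorem ncard_common_edges_of_loop {X : Type*} [Finite X] {γ : Equiv.Perm X} {π : Setoid X}
    {S T : Set X} (hS : ∀ z ∈ S, γ z ∈ S) (hT : ∀ z ∈ T, γ z ∈ T) {x : X} (hx : π x (γ x))
    (h : Quotient.mk π '' S ∩ Quotient.mk π '' T = {Quotient.mk π x}) :
    (Quotient.mk (edgeSetoid γ π) '' S ∩ Quotient.mk (edgeSetoid γ π) '' T).ncard ≤ 1 := by
  have h1 : Quotient.mk (edgeSetoid γ π) '' S ∩ Quotient.mk (edgeSetoid γ π) '' T ⊆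
      {Quotient.mk (edgeSetoid γ π) x} := by
    rintro _ ⟨⟨p, hp, rfl⟩, q, hq, hqp⟩
    have h2 := pair_subset_of_edge hS hT hp hq ((edgeSetoid γ π).symm' (mk_eq_mk.1 hqp))
    rw [h] at h2
    have h3 : π p x := mk_eq_mk.1 (h2 (mem_insert _ _))
    have h4 : π (γ p) x := mk_eq_mk.1 (h2 (mem_insert_of_mem _ rfl))
    exact mk_eq_mk.2 (edgeSetoid_apply.2 (Or.inl ⟨h3, π.trans' h4 hx⟩))
  exact (ncard_le_ncard h1 (toFinite _)).trans (ncard_singleton _).le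

theorem exists_oriented_glue (hf : f ∈ orientations σ) (x y : Point m) : ∃ y₁, f x = f y₁ ∧ glue (cycles σ) x y = glue (cycles σ) x y₁ := by
  by_cases hxy : f x = f y
  · exact ⟨y, hxy, rfl⟩
  · refine ⟨σ y, ?_, glue_congr ((cycles σ).refl' x) (cycles_self_apply σ y)⟩
    rw [hf y]; revert hxy; cases f x <;> cases f y <;> simp

/-- Here `#(γσ) = #σ + 1 = #V + 2`, and a single identification of edges loses at most two vertices.
-/
theorem IsAnnular.blocks_merged (h : IsAnnular k σ) (hx : x.1 = k) (hy : y.1 ≠ k)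
    (hf : f ∈ orientations σ) :
    blocks (glue (cycles σ) x y) univ ≤
      blocks (merged (gamma m) (glue (cycles σ) x y) σ f) univ := by
  have h2 := h.blocks_glue hx hy
  have h3 := h.2.1
  obtain ⟨y₁, hfy, hg⟩ := exists_oriented_glue hf x y
  rw [hg] at h2 ⊢
  set M₁ := glue (cycles (gamma m * σ)) x y₁
  set M₂ := glue M₁ (gamma m x) (gamma m y₁)
  have b1 : _ ≤ blocks M₁ univ + 1 := blocks_le_blocks_glue _ _ _ univ
  have b2 : _ ≤ blocks M₂ univ + 1 := blocks_le_blocks_glue _ _ _ univ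
  have l1 : cycles (gamma m * σ) ≤ M₁ := le_glue _ _ _
  have l2 : M₁ ≤ M₂ := le_glue _ _ _
  have hle : merged (gamma m) (glue (cycles σ) x y₁) σ f ≤ M₂ :=
    merged_glue_le hf h.1 (l1.trans l2) fun K hK hK' =>
      glue_le hK (hK' _ _ hfy (l2 (glue_self _ _ _)) (glue_self _ _ _))
  have := blocks_anti hle univ
  omega

/-- The counts of vertices and edges force the union of a double unicircuit graph with a double
tree or a double uniloop graph. -/
theorem IsAnnular.union_structure (hm : ∀ j, 0 < m j) (h : IsAnnular k σ) (hkj : k ≠ j)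
    (hkl : k ≠ l) (hjl : j ≠ l) (ht : (throughStrings σ).ncard ≠ 2) (hx : x.1 = k) (hy : y.1 ≠ k)
    (hU : cycles (gamma m * σ) ≤ π) (hV : glue (cycles σ) x y ≤ edgeSetoid (gamma m) π)
    (hb : blocks (glue (cycles σ) x y) univ ≤ blocks π univ) :
    blocks π univ = blocks (glue (cycles σ) x y) univ ∧
      edgeSetoid (gamma m) π = glue (cycles σ) x y ∧ IsDoubleUnicircuit π j l ∧
      ((¬ π x (gamma m x) ∧ (quotientGraph π {k}).IsDoubleTree ∧
        Quotient.mk π '' sector m {k} ∩ Quotient.mk π '' sector m {j, l} =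
          {Quotient.mk π x, Quotient.mk π (gamma m x)}) ∨
      (π x (gamma m x) ∧ (quotientGraph π {k}).IsDoubleUniloopAt (Quotient.mk π x) ∧
        Quotient.mk π '' sector m {k} ∩ Quotient.mk π '' sector m {j, l} =
          {Quotient.mk π x})) := by
  obtain ⟨hs, hUk, hUc⟩ := h.blocks_eq hkj hkl hjl
  have hEU := h.edges_of_ncard_ne hkj hkl hjl ht
  have hcount := h.blocks_glue hx hy
  have hmem : ∀ {w}, w ∈ sector m {j, l} ↔ w.1 ≠ k := mem_sector_pair_iff hkj hkl hjl
  have hσE := cycles_le_edgeSetoid h.1 hU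
  have hπk := blocks_anti hU (sector m {k})
  have hπc := blocks_anti hU (sector m {j, l})
  have hunion := blocks_union π (sector m {k}) (sector m {j, l})
  rw [sector_union hkj hkl hjl] at hunion
  have hEunion := blocks_union (edgeSetoid (gamma m) π) (sector m {k}) (sector m {j, l})
  rw [sector_union hkj hkl hjl] at hEunion
  have hsub : {Quotient.mk π x, Quotient.mk π (gamma m x)} ⊆
      Quotient.mk π '' sector m {k} ∩ Quotient.mk π '' sector m {j, l} :=
    pair_subset_of_edge gamma_mem_sector gamma_mem_sector hx (hmem.2 hy) (hV (glue_self _ _ _))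
  have hsubn := ncard_le_ncard hsub (toFinite _)
  have hconn := connects_singleton π k
  have hEk := blocks_anti hσE (sector m {k})
  have hEb := hconn.blocks_le
  have hVE := blocks_anti hV univ
  have hσk : ∀ p ∈ sector m {k}, σ p ∈ sector m {k} := fun p => (h.2.2.1 p).2
  -- Without loss of vertices on the annulus, `π` agrees there with `cycles (γ * σ)`, and so do the
  -- edge classes.
  have hEc : blocks π (sector m {j, l}) = blocks (cycles σ) (sector m {j, l}) →
      blocks (edgeSetoid (gamma m) π) (sector m {j, l}) =
        blocks (cycles σ) (sector m {j, l}) := by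
    intro hc
    rw [← hEU]
    have hrel : ∀ p ∈ sector m {j, l}, ∀ q ∈ sector m {j, l},
        π p q ↔ cycles (gamma m * σ) p q := fun p hp q hq =>
      ⟨rel_of_blocks_le hU (by omega) hp hq, fun h => hU h⟩
    refine blocks_congr fun p hp q hq => ?_
    have hp' := gamma_mem_sector p hp
    have hq' := gamma_mem_sector q hq
    rw [edgeSetoid_apply, edgeSetoid_apply, hrel p hp q hq, hrel _ hp' _ hq', hrel _ hp _ hq',
      hrel _ hq _ hp']
  -- If the joined edge is a loop, the disc is not a tree and loses a vertex, while at least one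
  -- vertex is shared. Otherwise at least two are shared. Both cases allow at most `#σ - 1 = #V`
  -- vertices, so the lower bound forces equality.
  by_cases hl : π x (gamma m x)
  · have hxx : ({Quotient.mk π x, Quotient.mk π (gamma m x)} : Set (Quotient π)) =
        {Quotient.mk π x} := by rw [← mk_eq_mk.2 hl, pair_eq_singleton]
    rw [hxx] at hsub hsubn
    rw [ncard_singleton] at hsubn
    have hnt : blocks (edgeSetoid (gamma m) π) (sector m {k}) + 1 ≠ blocks π (sector m {k}) :=
      fun he => hconn.not_loop he.le hx hl
    have hC := (eq_of_subset_of_ncard_le hsub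
      (by rw [ncard_singleton]; omega) (toFinite _)).symm
    have hCE := ncard_common_edges_of_loop gamma_mem_sector gamma_mem_sector hl hC
    have hEc' := hEc (by omega)
    exact ⟨by omega, (eq_of_blocks_le hV (by omega)).symm,
      h.isDoubleUnicircuit hkj hkl hjl hU (by omega) hEc', Or.inr ⟨hl,
      (isDoubleUniloopAt_iff hm).2 ⟨x, hx, rfl, hl, isDoubledOn_of_blocks h.1 hU hσk (by omega),
        by omega⟩, hC⟩⟩
  · rw [ncard_pair fun he => hl (mk_eq_mk.1 he)] at hsubn
    have hC := (eq_of_subset_of_ncard_le hsub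
      (by rw [ncard_pair fun he => hl (mk_eq_mk.1 he)]; omega) (toFinite _)).symm
    have hEc' := hEc (by omega)
    have hCE := ncard_common_edges gamma_mem_sector gamma_mem_sector
      (fun z hz => hconn.not_loop (by omega) hz) ((inter_comm _ _).trans hC)
    rw [inter_comm] at hCE
    exact ⟨by omega, (eq_of_blocks_le hV (by omega)).symm,
      h.isDoubleUnicircuit hkj hkl hjl hU (by omega) hEc', Or.inl ⟨hl,
      (isDoubleTree_iff hm).2 ⟨by omega, isDoubledOn_of_blocks h.1 hU hσk (by omega)⟩, hC⟩⟩

theorem IsAnnular.merged_structure (hm : ∀ j, 0 < m j) (h : IsAnnular k σ) (hkj : k ≠ j)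
    (hkl : k ≠ l) (hjl : j ≠ l) (ht : (throughStrings σ).ncard ≠ 2) (hx : x.1 = k) (hy : y.1 ≠ k)
    (hV : V = glue (cycles σ) x y) (hf : f ∈ orientations σ)
    (hπ : π = merged (gamma m) V σ f) :
    cycles (gamma m * σ) ≤ π ∧ blocks π univ = blocks V univ ∧
      edgeSetoid (gamma m) π = V ∧ IsDoubleUnicircuit π j l ∧
      ((¬ π x (gamma m x) ∧ (quotientGraph π {k}).IsDoubleTree ∧
        Quotient.mk π '' sector m {k} ∩ Quotient.mk π '' sector m {j, l} =
          {Quotient.mk π x, Quotient.mk π (gamma m x)}) ∨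
      (π x (gamma m x) ∧ (quotientGraph π {k}).IsDoubleUniloopAt (Quotient.mk π x) ∧
        Quotient.mk π '' sector m {k} ∩ Quotient.mk π '' sector m {j, l} =
          {Quotient.mk π x})) := by
  subst hV hπ
  exact ⟨cycles_le_merged, h.union_structure hm hkj hkl hjl ht hx hy cycles_le_merged
    (le_edgeSetoid_merged h.1 (le_glue _ _ _) hf) (h.blocks_merged hx hy hf)⟩

/-- The loop in a merged partition comes from a single through string. -/
theorem IsAnnular.loop_iff (hm : ∀ j, 0 < m j) (h : IsAnnular k σ)
    (ht : (throughStrings σ).ncard ≠ 2) (hx : x.1 = k) (hy : y.1 ≠ k)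
    (hV : V = glue (cycles σ) x y) (hf : f ∈ orientations σ) :
    merged (gamma m) V σ f x (gamma m x) ↔ (V, σ) ∈ PS11NC2Through m := by
  obtain ⟨j, l, hkj, hkl, hjl⟩ := exists_two_others k
  have key : ∀ x y : Point m, x.1 = k → y.1 ≠ k → V = glue (cycles σ) x y →
      (merged (gamma m) V σ f x (gamma m x) ↔ ∀ u, (σ u).1 ≠ u.1 ↔ u = y ∨ u = σ y) := by
    intro x y hx hy hV
    obtain ⟨h1, h2, h3, h4, -⟩ := h.merged_structure hm hkj hkl hjl ht hx hy hV hf rfl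
    have hxy : edgeSetoid (gamma m) (merged (gamma m) V σ f) x y := by
      rw [h3, hV]; exact glue_self _ _ _
    constructor
    · intro hl u
      refine h4.through_of_loop hkj hkl hjl h h1 ?_ hy (rel_gamma_of_edgeSetoid le_rfl hxy hl) u
      intro p q hp hq hpq
      rw [h3, hV] at hpq
      exact h.cycles_of_glue hx hy hpq (iff_of_false hp hq)
    · intro hu
      exact rel_gamma_of_edgeSetoid le_rfl ((edgeSetoid _ _).symm' hxy) (h1 (h.loop_of_through hu))
  constructor
  · intro hl
    exact (mem_PS11NC2Through_iff hm).2 ⟨k, x, y, h, hx, hy, hV, (key x y hx hy hV).1 hl⟩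
  · intro hT
    obtain ⟨k', x', y', h', hx', hy', hV', hu⟩ := (mem_PS11NC2Through_iff hm).1 hT
    obtain rfl := h.eq h'
    have h3 := (h.merged_structure hm hkj hkl hjl ht hx hy hV hf rfl).2.2.1
    -- The gluing points `x'` and `y'` need not be `x` and `y`, but both pairs generate the same
    -- partition `V`, so the loop carries over to `x`.
    refine rel_gamma_of_edgeSetoid le_rfl ?_ ((key x' y' hx' hy' hV').2 hu)
    have h5 : glue (cycles σ) x' y' x y := by rw [← hV', hV]; exact glue_self _ _ _
    rw [h3, hV']
    rcases h5 with h6 | ⟨h6, h7⟩ | ⟨h6, -⟩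
    · exact absurd h6 (h.not_cycles hx hy)
    · exact le_glue _ _ _ ((cycles σ).symm' h6)
    · exact absurd h6 (h.not_cycles hx hy')

theorem ncard_ne_two_of_through (hm : ∀ j, 0 < m j) (h : (V, σ) ∈ PS11NC2Through m) :
    (throughStrings σ).ncard ≠ 2 := by
  obtain ⟨k, x, y, hA, -, -, -, hu⟩ := (mem_PS11NC2Through_iff hm).1 h
  rw [ncard_throughStrings_of_through hA.1 hu]
  decide

/-- A pairing of the edges of the union of two graphs, one of them a double unicircuit graph. -/
theorem exists_isAnnular (hm : ∀ j, 0 < m j) (hkj : k ≠ j) (hkl : k ≠ l) (hjl : j ≠ l)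
    (hD : IsDoubleUnicircuit π j l) (hk : IsDoubledOn (gamma m) π (sector m {k}))
    (hb : blocks (edgeSetoid (gamma m) π) (sector m {k}) ≤ blocks π (sector m {k})) :
    ∃ σ, IsAnnular k σ ∧ cycles (gamma m * σ) ≤ π ∧
      ∀ p q : Point m, (p.1 = k ↔ q.1 = k) → edgeSetoid (gamma m) π p q → cycles σ p q := by
  obtain ⟨hD1, hD2, x, y, hx, hy, hxy⟩ := (isDoubleUnicircuit_iff hjl).1 hD
  have hmem : ∀ {w : Point m}, w ∈ sector m {j, l} ↔ w.1 ≠ k := mem_sector_pair_iff hkj hkl hjl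
  obtain ⟨σ, hM, hσ, hU, huniq⟩ := exists_matching (γ := gamma m) (π := π)
    (fun x : Point m => x.1 = k) fun p => by
      by_cases hp : p.1 = k
      · obtain ⟨q, hq, h3, h4, h5, h6⟩ := hk p hp
        exact ⟨q, propext (iff_of_true hq hp), h3, h4, h5, fun z hz =>
          h6 z ((iff_of_eq hz).2 hp)⟩
      · obtain ⟨q, hq, h3, h4, h5, h6⟩ := hD2 p (hmem.2 hp)
        exact ⟨q, propext (iff_of_false (hmem.1 hq) hp), h3, h4, h5, fun z hz =>
          h6 z (hmem.2 fun hz' => hp ((iff_of_eq hz).1 hz'))⟩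
  have hσ : ∀ x, (σ x).1 = k ↔ x.1 = k := fun x => iff_of_eq (hσ x)
  have hE : ∀ p q : Point m, (p.1 = k ↔ q.1 = k) → edgeSetoid (gamma m) π p q → cycles σ p q :=
    fun p q hpq h => (cycles σ).symm' (hM.cycles_apply.2 (huniq q p (propext hpq) h))
  have hσE := cycles_le_edgeSetoid hM hU
  have hs : ∀ J, (∀ p ∈ sector m J, ∀ q ∈ sector m J, p.1 = k ↔ q.1 = k) →
      blocks (edgeSetoid (gamma m) π) (sector m J) = blocks (cycles σ) (sector m J) :=
    fun J hJ => blocks_congr fun p hp q hq => ⟨hE p q (hJ p hp q hq), fun h => hσE h⟩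
  have hsk := hs {k} fun p hp q hq => iff_of_true hp hq
  have hsc := hs {j, l} fun p hp q hq => iff_of_false (hmem.1 hp) (hmem.1 hq)
  have hxs : y = σ x := by
    rcases hM.cycles_apply.1 (hE x y (iff_of_false (hx ▸ hkj.symm) (hy ▸ hkl.symm)) hxy) with h | h
    · exact absurd (hx.symm.trans ((h ▸ rfl : x.1 = y.1).trans hy)) hjl
    · exact h
  have hσU := cycles_le_edgeSetoid hM (le_refl (cycles (gamma m * σ)))
  have hUk := (connects_singleton (cycles (gamma m * σ)) k).blocks_le
  have hUc := (connects_pair_of_edge hx hy (hxs ▸ hσU (cycles_self_apply σ x))).blocks_le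
  have a1 := blocks_anti hσU (sector m {k})
  have a2 := blocks_anti hσU (sector m {j, l})
  have a3 := blocks_anti hU (sector m {k})
  have a4 := blocks_anti hU (sector m {j, l})
  have h1 := sum_blocks_isolate (W := cycles σ) hkj hkl hjl fun p q => hM.fst_iff hσ
  have h2 := sum_blocks_isolate (W := cycles (gamma m * σ)) hkj hkl hjl fun p q hpq =>
    iff_of_eq (show (Setoid.ker fun p : Point m => p.1 = k) p q from
      cycles_le_iff.2 (fun p => propext (hσ p).symm) hpq)
  -- The counts give `#(γσ) - #σ` between 0 and 2, and parity excludes both ends of this range.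
  have hpar := even_blocks_cycles_mul (gamma m) σ
  rw [blocks_cycles_gamma hm, ← hM.two_mul_blocks] at hpar
  obtain ⟨r, hr⟩ := hpar
  exact ⟨σ, ⟨hM, by omega, hσ, x, by rw [← hxs, hx, hy]; exact hjl.symm⟩, hU, hE⟩

/-- This serves both types at once. The difference in the last hypothesis is 1 when the disc is a
double tree and 0 when it is a uniloop, so the hypothesis allows two shared vertices in the first
case and one in the second. -/
theorem exists_mem_image_merged (hm : ∀ j, 0 < m j) (hkj : k ≠ j) (hkl : k ≠ l) (hjl : j ≠ l)
    (hD : IsDoubleUnicircuit π j l) (hk : IsDoubledOn (gamma m) π (sector m {k}))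
    (hb : blocks (edgeSetoid (gamma m) π) (sector m {k}) ≤ blocks π (sector m {k}))
    (hx : x.1 = k) (hy : y.1 ≠ k) (hxy : edgeSetoid (gamma m) π x y)
    (hC : (Quotient.mk (edgeSetoid (gamma m) π) '' sector m {k} ∩
      Quotient.mk (edgeSetoid (gamma m) π) '' sector m {j, l}).ncard ≤ 1)
    (hle : blocks π (sector m {k}) + blocks π (sector m {j, l}) ≤ blocks π univ +
      (blocks π (sector m {k}) - blocks (edgeSetoid (gamma m) π) (sector m {k})) + 1) :
    ∃ σ, (edgeSetoid (gamma m) π, σ) ∈ PS11NC2 m ∧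
      (edgeSetoid (gamma m) π, σ) ∉ PS11NC2Two m ∧
      π ∈ merged (gamma m) (edgeSetoid (gamma m) π) σ '' orientations σ ∧
      (π x (gamma m x) ↔ (edgeSetoid (gamma m) π, σ) ∈ PS11NC2Through m) := by
  obtain ⟨σ, hA, hU, hE⟩ := exists_isAnnular hm hkj hkl hjl hD hk hb
  have hmem : ∀ {w : Point m}, w ∈ sector m {j, l} ↔ w.1 ≠ k := mem_sector_pair_iff hkj hkl hjl
  have hσE := cycles_le_edgeSetoid hA.1 hU
  have ht := hD.ncard_ne_two hkj hkl hjl hA hU fun p q hp hq => hE p q (iff_of_false hp hq)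
  have hD1 := ((isDoubleUnicircuit_iff hjl).1 hD).1
  have hs := (hA.blocks_eq hkj hkl hjl).1
  have hsk := blocks_congr (S := sector m {k}) (W := edgeSetoid (gamma m) π) (W' := cycles σ)
    fun p hp q hq => ⟨hE p q (iff_of_true hp hq), fun h => hσE h⟩
  have hsc := blocks_congr (S := sector m {j, l}) (W := edgeSetoid (gamma m) π) (W' := cycles σ)
    fun p hp q hq => ⟨hE p q (iff_of_false (hmem.1 hp) (hmem.1 hq)), fun h => hσE h⟩
  have hEunion := blocks_union (edgeSetoid (gamma m) π) (sector m {k}) (sector m {j, l})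
  rw [sector_union hkj hkl hjl] at hEunion
  have hglue := hA.blocks_glue hx hy
  have hV : edgeSetoid (gamma m) π = glue (cycles σ) x y :=
    (eq_of_blocks_le (glue_le hσE hxy) (by omega)).symm
  obtain ⟨f, hf, hfle⟩ := exists_merged_le hA.1 hU
  have hst := hA.merged_structure hm hkj hkl hjl ht hx hy hV hf rfl
  have hbV : blocks (edgeSetoid (gamma m) π) univ = blocks (glue (cycles σ) x y) univ := by
    rw [hV]
  have hπ : merged (gamma m) (edgeSetoid (gamma m) π) σ f = π := by
    refine eq_of_blocks_le hfle ?_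
    have := hst.2.1
    omega
  have hl := hA.loop_iff hm ht hx hy hV hf
  rw [hπ] at hl
  exact ⟨σ, (mem_PS11NC2_iff hm).2 ⟨k, x, y, hA, hx, hy, hV⟩, fun h => ht h.2, ⟨f, hf, hπ⟩, hl⟩

theorem mem_UC24_iff (hm : ∀ j, 0 < m j) :
    π ∈ UC24 m ↔ ∃ p ∈ PS11NC2 m \ (PS11NC2Two m ∪ PS11NC2Through m),
      π ∈ merged (gamma m) p.1 p.2 '' orientations p.2 := by
  constructor
  · rintro ⟨k, j, l, hkj, hkl, hjl, hT, hD, ε, hε⟩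
    obtain ⟨x, hx, y, hy, -, hxy, hC⟩ := joinedAlongEdge_iff.1 hε
    have hmem : ∀ {w : Point m}, w ∈ sector m {j, l} ↔ w.1 ≠ k := mem_sector_pair_iff hkj hkl hjl
    have hT' := (isDoubleTree_iff hm).1 hT
    have hnl : ∀ z ∈ sector m {k}, ¬ π z (gamma m z) := fun z hz =>
      (connects_singleton π k).not_loop hT'.1.le hz
    have hCE := ncard_common_edges gamma_mem_sector gamma_mem_sector hnl
      ((inter_comm _ _).trans hC)
    rw [inter_comm] at hCE
    have hunion := blocks_union π (sector m {k}) (sector m {j, l})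
    rw [sector_union hkj hkl hjl, hC, ncard_pair fun h => hnl x hx (mk_eq_mk.1 h)] at hunion
    obtain ⟨σ, h1, h2, h3, h4⟩ := exists_mem_image_merged hm hkj hkl hjl hD hT'.2 (by omega) hx
      (hmem.1 hy) hxy hCE (by omega)
    exact ⟨_, ⟨h1, fun h => h.elim h2 fun h => hnl x hx (h4.2 h)⟩, h3⟩
  · rintro ⟨⟨V, σ⟩, ⟨hp, hn⟩, f, hf, rfl⟩
    obtain ⟨k, x, y, hA, hx, hy, hV⟩ := (mem_PS11NC2_iff hm).1 hp
    obtain ⟨j, l, hkj, hkl, hjl⟩ := exists_two_others k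
    have ht : (throughStrings σ).ncard ≠ 2 := fun h => hn (Or.inl ⟨hp, h⟩)
    obtain ⟨h1, h2, h3, h4, h5⟩ := hA.merged_structure hm hkj hkl hjl ht hx hy hV hf rfl
    rcases h5 with ⟨h5, h6, h7⟩ | ⟨h5, -⟩
    · refine ⟨k, j, l, hkj, hkl, hjl, h6, h4, _,
        joinedAlongEdge_of_edge hx ((mem_sector_pair_iff hkj hkl hjl).2 hy) ?_ h7.le⟩
      change edgeSetoid (gamma m) (merged (gamma m) V σ f) x y
      rw [h3, hV]
      exact glue_self _ _ _
    · exact absurd (Or.inr ((hA.loop_iff hm ht hx hy hV hf).1 h5)) hn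

theorem mem_UL24_iff (hm : ∀ j, 0 < m j) :
    π ∈ UL24 m ↔ ∃ p ∈ PS11NC2Through m,
      π ∈ merged (gamma m) p.1 p.2 '' orientations p.2 := by
  constructor
  · rintro ⟨k, j, l, hkj, hkl, hjl, U, hT, hD, ⟨C, hC, hCU⟩, hJ⟩
    have hmem : ∀ {w : Point m}, w ∈ sector m {j, l} ↔ w.1 ≠ k := mem_sector_pair_iff hkj hkl hjl
    obtain ⟨x, hx, rfl, hl, hk, hb⟩ := (isDoubleUniloopAt_iff hm).1 hT
    have hJ : Quotient.mk π '' sector m {k} ∩ Quotient.mk π '' sector m {j, l} =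
      {Quotient.mk π x} := hJ
    have hCE := ncard_common_edges_of_loop gamma_mem_sector gamma_mem_sector hl hJ
    have hy : s(Quotient.mk π x, Quotient.mk π x) ∈
        (quotientGraph π {j, l}).elementarization.edgeSet := by
      have h1 : s(Quotient.mk π x, Quotient.mk π x) ∈ C.edgeSet := hCU ▸ rfl
      exact hC.1.edgeSet_mono h1
    obtain ⟨y, hy, hye⟩ := hy
    have hye : s(Quotient.mk π (gamma m y), Quotient.mk π y) =
      s(Quotient.mk π x, Quotient.mk π x) := hye
    have hy1 : π (gamma m y) x ∧ π y x := by
      rcases Sym2.eq_iff.1 hye with ⟨h1, h2⟩ | ⟨h1, h2⟩ <;> exact ⟨mk_eq_mk.1 h1, mk_eq_mk.1 h2⟩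
    have hxy : edgeSetoid (gamma m) π x y := edgeSetoid_apply.2 (Or.inl ⟨π.symm' hy1.2,
      π.trans' (π.symm' hl) (π.symm' hy1.1)⟩)
    have hunion := blocks_union π (sector m {k}) (sector m {j, l})
    rw [sector_union hkj hkl hjl, hJ, ncard_singleton] at hunion
    obtain ⟨σ, h1, h2, h3, h4⟩ := exists_mem_image_merged hm hkj hkl hjl hD hk hb.ge hx
      (hmem.1 hy) hxy hCE (by omega)
    exact ⟨_, h4.1 hl, h3⟩
  · rintro ⟨⟨V, σ⟩, hp, f, hf, rfl⟩
    obtain ⟨k, x, y, hA, hx, hy, hV, hu⟩ := (mem_PS11NC2Through_iff hm).1 hp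
    obtain ⟨j, l, hkj, hkl, hjl⟩ := exists_two_others k
    have ht := ncard_ne_two_of_through hm hp
    obtain ⟨h1, h2, h3, h4, h5⟩ := hA.merged_structure hm hkj hkl hjl ht hx hy hV hf rfl
    have hl := (hA.loop_iff hm ht hx hy hV hf).2 hp
    rcases h5 with ⟨h5, -⟩ | ⟨-, h6, h7⟩
    · exact absurd hl h5
    · refine ⟨k, j, l, hkj, hkl, hjl, _, h6, h4, exists_loop_circuit
        ⟨y, (mem_sector_pair_iff hkj hkl hjl).2 hy, ?_⟩, h7⟩
      have hxy : edgeSetoid (gamma m) (merged (gamma m) V σ f) y x := by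
        rw [h3, hV]; exact (glue _ _ _).symm' (glue_self _ _ _)
      rw [show (quotientGraph (merged (gamma m) V σ f) {j, l}).ends y =
        (quotientGraph (merged (gamma m) V σ f) {j, l}).ends x from ends_eq_iff'.2 hxy]
      change s(Quotient.mk _ (gamma m x), Quotient.mk _ x) = _
      rw [← mk_eq_mk.2 hl]

/-- The partition `V` is recovered as the edge partition of the quotient, and `V` determines the
pairing. -/
theorem eq_of_mem_image_merged (hm : ∀ j, 0 < m j)
    {B : Set (Setoid (Point m) × Equiv.Perm (Point m))}
    (hB : ∀ p ∈ B, p ∈ PS11NC2 m ∧ (throughStrings p.2).ncard ≠ 2) :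
    ∀ p ∈ B, ∀ p' ∈ B, ∀ π ∈ merged (gamma m) p.1 p.2 '' orientations p.2,
      π ∈ merged (gamma m) p'.1 p'.2 '' orientations p'.2 → p = p' := by
  have key : ∀ p ∈ B, ∀ π ∈ merged (gamma m) p.1 p.2 '' orientations p.2,
      edgeSetoid (gamma m) π = p.1 := by
    rintro ⟨V, σ⟩ hp π ⟨f, hf, rfl⟩
    obtain ⟨k, x, y, hA, hx, hy, hV⟩ := (mem_PS11NC2_iff hm).1 (hB _ hp).1
    obtain ⟨j, l, hkj, hkl, hjl⟩ := exists_two_others k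
    exact (hA.merged_structure hm hkj hkl hjl (hB _ hp).2 hx hy hV hf rfl).2.2.1
  rintro ⟨V, σ⟩ hp ⟨V', σ'⟩ hp' π hπ hπ'
  obtain rfl : V = V' := (key _ hp π hπ).symm.trans (key _ hp' π hπ')
  rw [eq_of_mem_PS11NC2 hm (hB _ hp).1 (hB _ hp').1]

/-- The only block of `V` with two pairs consists of loops at one vertex, so all orientations yield
the same quotient and each fibre has one element. -/
theorem ncard_UL24 (hm : ∀ j, 0 < m j) : (UL24 m).ncard = (PS11NC2Through m).ncard := by
  rw [← one_mul (PS11NC2Through m).ncard]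
  refine ncard_eq_mul (fun π => mem_UL24_iff hm) (eq_of_mem_image_merged hm fun p hp =>
    ⟨hp.1, ncard_ne_two_of_through hm hp⟩) ?_
  rintro ⟨V, σ⟩ hp
  obtain ⟨k, x, y, hA, hx, hy, hV⟩ := (mem_PS11NC2_iff hm).1 hp.1
  obtain ⟨j, l, hkj, hkl, hjl⟩ := exists_two_others k
  have ht := ncard_ne_two_of_through hm hp
  have hle : ∀ f ∈ orientations σ, ∀ f' ∈ orientations σ,
      merged (gamma m) V σ f ≤ merged (gamma m) V σ f' := by
    intro f hf f' hf'
    obtain ⟨h1, -, h3, -, -⟩ := hA.merged_structure hm hkj hkl hjl ht hx hy hV hf' rfl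
    have hl := (hA.loop_iff hm ht hx hy hV hf').2 hp
    refine merged_le h1 fun p q hpq hfpq => ?_
    by_cases hc : cycles σ p q
    · rcases hA.1.cycles_apply.1 hc with rfl | rfl
      · exact ⟨Setoid.refl' _ _, Setoid.refl' _ _⟩
      · rw [hf p] at hfpq
        exact absurd hfpq (by cases f p <;> simp)
    · set M := merged (gamma m) V σ f'
      have h4 : V p x ∧ V q x := by
        have hxy : V y x := by rw [hV]; exact (glue _ _ _).symm' (glue_self _ _ _)
        have hσV : cycles σ ≤ V := hV ▸ le_glue _ _ _
        rw [hV] at hpq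
        rcases hpq with h4 | ⟨h4, h5⟩ | ⟨h4, h5⟩
        · exact absurd h4 hc
        · exact ⟨hσV h4, V.trans' (hσV h5) hxy⟩
        · exact ⟨V.trans' (hσV h4) hxy, hσV h5⟩
      have h5 : ∀ p, V p x → M p x ∧ M (gamma m p) x := by
        intro p hpx
        rw [← h3] at hpx
        rcases edgeSetoid_apply.1 hpx with ⟨h6, h7⟩ | ⟨h6, h7⟩
        · exact ⟨h6, M.trans' h7 (M.symm' hl)⟩
        · exact ⟨M.trans' h6 (M.symm' hl), M.symm' h7⟩
      exact ⟨M.trans' (h5 p h4.1).1 (M.symm' (h5 q h4.2).1),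
        M.trans' (h5 p h4.1).2 (M.symm' (h5 q h4.2).2)⟩
  obtain ⟨f, hf⟩ := orientations_nonempty hA.1
  refine ncard_eq_one.2 ⟨merged (gamma m) V σ f, Subset.antisymm ?_ ?_⟩
  · rintro _ ⟨f', hf', rfl⟩
    exact le_antisymm (hle _ hf' _ hf) (hle _ hf _ hf')
  · rintro _ rfl
    exact ⟨f, hf, rfl⟩

/-- With the one-string joins removed, a block of `V` with two pairs contains no loops. Hence
`ncard_merged` applies and gives fibres of size `2 ^ (#σ - #V) = 2`. -/
theorem ncard_UC24 (hm : ∀ j, 0 < m j) :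
    (UC24 m).ncard = 2 * (PS11NC2 m \ (PS11NC2Two m ∪ PS11NC2Through m)).ncard := by
  have hB : ∀ p ∈ PS11NC2 m \ (PS11NC2Two m ∪ PS11NC2Through m),
      p ∈ PS11NC2 m ∧ (throughStrings p.2).ncard ≠ 2 := fun p hp =>
    ⟨hp.1, fun h => hp.2 (Or.inl ⟨hp.1, h⟩)⟩
  refine ncard_eq_mul (fun π => mem_UC24_iff hm) (eq_of_mem_image_merged hm hB) ?_
  rintro ⟨V, σ⟩ hp
  have ht := (hB _ hp).2
  obtain ⟨k, x, y, hA, hx, hy, hV⟩ := (mem_PS11NC2_iff hm).1 hp.1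
  obtain ⟨j, l, hkj, hkl, hjl⟩ := exists_two_others k
  have hσV : cycles σ ≤ V := hV ▸ le_glue _ _ _
  have h1 := ncard_merged (γ := gamma m) hA.1 hσV fun f hf p q hpq hl => by
    refine hA.1.cycles_apply.1 ?_
    by_contra hc
    have h3 := (hA.merged_structure hm hkj hkl hjl ht hx hy hV hf rfl).2.2.1
    refine hp.2 (Or.inr ((hA.loop_iff hm ht hx hy hV hf).1 (rel_gamma_of_edgeSetoid le_rfl ?_ hl)))
    rw [h3]
    have hxy : V y x := by rw [hV]; exact (glue _ _ _).symm' (glue_self _ _ _)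
    rw [hV] at hpq
    rcases hpq with h4 | ⟨h4, h5⟩ | ⟨h4, h5⟩
    · exact absurd h4 hc
    · exact hσV h4
    · exact V.trans' (hσV h4) hxy
  have h2 := hA.blocks_glue hx hy
  rw [← hV] at h2
  rw [← h2, pow_succ, mul_comm _ 2] at h1
  exact Nat.eq_of_mul_eq_mul_right (by positivity) h1

theorem ncard_PS11NC2 (hm : ∀ j, 0 < m j) :
    (PS11NC2 m).ncard = (PS11NC2 m \ (PS11NC2Two m ∪ PS11NC2Through m)).ncard +
      ((PS11NC2Two m).ncard + (PS11NC2Through m).ncard) := by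
  rw [← ncard_union_eq (s := PS11NC2Two m) _ (toFinite _) (toFinite _),
    ncard_sdiff_add_ncard_of_subset _ (toFinite _)]
  · rintro p (hp | hp)
    · exact hp.1
    · exact hp.1
  · rw [disjoint_left]
    exact fun p hp hp' => ncard_ne_two_of_through hm hp' hp.2

end Unicircuit
end LimitGraphs

namespace LimitGraphs
open Set

/-! ### Exchanging a through string for two fixed points -/

section FixedPoints

variable {m : Fin 3 → ℕ} {V : Setoid (Point m)} {σ τ : Equiv.Perm (Point m)} {x y z : Point m}

/-- `σ` respects the discs, and its cycles have size two except for the fixed points `x` and `y`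
in different discs. -/
def IsPairingExcept (σ : Equiv.Perm (Point m)) (x y : Point m) : Prop :=
  x.1 ≠ y.1 ∧ σ x = x ∧ σ y = y ∧ (∀ u, u ≠ x → u ≠ y → σ u ≠ u) ∧ (∀ u, σ (σ u) = u) ∧
    ∀ u, (σ u).1 = u.1

theorem IsPairingExcept.apply (h : IsPairingExcept σ x y) :
    (σ * Equiv.swap x y) x = y ∧ (σ * Equiv.swap x y) y = x ∧
      ∀ u, u ≠ x → u ≠ y → (σ * Equiv.swap x y) u = σ u := by
  refine ⟨by simp [h.2.2.1], by simp [h.2.1], fun u hx hy => ?_⟩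
  rw [Equiv.Perm.mul_apply, Equiv.swap_apply_of_ne_of_ne hx hy]

theorem IsPairingExcept.isMatching (h : IsPairingExcept σ x y) :
    IsMatching (σ * Equiv.swap x y) := by
  obtain ⟨hx, hy, ha⟩ := h.apply
  have hxy : x ≠ y := fun he => h.1 (he ▸ rfl)
  intro u
  by_cases h1 : u = x
  · subst h1; rw [hx, hy]; exact ⟨hxy.symm, rfl⟩
  by_cases h2 : u = y
  · subst h2; rw [hy, hx]; exact ⟨hxy, rfl⟩
  rw [ha u h1 h2]
  refine ⟨h.2.2.2.1 u h1 h2, ?_⟩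
  rw [ha, h.2.2.2.2.1 u]
  · intro h3
    exact h1 (by rw [← h.2.2.2.2.1 u, h3, h.2.1])
  · intro h3
    exact h2 (by rw [← h.2.2.2.2.1 u, h3, h.2.2.1])

theorem IsPairingExcept.through (h : IsPairingExcept σ x y) (u : Point m) :
    ((σ * Equiv.swap x y) u).1 ≠ u.1 ↔ u = x ∨ u = (σ * Equiv.swap x y) x := by
  obtain ⟨hx, hy, ha⟩ := h.apply
  rw [hx]
  by_cases h1 : u = x
  · subst h1; rw [hx]; exact iff_of_true h.1.symm (Or.inl rfl)
  by_cases h2 : u = y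
  · subst h2; rw [hy]; exact iff_of_true h.1 (Or.inr rfl)
  rw [ha u h1 h2, h.2.2.2.2.2 u]
  simp [h1, h2]

theorem IsPairingExcept.cycles_eq (h : IsPairingExcept σ x y) :
    cycles (σ * Equiv.swap x y) = glue (cycles σ) x y :=
  cycles_mul_swap fun h1 => h.1 (cycles_fst_eq h.2.2.2.2.2 h1)

/-- Since `x` and `y` lie in different discs, the transposition merges two cycles of `σ` and two of
`γ * σ`. This converts the Euler relation for three discs into that for an annulus and a disc. -/
theorem IsPairingExcept.mem_NCDiscs_iff (hm : ∀ j, 0 < m j) (h : IsPairingExcept σ x y) :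
    σ ∈ NCDiscs m ↔ blocks (cycles (gamma m * (σ * Equiv.swap x y))) univ =
      blocks (cycles (σ * Equiv.swap x y)) univ + 1 := by
  have hinv : σ⁻¹ = σ := inv_eq_of_mul_eq_one_left (Equiv.ext h.2.2.2.2.1)
  have h1 : blocks (glue (cycles σ) x y) univ + 1 = blocks (cycles σ) univ :=
    blocks_glue_univ fun h1 => h.1 (cycles_fst_eq h.2.2.2.2.2 h1)
  have hγ : ¬ cycles (gamma m * σ) x y := fun h1 =>
    h.1 (cycles_fst_eq (σ := gamma m * σ) (fun u => h.2.2.2.2.2 u) h1)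
  have h2 := blocks_glue_univ hγ
  have h3 := h.isMatching.two_mul_blocks
  rw [LimitGraphs.mem_NCDiscs_iff hm, hinv, blocks_cycles_mul_comm, ← mul_assoc, cycles_mul_swap hγ,
    and_iff_left h.2.2.2.2.2]
  rw [h.cycles_eq] at h3 ⊢
  omega

theorem mem_PS111NC211_iff (hm : ∀ j, 0 < m j) :
    (V, σ) ∈ PS111NC211 m ↔ σ ∈ NCDiscs m ∧ ∃ x y z, IsPairingExcept σ x y ∧
      TreeForm V σ x y x z := by
  constructor
  · rintro ⟨hp, i₁, i₂, i₃, h12, h13, h23, c₁, c₂, c₃, l₁, l₂, l₃, s₁, s₂, hs, b, hb⟩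
    obtain ⟨hσ, a, a', a₁, a₂, hT, hV⟩ := (mem_PS111_iff hm).1 hp
    have hfst := ((mem_NCDiscs_iff hm).1 hσ).2
    induction c₁ using Quotient.ind with
    | _ x =>
    induction c₂ using Quotient.ind with
    | _ y =>
    induction c₃ using Quotient.ind with
    | _ z =>
    have hx : x.1 = i₁ := l₁ x rfl
    have hy : y.1 = i₂ := l₂ y rfl
    have hz : z.1 = i₃ := l₃ z rfl
    have hmem : ∀ c ∈ ({Quotient.mk (cycles σ) x, Quotient.mk (cycles σ) y,
        Quotient.mk (cycles σ) z} : Set (Quotient (cycles σ))), c ∈ cyclesIn V σ b := fun c hc =>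
      hb ▸ hc
    have bx : Quotient.mk V x = b := hmem _ (Or.inl rfl) x rfl
    have by' : Quotient.mk V y = b := hmem _ (Or.inr (Or.inl rfl)) y rfl
    have bz : Quotient.mk V z = b := hmem _ (Or.inr (Or.inr rfl)) z rfl
    have hfx : σ x = x := cycleSize_eq_one_iff.1 s₁
    have hfy : σ y = y := cycleSize_eq_one_iff.1 s₂
    have hs' : ∀ u, u ≠ x → u ≠ y → σ u ≠ u ∧ σ (σ u) = u := fun u hux huy =>
      cycleSize_eq_two_iff.1 (hs _
        (fun h => hux ((cycles_of_apply_eq hfx).1 (mk_eq_mk.1 h.symm)))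
        (fun h => huy ((cycles_of_apply_eq hfy).1 (mk_eq_mk.1 h.symm))))
    have hT' : TreeForm (glue (glue (cycles σ) x y) x z) σ x y x z :=
      ⟨by rw [hx, hy]; exact h12, by rw [hx, hz]; exact h13.symm, by rw [hy, hz]; exact h23.symm,
        by rw [hx, hz]; exact h13, rfl⟩
    have hVeq : glue (glue (cycles σ) x y) x z = V := by
      refine eq_of_blocks_le (glue_le (glue_le hT.cycles_le (mk_eq_mk.1 (bx.trans by'.symm)))
        (mk_eq_mk.1 (bx.trans bz.symm))) ?_
      have h1 := hT'.blocks_add_two hfst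
      have h2 := hT.blocks_add_two hfst
      omega
    refine ⟨hσ, x, y, z, ⟨hT'.1, hfx, hfy, fun u h1 h2 => (hs' u h1 h2).1, fun u => ?_, hfst⟩,
      hVeq ▸ hT'⟩
    by_cases h1 : u = x
    · rw [h1, hfx, hfx]
    by_cases h2 : u = y
    · rw [h2, hfy, hfy]
    exact (hs' u h1 h2).2
  · rintro ⟨hσ, x, y, z, h, hT⟩
    have hfst := h.2.2.2.2.2
    refine ⟨(mem_PS111_iff hm).2 ⟨hσ, x, y, x, z, hT, V.refl' x⟩, x.1, y.1, z.1, hT.1,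
      hT.2.1.symm, hT.2.2.1.symm, Quotient.mk _ x, Quotient.mk _ y, Quotient.mk _ z,
      fun p hp => cycles_fst_eq hfst (mk_eq_mk.1 hp), fun p hp => cycles_fst_eq hfst (mk_eq_mk.1 hp),
      fun p hp => cycles_fst_eq hfst (mk_eq_mk.1 hp), cycleSize_eq_one_iff.2 h.2.1,
      cycleSize_eq_one_iff.2 h.2.2.1, fun c hx hy => ?_, _,
      (hT.ncard_of_rel hfst (V.refl' x)).2.1⟩
    induction c using Quotient.ind with
    | _ u =>
    exact cycleSize_eq_two_iff.2 ⟨h.2.2.2.1 u (fun hu => hx (hu ▸ rfl)) fun hu => hy (hu ▸ rfl),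
      h.2.2.2.2.1 u⟩

theorem eq_of_mem_PS111NC211 (hm : ∀ j, 0 < m j) (h : (V, σ) ∈ PS111NC211 m)
    (h' : (V, τ) ∈ PS111NC211 m) : σ = τ := by
  obtain ⟨-, x, y, z, h1, hT⟩ := (mem_PS111NC211_iff hm).1 h
  obtain ⟨-, x', y', z', h1', hT'⟩ := (mem_PS111NC211_iff hm).1 h'
  have hfst := h1.2.2.2.2.2
  have hfst' := h1'.2.2.2.2.2
  refine Equiv.ext fun u => ?_
  have h2 : cycles τ u (σ u) := hT'.cycles_of_fst_eq hfst'
    (hT.cycles_le (cycles_self_apply σ u)) (hfst u).symm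
  have h3 : cycles σ u (τ u) := hT.cycles_of_fst_eq hfst
    (hT'.cycles_le (cycles_self_apply τ u)) (hfst' u).symm
  rcases (cycles_of_apply_apply_eq (h1'.2.2.2.2.1 u)).1 h2 with h4 | h4
  · rw [h4, (cycles_of_apply_eq h4).1 h3]
  · exact h4

/-- Multiplying by the transposition of the two fixed points creates the through string, and
multiplying by it again cuts the string. The partition `V` is the same on both sides, because gluing
the fixed points is the first of its two gluings. -/
theorem image_fst_PS111NC211 (hm : ∀ j, 0 < m j) :
    Prod.fst '' PS111NC211 m = Prod.fst '' PS11NC2Through m := by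
  ext V
  constructor
  · rintro ⟨⟨V, σ⟩, h, rfl⟩
    obtain ⟨hσ, x, y, z, h, hT⟩ := (mem_PS111NC211_iff hm).1 h
    obtain ⟨hx, hy, ha⟩ := h.apply
    refine ⟨(V, σ * Equiv.swap x y), (mem_PS11NC2Through_iff hm).2 ⟨z.1, z, x, ⟨h.isMatching,
      (h.mem_NCDiscs_iff hm).1 hσ, fun u => ?_, x, ?_⟩, rfl, hT.2.1.symm, ?_, h.through⟩, rfl⟩
    · by_cases h1 : u = x
      · subst h1; rw [hx]; exact iff_of_false hT.2.2.1.symm hT.2.1.symm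
      by_cases h2 : u = y
      · subst h2; rw [hy]; exact iff_of_false hT.2.1.symm hT.2.2.1.symm
      rw [ha u h1 h2, h.2.2.2.2.2 u]
    · rw [hx]; exact h.1.symm
    · rw [h.cycles_eq, glue_comm]
      exact hT.2.2.2.2
  · rintro ⟨⟨V, τ⟩, h, rfl⟩
    obtain ⟨k, z, x, hA, rfl, hx, hV, ht⟩ := (mem_PS11NC2Through_iff hm).1 h
    have hxt : (τ x).1 ≠ x.1 := (ht x).2 (Or.inl rfl)
    have hxx : τ (τ x) = x := (hA.1 x).2
    have ha : ∀ u, u ≠ x → u ≠ τ x → (τ * Equiv.swap x (τ x)) u = τ u := fun u hx hy => by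
      rw [Equiv.Perm.mul_apply, Equiv.swap_apply_of_ne_of_ne hx hy]
    have hτ : τ * Equiv.swap x (τ x) * Equiv.swap x (τ x) = τ := by
      rw [mul_assoc, Equiv.swap_mul_self, mul_one]
    have hP : IsPairingExcept (τ * Equiv.swap x (τ x)) x (τ x) := by
      have e1 : (τ * Equiv.swap x (τ x)) x = x := by simp [hxx]
      have e2 : (τ * Equiv.swap x (τ x)) (τ x) = τ x := by simp
      refine ⟨hxt.symm, e1, e2, fun u h1 h2 => ?_, fun u => ?_, fun u => ?_⟩
      · rw [ha u h1 h2]; exact (hA.1 u).1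
      · by_cases h1 : u = x
        · rw [h1, e1, e1]
        by_cases h2 : u = τ x
        · rw [h2, e2, e2]
        rw [ha u h1 h2, ha, (hA.1 u).2]
        · exact fun h3 => h2 (by rw [← h3, (hA.1 u).2])
        · exact fun h3 => h1 (τ.injective h3)
      · by_cases h1 : u = x
        · rw [h1, e1]
        by_cases h2 : u = τ x
        · rw [h2, e2]
        rw [ha u h1 h2]
        by_contra h3
        exact ((ht u).1 h3).elim h1 h2
    refine ⟨(V, τ * Equiv.swap x (τ x)), (mem_PS111NC211_iff hm).2 ⟨(hP.mem_NCDiscs_iff hm).2 ?_,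
      x, τ x, z, hP, hxt.symm, hx.symm, ?_, hx, ?_⟩, rfl⟩
    · rw [hτ]; exact hA.2.1
    · exact fun h1 => hx ((hA.2.2.1 x).1 h1.symm)
    · rw [← hP.cycles_eq, hτ, glue_comm]
      exact hV

theorem ncard_PS111NC211 (hm : ∀ j, 0 < m j) :
    (PS111NC211 m).ncard = (PS11NC2Through m).ncard := by
  have h1 : InjOn Prod.fst (PS111NC211 m) := by
    rintro ⟨V, σ⟩ h ⟨V', σ'⟩ h' rfl
    rw [eq_of_mem_PS111NC211 hm h h']
  have h2 : InjOn Prod.fst (PS11NC2Through m) := by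
    rintro ⟨V, σ⟩ h ⟨V', σ'⟩ h' rfl
    rw [eq_of_mem_PS11NC2 hm h.1 h'.1]
  -- In both sets the partition determines the permutation, so it suffices to compare the sets of
  -- partitions.
  rw [← h1.ncard_image, image_fst_PS111NC211 hm, h2.ncard_image]

end FixedPoints
end LimitGraphs

theorem mainTheorem9 (m : Fin 3 → ℕ) (hm : ∀ j, 0 < m j) :
    (LimitGraphs.T26 m).ncard = 4 * (LimitGraphs.PS111NC2 m).ncard ∧
    (LimitGraphs.T244 m).ncard = 4 * (LimitGraphs.PS211NC2 m).ncard ∧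
    (LimitGraphs.UL24 m).ncard = (LimitGraphs.PS111NC211 m).ncard ∧
    (LimitGraphs.PS111NC211 m).ncard = (LimitGraphs.PS11NC2Through m).ncard ∧
    ((LimitGraphs.UC24 m).ncard : ℤ) =
      2 * ((LimitGraphs.PS11NC2 m).ncard : ℤ) - 2 * ((LimitGraphs.PS11NC2Two m).ncard : ℤ)
        - 2 * ((LimitGraphs.PS11NC2Through m).ncard : ℤ) := by
  refine ⟨LimitGraphs.ncard_T26 hm, LimitGraphs.ncard_T244 hm,
    (LimitGraphs.ncard_UL24 hm).trans (LimitGraphs.ncard_PS111NC211 hm).symm,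
    LimitGraphs.ncard_PS111NC211 hm, ?_⟩
  rw [LimitGraphs.ncard_UC24 hm, LimitGraphs.ncard_PS11NC2 hm]
  push_cast
  ring
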